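/- **Setting.** Let $r\ge 0$, $q=e^{-r}$, and let $\hbar$ be the Planck parameter. $\mathcal U_q^\hbar(\mathfrak{sl}_2)$ is the algebra generated by $H$, $K^{\pm 1/2}=e^{\mp rH/2}$, $E$, $F$ with relations $K^{1/2}K^{-1/2}=K^{-1/2}K^{1/2}=1$, $HK^{1/2}=K^{1/2}H$, $K^{1/2}EK^{-1/2}=q^{\hbar}E$, $K^{1/2}FK^{-1/2}=q^{-\hbar}F$, $[H,E]=2\hbar E$, $[H,F]=-2\hbar F$, $[E,F]=\hbar\frac{K^{-1}-K}{2r}$ (for $r=0$: $K^{1/2}=1$ and $[E,F]=\hbar H$), and coproduct $\Delta_r H=H\otimes 1+1\otimes H$, $\Delta_r K^{\pm1/2}=K^{\pm1/2}\otimes K^{\pm1/2}$, $\Delta_r X=X\otimes K^{-1/2}+K^{1/2}\otimes X$ for $X=E,F$. An observable $\mathcal F\in\mathcal U_q^\hbar(\mathfrak{sl}_2)$ is an element of this algebra whose coefficients are functions of $\hbar$ smooth at $\hbar=0$. The group $(SU_2^*)_r$ is $\{g=(H,F)\in\mathbb R\times\mathbb C\}$, identified for $r>0$ with the matrices $\begin{pmatrix}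 e^{rH/2}&0\\ 2rF&e^{-rH/2}\end{pmatrix}$, with the group law $(H_1,F_1)(H_2,F_2)=(H_1+H_2,\;F_1e^{rH_2/2}+e^{-rH_1/2}F_2)$, which is matrix multiplication (addition for $r=0$); put $E=\overline F$. The function $f=\mathcal F \bmod \hbar$ on $(SU_2^*)_r$ is obtained from $\mathcal F$ by putting $\hbar=0$ and reading $H,K^{\pm1/2}=e^{\mp rH/2},E,F$ as coordinate functions. $SU_2$ acts on $(SU_2^*)_r$ by the dressing action: for $r>0$, $k\cdot b=b'$ where $kb=b'k'$ with $b'$ lower triangular with positive diagonal and $k'\in SU_2$; for $r=0$ it is the coadjoint action, i.e. conjugation of $\begin{pmatrix}H&2\overline F\\2F&-H\end{pmatrix}$. $\mathcal O_r(\Lambda)$ is the orbit of the point $H=\Lambda$, $F=0$ (for $r>0$ the matrix $\mathrm{diag}(e^{r\Lambda/2},e^{-r\Lambda/2})$), and its uniform measure is the image of the Haar probability measure of $SU_2$. For $r>0$, $\Lambda(g)\ge0$ is the number with $g\in\mathcal O_r(\Lambda(g))$. For $\Lambda>0$, $\hbar>0$ let $n=\lfloor\Lambda/\hbar\rfloor$,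 $\Lambda^\hbar=\hbar n$, and let $V^q(\Lambda^\hbar)$ be the representation of dimension $n+1$ with basis $e_{\hbar k}$, $k=-n,-n+2,\dots,n$, on which $He_{\hbar k}=\hbar k\,e_{\hbar k}$, $K^{\pm1/2}e_{\hbar k}=e^{\mp r\hbar k/2}e_{\hbar k}$, $Ee_{\hbar k}=c_{k+1}e_{\hbar(k+2)}$, $Fe_{\hbar k}=c_{k-1}e_{\hbar(k-2)}$, where $c_m=\frac1{2r}\sqrt{\frac{2r\hbar}{e^{r\hbar}-e^{-r\hbar}}}\sqrt{e^{r(\Lambda^\hbar+\hbar)}+e^{-r(\Lambda^\hbar+\hbar)}-e^{r\hbar m}-e^{-r\hbar m}}$ (for $r=0$: $c_m=\frac{\hbar}{2}\sqrt{(n+1)^2-m^2}$). Tensor products are representations through $\Delta_r$. $\operatorname{Tr}$ is the trace and $\operatorname{tr}=\operatorname{Tr}/\dim$. For $r>0$ set $$C^{r,\hbar}=\tfrac12\Big(4r^2EF+\tfrac{2r\hbar}{e^{r\hbar}-e^{-r\hbar}}\big(e^{r\hbar}K+e^{-r\hbar}K^{-1}\big)\Big),\qquad \Lambda^{r,\hbar}=\tfrac1r\operatorname{Argcosh}\Big(\tfrac{e^{r\hbar}-e^{-r\hbar}}{2r\hbar}C^{r,\hbar}\Big)-\hbar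 ,$$ where $\Lambda^{r,\hbar}$ acts on finite-dimensional representations as above by functional calculus. For $n\in\mathbb N$ the crystal $\mathcal B(\hbar n)$ is the chain with elements of weights $-\hbar n,-\hbar n+2\hbar,\dots,\hbar n$. In $\mathcal B(\hbar n_1)\otimes\mathcal B(\hbar n_2)$ the weight is $\mathrm{wt}(b_1\otimes b_2)=\mathrm{wt}(b_1)+\mathrm{wt}(b_2)$ and the raising operator acts on $b_1$ if $\varphi(b_1)\ge\varepsilon(b_2)$ and on $b_2$ otherwise, where $\varphi(b)$, $\varepsilon(b)$ are the numbers of times the lowering, resp. raising, operator can be applied to $b$; $\mathrm{hw}(b_1\otimes b_2)$ is the highest weight of the connected component of $b_1\otimes b_2$. For real numbers let $\mathrm{hw}_{\Lambda_1,\Lambda_2}(\mu_1,\mu_2)=\max(\Lambda_1+\mu_2,-\mu_1+\Lambda_2)$. **Theorem.** Let $\Lambda_1,\Lambda_2>0$ and, for $r\ge0$, let $g_1,g_2$ be independent and uniformly distributed on $\mathcal O_r(\Lambda_1)$ and $\mathcal O_r(\Lambda_2)$. 1. For all $r\ge0$ and all observables $\mathcal F$, with $f=\mathcal F\bmod\hbar$,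 the variables $f(g_1)$ and $f(g_1g_2)$ are integrable and, as $\hbar\to0^+$, $$\frac{\operatorname{Tr}_{V^q(\Lambda_1^\hbar)}(q^{-H}\mathcal F)}{\operatorname{Tr}_{V^q(\Lambda_1^\hbar)}(q^{-H})}\to\mathbb E f(g_1),\qquad \frac{\operatorname{Tr}_{V^q(\Lambda_1^\hbar)\otimes V^q(\Lambda_2^\hbar)}(q^{-H}\mathcal F)}{\operatorname{Tr}_{V^q(\Lambda_1^\hbar)\otimes V^q(\Lambda_2^\hbar)}(q^{-H})}\to\mathbb E f(g_1g_2).$$ 2. Let $\varphi,\psi\in\mathbb C[X]$ and $$A_{r,\hbar}=\operatorname{tr}_{V^q(\Lambda_1^\hbar)\otimes V^q(\Lambda_2^\hbar)}[\varphi(\Lambda^{r,\hbar})\psi(H)],\qquad B_r=\frac{\mathbb E\big(e^{-rH(g_1g_2)}\varphi(\Lambda(g_1g_2))\psi(H(g_1g_2))\big)}{\mathbb E\big(e^{-rH(g_1g_2)}\big)},$$ $$C_\hbar=\sum_{b_1\otimes b_2\in\mathcal B(\Lambda_1^\hbar)\otimes\mathcal B(\Lambda_2^\hbar)}\frac{\varphi(\mathrm{hw}(b_1\otimes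 b_2))\,\psi(\mathrm{wt}(b_1\otimes b_2))}{(\lfloor\Lambda_1/\hbar\rfloor+1)(\lfloor\Lambda_2/\hbar\rfloor+1)},$$ $$D=\frac1{4\Lambda_1\Lambda_2}\int_{-\Lambda_1}^{\Lambda_1}\!\int_{-\Lambda_2}^{\Lambda_2}\varphi(\mathrm{hw}_{\Lambda_1,\Lambda_2}(\mu_1,\mu_2))\,\psi(\mu_1+\mu_2)\,d\mu_2\,d\mu_1 .$$ The random variables in $B_r$ are integrable, $A_{r,\hbar}\to B_r$ as $\hbar\to0^+$ for every $r>0$, $A_{r,\hbar}\to C_\hbar$ as $r\to\infty$ for every $\hbar>0$, $C_\hbar\to D$ as $\hbar\to0^+$, and $B_r\to D$ as $r\to\infty$. 3. For all $\hbar>0$, $n_1,n_2\in\mathbb N$ and $b_i\in\mathcal B(\hbar n_i)$, one has $\mathrm{hw}(b_1\otimes b_2)=\max(\hbar n_1+\mathrm{wt}(b_2),\,-\mathrm{wt}(b_1)+\hbar n_2)$. -/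

import Mathlib

open MeasureTheory ProbabilityTheory Filter Topology Polynomial
open scoped TensorProduct Matrix

namespace StaticLimits

/-! ### The quantum group, by generators and relations

The base ring `S` is either `ℂ` (numerical Planck constant) or a ring of functions of the
Planck constant.  `h : S` plays the role of `ħ` and `Q : S` the role of `q ^ ħ = e ^ (-r ħ)`. -/

/-- Generators: `H`, `K^{1/2} = e^{-rH/2}`, `K^{-1/2} = e^{rH/2}`, `E`, `F`. -/
inductive Gen : Type
  | H | k | kInv | E | F

/-- The element `(e^{rH} - e^{-rH}) / (2r) = (K⁻¹ - K) / (2r)`, read as `H` when `r = 0`. -/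
noncomputable def curvedH (S : Type*) [CommRing S] [Algebra ℂ S] (r : ℝ)
    {B : Type*} [Ring B] [Algebra S B] (x : Gen → B) : B :=
  if r = 0 then x .H
  else algebraMap ℂ S (1 / (2 * r)) • (x .kInv * x .kInv - x .k * x .k)

/-- The defining relations. The relation `k_F` is `K^{1/2} F K^{-1/2} = q^{-ħ} F`. -/
structure IsQTuple {S : Type*} [CommRing S] [Algebra ℂ S] (r : ℝ) (h Q : S)
    {B : Type*} [Ring B] [Algebra S B] (x : Gen → B) : Prop where
  k_kInv : x .k * x .kInv = 1
  kInv_k : x .kInv * x .k = 1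
  H_k : x .H * x .k = x .k * x .H
  k_E : x .k * x .E * x .kInv = Q • x .E
  k_F : Q • (x .k * x .F * x .kInv) = x .F
  H_E : x .H * x .E - x .E * x .H = (2 * h) • x .E
  H_F : x .H * x .F - x .F * x .H = -((2 * h) • x .F)
  E_F : x .E * x .F - x .F * x .E = h • curvedH S r x
  flat : r = 0 → x .k = 1

/-- The same relations in the free algebra. -/
inductive QRel {S : Type*} [CommRing S] [Algebra ℂ S] (r : ℝ) (h Q : S) :
    FreeAlgebra S Gen → FreeAlgebra S Gen → Prop
  | k_kInv : QRel r h Q (FreeAlgebra.ι S .k * FreeAlgebra.ι S .kInv) 1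
  | kInv_k : QRel r h Q (FreeAlgebra.ι S .kInv * FreeAlgebra.ι S .k) 1
  | H_k : QRel r h Q (FreeAlgebra.ι S .H * FreeAlgebra.ι S .k)
      (FreeAlgebra.ι S .k * FreeAlgebra.ι S .H)
  | k_E : QRel r h Q (FreeAlgebra.ι S .k * FreeAlgebra.ι S .E * FreeAlgebra.ι S .kInv)
      (Q • FreeAlgebra.ι S .E)
  | k_F : QRel r h Q (Q • (FreeAlgebra.ι S .k * FreeAlgebra.ι S .F * FreeAlgebra.ι S .kInv))
      (FreeAlgebra.ι S .F)
  | H_E : QRel r h Q (FreeAlgebra.ι S .H * FreeAlgebra.ι S .E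
      - FreeAlgebra.ι S .E * FreeAlgebra.ι S .H) ((2 * h) • FreeAlgebra.ι S .E)
  | H_F : QRel r h Q (FreeAlgebra.ι S .H * FreeAlgebra.ι S .F
      - FreeAlgebra.ι S .F * FreeAlgebra.ι S .H) (-((2 * h) • FreeAlgebra.ι S .F))
  | E_F : QRel r h Q (FreeAlgebra.ι S .E * FreeAlgebra.ι S .F
      - FreeAlgebra.ι S .F * FreeAlgebra.ι S .E) (h • curvedH S r (FreeAlgebra.ι S))
  | flat : r = 0 → QRel r h Q (FreeAlgebra.ι S .k) 1

/-- The algebra generated by `H, K^{±1/2}, E, F` subject to the relations above. -/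
abbrev QAlg {S : Type*} [CommRing S] [Algebra ℂ S] (r : ℝ) (h Q : S) : Type _ :=
  RingQuot (QRel r h Q)

section generic

variable {S : Type*} [CommRing S] [Algebra ℂ S] {r : ℝ} {h Q : S}

theorem map_curvedH {B C : Type*} [Ring B] [Algebra S B] [Ring C] [Algebra S C]
    (f : B →ₐ[S] C) (x : Gen → B) :
    f (curvedH S r x) = curvedH S r (fun i => f (x i)) := by
  unfold curvedH
  split_ifs <;> simp

/-- The generators of `QAlg`. -/
noncomputable def gen (r : ℝ) (h Q : S) (i : Gen) : QAlg r h Q :=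
  RingQuot.mkAlgHom S (QRel r h Q) (FreeAlgebra.ι S i)

theorem isQTuple_gen (r : ℝ) (h Q : S) : IsQTuple r h Q (gen r h Q) where
  k_kInv := by simpa [gen] using RingQuot.mkAlgHom_rel S (QRel.k_kInv (r := r) (h := h) (Q := Q))
  kInv_k := by simpa [gen] using RingQuot.mkAlgHom_rel S (QRel.kInv_k (r := r) (h := h) (Q := Q))
  H_k := by simpa [gen] using RingQuot.mkAlgHom_rel S (QRel.H_k (r := r) (h := h) (Q := Q))
  k_E := by simpa [gen] using RingQuot.mkAlgHom_rel S (QRel.k_E (r := r) (h := h) (Q := Q))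
  k_F := by simpa [gen] using RingQuot.mkAlgHom_rel S (QRel.k_F (r := r) (h := h) (Q := Q))
  H_E := by simpa [gen] using RingQuot.mkAlgHom_rel S (QRel.H_E (r := r) (h := h) (Q := Q))
  H_F := by simpa [gen] using RingQuot.mkAlgHom_rel S (QRel.H_F (r := r) (h := h) (Q := Q))
  E_F := by
    have := RingQuot.mkAlgHom_rel S (QRel.E_F (r := r) (h := h) (Q := Q))
    rw [map_smul, map_curvedH] at this
    change _ = h • curvedH S r (gen r h Q) at this
    simpa [gen] using this
  flat := fun hr => by
    simpa [gen] using RingQuot.mkAlgHom_rel S (QRel.flat (h := h) (Q := Q) hr)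

theorem lift_respects {B : Type*} [Ring B] [Algebra S B] {x : Gen → B} (hx : IsQTuple r h Q x)
    ⦃a b : FreeAlgebra S Gen⦄ (hab : QRel r h Q a b) :
    FreeAlgebra.lift S x a = FreeAlgebra.lift S x b := by
  induction hab with
  | k_kInv => simpa using hx.k_kInv
  | kInv_k => simpa using hx.kInv_k
  | H_k => simpa using hx.H_k
  | k_E => simpa using hx.k_E
  | k_F => simpa using hx.k_F
  | H_E => simpa using hx.H_E
  | H_F => simpa using hx.H_F
  | E_F => rw [map_smul, map_curvedH]; simpa using hx.E_F
  | flat hr => simpa using hx.flat hr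

/-- The algebra morphism sending the generators to a tuple that satisfies the relations. -/
noncomputable def liftHom {B : Type*} [Ring B] [Algebra S B] (x : Gen → B)
    (hx : IsQTuple r h Q x) : QAlg r h Q →ₐ[S] B :=
  RingQuot.liftAlgHom S ⟨FreeAlgebra.lift S x, lift_respects hx⟩

theorem liftHom_gen {B : Type*} [Ring B] [Algebra S B] (x : Gen → B)
    (hx : IsQTuple r h Q x) (i : Gen) : liftHom x hx (gen r h Q i) = x i := by
  simp [liftHom, gen]

/-- The coproduct on generators: `H` is primitive, `K^{±1/2}` are group-like,
`E ↦ E ⊗ e^{rH/2} + e^{-rH/2} ⊗ E` and `F ↦ F ⊗ e^{rH/2} + e^{-rH/2} ⊗ F`. -/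
noncomputable def coprodTuple {A B : Type*} [Ring A] [Algebra S A] [Ring B] [Algebra S B]
    (x : Gen → A) (y : Gen → B) : Gen → A ⊗[S] B
  | .H => x .H ⊗ₜ 1 + 1 ⊗ₜ y .H
  | .k => x .k ⊗ₜ y .k
  | .kInv => x .kInv ⊗ₜ y .kInv
  | .E => x .E ⊗ₜ y .kInv + x .k ⊗ₜ y .E
  | .F => x .F ⊗ₜ y .kInv + x .k ⊗ₜ y .F

theorem IsQTuple.kInv_H {A : Type*} [Ring A] [Algebra S A] {x : Gen → A}
    (hx : IsQTuple r h Q x) : x .H * x .kInv = x .kInv * x .H := by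
  calc x .H * x .kInv = x .kInv * (x .k * x .H) * x .kInv := by
        rw [← mul_assoc, hx.kInv_k, one_mul]
    _ = x .kInv * x .H * (x .k * x .kInv) := by rw [← hx.H_k]; simp only [mul_assoc]
    _ = _ := by rw [hx.k_kInv, mul_one]

theorem IsQTuple.kE {A : Type*} [Ring A] [Algebra S A] {x : Gen → A}
    (hx : IsQTuple r h Q x) : x .k * x .E = Q • (x .E * x .k) := by
  have := congrArg (· * x .k) hx.k_E
  simpa [mul_assoc, hx.kInv_k] using this

theorem IsQTuple.kF {A : Type*} [Ring A] [Algebra S A] {x : Gen → A}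
    (hx : IsQTuple r h Q x) : x .F * x .k = Q • (x .k * x .F) := by
  have := congrArg (· * x .k) hx.k_F
  simpa [mul_assoc, hx.kInv_k] using this.symm

theorem IsQTuple.EkInv {A : Type*} [Ring A] [Algebra S A] {x : Gen → A}
    (hx : IsQTuple r h Q x) : x .E * x .kInv = Q • (x .kInv * x .E) := by
  have := congrArg (x .kInv * ·) hx.k_E
  simpa [← mul_assoc, hx.kInv_k] using this

theorem IsQTuple.kInvF {A : Type*} [Ring A] [Algebra S A] {x : Gen → A}
    (hx : IsQTuple r h Q x) : x .kInv * x .F = Q • (x .F * x .kInv) := by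
  have := congrArg (x .kInv * ·) hx.k_F
  simpa [← mul_assoc, hx.kInv_k] using this.symm

theorem isQTuple_coprod {A B : Type*} [Ring A] [Algebra S A] [Ring B] [Algebra S B]
    {x : Gen → A} {y : Gen → B} (hx : IsQTuple r h Q x) (hy : IsQTuple r h Q y) :
    IsQTuple r h Q (coprodTuple (S := S) x y) where
  k_kInv := by
    simp [coprodTuple, hx.k_kInv, hy.k_kInv, Algebra.TensorProduct.one_def]
  kInv_k := by
    simp [coprodTuple, hx.kInv_k, hy.kInv_k, Algebra.TensorProduct.one_def]
  H_k := by simp [coprodTuple, add_mul, mul_add, hx.H_k, hy.H_k]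
  k_E := by
    simp only [coprodTuple, mul_add, add_mul, Algebra.TensorProduct.tmul_mul_tmul, hx.k_E, hy.k_E,
      hy.k_kInv, mul_assoc (x .k) (x .k), hx.k_kInv, one_mul, mul_one, smul_add,
      TensorProduct.smul_tmul', TensorProduct.tmul_smul]
  k_F := by
    simp only [coprodTuple, mul_add, add_mul, Algebra.TensorProduct.tmul_mul_tmul, smul_add,
      hy.k_kInv, mul_assoc (x .k) (x .k), hx.k_kInv, one_mul, mul_one]
    rw [TensorProduct.smul_tmul', hx.k_F, ← TensorProduct.tmul_smul, hy.k_F]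
  H_E := by
    have e1 : x .H * x .E = (2 * h) • x .E + x .E * x .H := by rw [← hx.H_E]; abel
    have e2 : y .H * y .E = (2 * h) • y .E + y .E * y .H := by rw [← hy.H_E]; abel
    simp only [coprodTuple, mul_add, add_mul, Algebra.TensorProduct.tmul_mul_tmul, one_mul, mul_one,
      hx.H_k, hy.kInv_H, e1, e2, TensorProduct.add_tmul, TensorProduct.tmul_add,
      smul_add, TensorProduct.smul_tmul', TensorProduct.tmul_smul]
    abel
  H_F := by
    have e1 : x .H * x .F = -((2 * h) • x .F) + x .F * x .H := by rw [← hx.H_F]; abel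
    have e2 : y .H * y .F = -((2 * h) • y .F) + y .F * y .H := by rw [← hy.H_F]; abel
    simp only [coprodTuple, mul_add, add_mul, Algebra.TensorProduct.tmul_mul_tmul, one_mul, mul_one,
      hx.H_k, hy.kInv_H, e1, e2, TensorProduct.add_tmul, TensorProduct.tmul_add,
      smul_add, TensorProduct.smul_tmul', TensorProduct.tmul_smul, TensorProduct.neg_tmul,
      TensorProduct.tmul_neg]
    abel
  E_F := by
    have c1 : (x .E * x .k) ⊗ₜ[S] (y .kInv * y .F) = (x .k * x .E) ⊗ₜ (y .F * y .kInv) := by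
      rw [hy.kInvF, TensorProduct.tmul_smul, TensorProduct.smul_tmul', ← hx.kE]
    have c2 : (x .k * x .F) ⊗ₜ[S] (y .E * y .kInv) = (x .F * x .k) ⊗ₜ (y .kInv * y .E) := by
      rw [hy.EkInv, TensorProduct.tmul_smul, TensorProduct.smul_tmul', ← hx.kF]
    have e1 : x .E * x .F = h • curvedH S r x + x .F * x .E := by rw [← hx.E_F]; abel
    have e2 : y .E * y .F = h • curvedH S r y + y .F * y .E := by rw [← hy.E_F]; abel
    simp only [coprodTuple, mul_add, add_mul, Algebra.TensorProduct.tmul_mul_tmul, c1, c2, e1, e2,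
      TensorProduct.add_tmul, TensorProduct.tmul_add]
    have key : (h • curvedH S r x) ⊗ₜ[S] (y .kInv * y .kInv)
        + (x .k * x .k) ⊗ₜ[S] (h • curvedH S r y) = h • curvedH S r (coprodTuple (S := S) x y) := by
      by_cases hr : r = 0
      · have hy' : y .kInv = 1 := by simpa [hy.flat hr] using hy.k_kInv
        simp [curvedH, hr, hx.flat hr, hy', coprodTuple, TensorProduct.smul_tmul']
      · simp only [curvedH, hr, if_false, coprodTuple, Algebra.TensorProduct.tmul_mul_tmul,
          TensorProduct.smul_tmul', TensorProduct.tmul_smul, TensorProduct.sub_tmul,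
          TensorProduct.tmul_sub, smul_sub]
        abel
    rw [← key]
    abel
  flat := fun hr => by
    simp [coprodTuple, hx.flat hr, hy.flat hr, Algebra.TensorProduct.one_def]

/-- The coproduct `Δ_r`. -/
noncomputable def coprod (r : ℝ) (h Q : S) : QAlg r h Q →ₐ[S] QAlg r h Q ⊗[S] QAlg r h Q :=
  liftHom (coprodTuple (gen r h Q) (gen r h Q))
    (isQTuple_coprod (isQTuple_gen r h Q) (isQTuple_gen r h Q))

end generic

/-- `q ^ ħ = e ^ (-r ħ)`. -/
noncomputable def qPow (r ħ : ℝ) : ℂ := ((Real.exp (-(r * ħ)) : ℝ) : ℂ)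

/-- The quantum group `U_q^ħ(sl₂)` at a numerical value of `ħ`, with `q = e^{-r}`.
For `r = 0` it is `U^ħ(sl₂)`; for `ħ = 0` it is the commutative polynomial algebra
`ℂ[H, e^{±rH/2}, E, F]`. -/
abbrev Uq (r ħ : ℝ) : Type := QAlg r (ħ : ℂ) (qPow r ħ)

/-! ### Observables depending on `ħ`, and their reduction modulo `ħ` -/

/-- The ring of complex functions of `ħ` that are smooth at `ħ = 0`. A coefficient `c` is divisible by
`ħ` in this ring exactly if `c 0 = 0`, so reduction modulo `ħ` is evaluation at `ħ = 0`. -/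
def planckRing : Subalgebra ℂ (ℝ → ℂ) where
  carrier := {c | ContDiffAt ℝ ((⊤ : ℕ∞) : WithTop ℕ∞) c 0}
  mul_mem' := by
    intro a b ha hb
    rw [Set.mem_ofPred_eq] at *
    exact ha.mul hb
  add_mem' := by
    intro a b ha hb
    rw [Set.mem_ofPred_eq] at *
    exact ha.add hb
  algebraMap_mem' := fun z => by
    rw [Set.mem_ofPred_eq]
    exact contDiffAt_const (c := z)

/-- The element `ħ` of the coefficient ring. -/
noncomputable def planckVar : planckRing :=
  ⟨fun t => (t : ℂ), by
    change ContDiffAt ℝ ((⊤ : ℕ∞) : WithTop ℕ∞) (fun t : ℝ => (t : ℂ)) 0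
    exact Complex.ofRealCLM.contDiff.contDiffAt⟩

/-- The element `q ^ ħ` of the coefficient ring. -/
noncomputable def planckQ (r : ℝ) : planckRing :=
  ⟨fun t => qPow r t, by
    have h1 : ContDiff ℝ ((⊤ : ℕ∞) : WithTop ℕ∞) (fun t : ℝ => Real.exp (-(r * t))) := by fun_prop
    exact (Complex.ofRealCLM.contDiff.comp h1).contDiffAt⟩

/-- Evaluation of a coefficient at a numerical value of `ħ`. -/
def evalPlanck (ħ : ℝ) : planckRing →+* ℂ :=
  (Pi.evalRingHom (fun _ : ℝ => ℂ) ħ).comp planckRing.val.toRingHom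

/-- Observables: elements of the quantum group whose coefficients are smooth functions of `ħ`. -/
abbrev Observable (r : ℝ) : Type := QAlg r planckVar (planckQ r)

theorem isQTuple_specialize (r ħ : ℝ) :
    letI : Algebra planckRing (Uq r ħ) := Algebra.compHom (Uq r ħ) (evalPlanck ħ)
    IsQTuple r planckVar (planckQ r) (gen r (ħ : ℂ) (qPow r ħ)) := by
  let _ : Algebra planckRing (Uq r ħ) := Algebra.compHom (Uq r ħ) (evalPlanck ħ)
  have hx := isQTuple_gen r (ħ : ℂ) (qPow r ħ)
  have sm : ∀ (c : planckRing) (b : Uq r ħ), c • b = (evalPlanck ħ c) • b := fun _ _ => rfl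
  have v : evalPlanck ħ planckVar = ħ := rfl
  have w : evalPlanck ħ (planckQ r) = qPow r ħ := rfl
  have cv : curvedH planckRing r (gen r (ħ : ℂ) (qPow r ħ))
      = curvedH ℂ r (gen r (ħ : ℂ) (qPow r ħ)) := by
    unfold curvedH
    split_ifs
    · rfl
    · rfl
  exact
    { k_kInv := hx.k_kInv
      kInv_k := hx.kInv_k
      H_k := hx.H_k
      k_E := by rw [sm, w]; exact hx.k_E
      k_F := by rw [sm, w]; exact hx.k_F
      H_E := by rw [sm, map_mul, v, map_ofNat]; exact hx.H_E
      H_F := by rw [sm, map_mul, v, map_ofNat]; exact hx.H_F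
      E_F := by rw [sm, v, cv]; exact hx.E_F
      flat := hx.flat }

/-- The value of an observable at a numerical `ħ`: generators go to generators, coefficients are
evaluated at `ħ`. -/
noncomputable def specialize (r ħ : ℝ) : Observable r →+* Uq r ħ :=
  letI : Algebra planckRing (Uq r ħ) := Algebra.compHom (Uq r ħ) (evalPlanck ħ)
  (liftHom (gen r (ħ : ℂ) (qPow r ħ)) (isQTuple_specialize r ħ) :
    Observable r →ₐ[planckRing] Uq r ħ).toRingHom

/-! ### The group `(SU₂^*)_r` -/

/-- Points of `(SU₂^*)_r` in the coordinates `(H, F)`, with `H` real, `F` complex and `E = F̄`. -/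
abbrev SU2Star : Type := ℝ × ℂ

/-- The element of `NA` (lower triangular, positive diagonal, determinant one) with coordinates
`(H, F)`. -/
noncomputable def toNA (r : ℝ) (g : SU2Star) : Matrix (Fin 2) (Fin 2) ℂ :=
  !![((Real.exp (r * g.1 / 2) : ℝ) : ℂ), 0;
     2 * r * g.2, ((Real.exp (-(r * g.1 / 2)) : ℝ) : ℂ)]

/-- The group law of `(SU₂^*)_r` in coordinates; it is addition for `r = 0`. -/
noncomputable def starMul (r : ℝ) (g g' : SU2Star) : SU2Star :=
  (g.1 + g'.1, g.2 * ((Real.exp (r * g'.1 / 2) : ℝ) : ℂ)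
    + ((Real.exp (-(r * g.1 / 2)) : ℝ) : ℂ) * g'.2)

/-- The group law is matrix multiplication in `NA`. -/
theorem toNA_starMul (r : ℝ) (g g' : SU2Star) :
    toNA r (starMul r g g') = toNA r g * toNA r g' := by
  ext i j
  fin_cases i <;> fin_cases j <;>
    simp [toNA, starMul, Matrix.mul_apply, Fin.sum_univ_two, mul_add, add_div, Complex.exp_add]
  · ring
  · ring

/-- The coordinate functions `H`, `e^{∓rH/2}`, `E`, `F` on `(SU₂^*)_r`. -/
noncomputable def coordTuple (r : ℝ) : Gen → (SU2Star → ℂ)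
  | .H => fun g => (g.1 : ℂ)
  | .k => fun g => ((Real.exp (-(r * g.1 / 2)) : ℝ) : ℂ)
  | .kInv => fun g => ((Real.exp (r * g.1 / 2) : ℝ) : ℂ)
  | .E => fun g => (starRingEnd ℂ) g.2
  | .F => fun g => g.2

theorem isQTuple_coord (r : ℝ) :
    IsQTuple r ((0 : ℝ) : ℂ) (qPow r 0) (coordTuple r) where
  k_kInv := by
    funext g
    simp [coordTuple, ← Complex.exp_add]
  kInv_k := by
    funext g
    simp [coordTuple, ← Complex.exp_add]
  H_k := mul_comm _ _
  k_E := by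
    funext g
    have : Complex.exp (-(r * g.1 / 2)) * Complex.exp (r * g.1 / 2) = 1 := by
      rw [← Complex.exp_add]; simp
    simp only [coordTuple, qPow, Pi.mul_apply, Pi.smul_apply]
    push_cast
    rw [mul_right_comm, this]
    simp
  k_F := by
    funext g
    have : Complex.exp (-(r * g.1 / 2)) * Complex.exp (r * g.1 / 2) = 1 := by
      rw [← Complex.exp_add]; simp
    simp only [coordTuple, qPow, Pi.mul_apply, Pi.smul_apply]
    push_cast
    rw [mul_right_comm, this]
    simp
  H_E := by simp [mul_comm]
  H_F := by simp [mul_comm]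
  E_F := by simp [mul_comm]
  flat := fun hr => by
    funext g
    simp [coordTuple, hr]

/-- The quotient map modulo `ħ` to functions on `(SU₂^*)_r`: put `ħ = 0` and read the generators
as the coordinate functions. -/
noncomputable def modHbar (r : ℝ) : Observable r →+* (SU2Star → ℂ) :=
  (liftHom (coordTuple r) (isQTuple_coord r) : Uq r 0 →ₐ[ℂ] (SU2Star → ℂ)).toRingHom.comp
    (specialize r 0)

/-! ### Dressing orbits and their uniform measure -/

/-- The group `SU₂`. -/
abbrev SU2 : Type := Matrix.specialUnitaryGroup (Fin 2) ℂ

instance : IsTopologicalGroup SU2 where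
  continuous_inv := by
    refine Continuous.subtype_mk ?_ _
    exact continuous_star.comp continuous_subtype_val

instance : CompactSpace SU2 := by
  refine isCompact_iff_compactSpace.mp ?_
  have hK : IsCompact (Set.pi Set.univ
      (fun _ : Fin 2 => Set.pi Set.univ (fun _ : Fin 2 => Metric.closedBall (0 : ℂ) 1))) :=
    isCompact_univ_pi fun _ => isCompact_univ_pi fun _ => isCompact_closedBall _ _
  refine hK.of_isClosed_subset ?_ ?_
  · have : (Matrix.specialUnitaryGroup (Fin 2) ℂ : Set (Matrix (Fin 2) (Fin 2) ℂ))
        = {A | star A * A = 1} ∩ ({A | A * star A = 1} ∩ {A | A.det = 1}) := by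
      ext A
      simp [Matrix.mem_specialUnitaryGroup_iff, Matrix.unitaryGroup, Unitary.mem_iff, and_assoc]
    rw [this]
    refine IsClosed.inter (isClosed_eq (by fun_prop) (by fun_prop))
      (IsClosed.inter (isClosed_eq (by fun_prop) (by fun_prop))
        (isClosed_eq (by fun_prop) (by fun_prop)))
  · intro A hA i _ j _
    simpa using entry_norm_bound_of_unitary
      (Matrix.specialUnitaryGroup_le_unitaryGroup hA) i j

noncomputable instance : MeasurableSpace SU2 := borel SU2

instance : BorelSpace SU2 := ⟨rfl⟩

/-- The Haar probability measure on `SU₂`. -/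
noncomputable def haarSU2 : Measure SU2 := Measure.haarMeasure ⊤

/-- The dressing action of `SU₂` on `(SU₂^*)_r`. For `r ≠ 0`, `k · b = b'` where `k b = b' k'` with
`b' ∈ NA`, `k' ∈ SU₂`; the coordinates of `b'` are read off `b' b'ᴴ = (k b) (k b)ᴴ`. For `r = 0` it
is the coadjoint action, i.e. conjugation of the Hermitian matrix with entries `H, 2F̄, 2F, -H`. -/
noncomputable def dressing (r : ℝ) (k : SU2) (g : SU2Star) : SU2Star :=
  if r = 0 then
    let X := (k : Matrix (Fin 2) (Fin 2) ℂ) *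
      !![(g.1 : ℂ), 2 * (starRingEnd ℂ) g.2; 2 * g.2, -(g.1 : ℂ)] *
      (k : Matrix (Fin 2) (Fin 2) ℂ)ᴴ
    ((X 0 0).re, X 1 0 / 2)
  else
    let M := ((k : Matrix (Fin 2) (Fin 2) ℂ) * toNA r g) *
      ((k : Matrix (Fin 2) (Fin 2) ℂ) * toNA r g)ᴴ
    (Real.log (M 0 0).re / r, M 1 0 / (2 * r * ((√(M 0 0).re : ℝ) : ℂ)))

theorem normSq_row_pos (k : SU2) (r : ℝ) (g : SU2Star) :
    0 < Complex.normSq (((k : Matrix (Fin 2) (Fin 2) ℂ) * toNA r g) 0 0)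
      + Complex.normSq (((k : Matrix (Fin 2) (Fin 2) ℂ) * toNA r g) 0 1) := by
  have hdet : ((k : Matrix (Fin 2) (Fin 2) ℂ) * toNA r g).det = 1 := by
    rw [Matrix.det_mul, (Matrix.mem_specialUnitaryGroup_iff.mp k.2).2, one_mul]
    simp [toNA, Matrix.det_fin_two, ← Complex.exp_add]
  generalize (k : Matrix (Fin 2) (Fin 2) ℂ) * toNA r g = A at *
  rw [Matrix.det_fin_two] at hdet
  by_contra hle
  have h1 := Complex.normSq_nonneg (A 0 0)
  have h2 := Complex.normSq_nonneg (A 0 1)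
  have h3 : A 0 0 = 0 := Complex.normSq_eq_zero.mp (by linarith)
  have h4 : A 0 1 = 0 := Complex.normSq_eq_zero.mp (by linarith)
  simp [h3, h4] at hdet

/-- For `r ≠ 0` the dressing action is given by the Gram-Schmidt decomposition `k b = b' k'`. -/
theorem dressing_spec {r : ℝ} (hr : r ≠ 0) (k : SU2) (g : SU2Star) :
    ∃ k' : SU2, (k : Matrix (Fin 2) (Fin 2) ℂ) * toNA r g
      = toNA r (dressing r k g) * (k' : Matrix (Fin 2) (Fin 2) ℂ) := by
  have hpos := normSq_row_pos k r g
  have hdet : ((k : Matrix (Fin 2) (Fin 2) ℂ) * toNA r g).det = 1 := by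
    rw [Matrix.det_mul, (Matrix.mem_specialUnitaryGroup_iff.mp k.2).2, one_mul]
    simp [toNA, Matrix.det_fin_two, ← Complex.exp_add]
  unfold dressing
  rw [if_neg hr]
  generalize (k : Matrix (Fin 2) (Fin 2) ℂ) * toNA r g = A at *
  set s : ℝ := Complex.normSq (A 0 0) + Complex.normSq (A 0 1) with hs
  have hM : (A * Aᴴ) 0 0 = (s : ℂ) := by
    simp [Matrix.mul_apply, Fin.sum_univ_two, Complex.mul_conj, hs]
  have hM1 : (A * Aᴴ) 1 0 = A 1 0 * (starRingEnd ℂ) (A 0 0) + A 1 1 * (starRingEnd ℂ) (A 0 1) := by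
    simp [Matrix.mul_apply, Fin.sum_univ_two]
  simp only [hM, hM1, Complex.ofReal_re]
  have hsq : (√s : ℝ) * √s = s := Real.mul_self_sqrt hpos.le
  have hsp : 0 < √s := Real.sqrt_pos.mpr hpos
  have hsc : ((√s : ℝ) : ℂ) ≠ 0 := by exact_mod_cast hsp.ne'
  have hsqc : ((√s : ℝ) : ℂ) * ((√s : ℝ) : ℂ) = (s : ℂ) := by exact_mod_cast hsq
  have hrc : (r : ℂ) ≠ 0 := by exact_mod_cast hr
  have hexp : Real.exp (r * (Real.log s / r) / 2) = √s := by
    rw [mul_div_cancel₀ _ hr, Real.sqrt_eq_rpow, Real.rpow_def_of_pos hpos]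
    ring_nf
  have hexp' : Real.exp (-(r * (Real.log s / r) / 2)) = (√s)⁻¹ := by
    rw [Real.exp_neg, hexp]
  have hsA : A 0 0 * (starRingEnd ℂ) (A 0 0) + A 0 1 * (starRingEnd ℂ) (A 0 1) = (s : ℂ) := by
    simp [Complex.mul_conj, hs]
  rw [Matrix.det_fin_two] at hdet
  let U : Matrix (Fin 2) (Fin 2) ℂ :=
    !![A 0 0 / (√s : ℝ), A 0 1 / (√s : ℝ);
       -((starRingEnd ℂ) (A 0 1) / (√s : ℝ)), (starRingEnd ℂ) (A 0 0) / (√s : ℝ)]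
  have hU : U ∈ Matrix.specialUnitaryGroup (Fin 2) ℂ := by
    rw [Matrix.mem_specialUnitaryGroup_iff, Matrix.mem_unitaryGroup_iff]
    constructor
    · ext i j
      fin_cases i <;> fin_cases j <;>
        simp [U, Matrix.mul_apply, Fin.sum_univ_two, Matrix.star_eq_conjTranspose] <;>
        field_simp <;> rw [pow_two, hsqc] <;>
        first | linear_combination hsA | linear_combination (0 : ℂ) * hsA
    · simp only [U, Matrix.det_fin_two_of]
      field_simp
      rw [pow_two, hsqc]
      linear_combination hsA
  refine ⟨⟨U, hU⟩, ?_⟩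
  ext i j
  fin_cases i <;> fin_cases j <;>
    simp only [toNA, U, hexp, hexp', Matrix.mul_apply, Fin.sum_univ_two] <;> simp <;> field_simp
  · rw [pow_two, hsqc]
    linear_combination (-A 1 0) * hsA - (starRingEnd ℂ) (A 0 1) * hdet
  · rw [pow_two, hsqc]
    linear_combination (-A 1 1) * hsA + (starRingEnd ℂ) (A 0 0) * hdet

/-- The dressing orbit `O_r(Λ)`: the orbit of the diagonal element with `H = Λ`, `F = 0`. -/
noncomputable def dressingOrbit (r Λ : ℝ) : Set SU2Star :=
  Set.range fun k : SU2 => dressing r k (Λ, 0)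

/-- The uniform measure on `O_r(Λ)`, the image of the Haar measure of `SU₂`. -/
noncomputable def uniformOrbit (r Λ : ℝ) : Measure SU2Star :=
  haarSU2.map fun k => dressing r k (Λ, 0)

/-- `Λ(g)`: the nonnegative number `Λ` such that `g ∈ O_r(Λ)`. -/
noncomputable def orbitParam (r : ℝ) (g : SU2Star) : ℝ :=
  sInf {Λ | 0 ≤ Λ ∧ g ∈ dressingOrbit r Λ}

/-! ### Representations -/

/-- The highest weight of `V^q(Λ^ħ)` in units of `ħ`, so that `Λ^ħ = ħ ⌊Λ/ħ⌋`. -/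
noncomputable def level (Λ ħ : ℝ) : ℕ := ⌊Λ / ħ⌋₊

/-- The index `k ∈ {-n, -n+2, …, n}` of the basis vector `e_{ħk}`. -/
noncomputable def wtIdx (n : ℕ) (i : Fin (n + 1)) : ℝ := 2 * (i : ℝ) - n

/-- The constant `α_r^ħ`. -/
noncomputable def alphaConst (r ħ : ℝ) : ℝ :=
  1 / (2 * r) * √(2 * r * ħ / (Real.exp (r * ħ) - Real.exp (-(r * ħ))))

/-- The matrix coefficients of `E` and `F`: `E e_{ħk} = ladder (k+1) e_{ħ(k+2)}`,
`F e_{ħk} = ladder (k-1) e_{ħ(k-2)}`; for `r = 0` the limit as `r → 0` is taken. -/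
noncomputable def ladder (r ħ : ℝ) (n : ℕ) (m : ℝ) : ℝ :=
  if r = 0 then ħ / 2 * √(((n : ℝ) + 1) ^ 2 - m ^ 2)
  else alphaConst r ħ * √(Real.exp (r * (ħ * n + ħ)) + Real.exp (-(r * (ħ * n + ħ)))
      - Real.exp (r * ħ * m) - Real.exp (-(r * ħ * m)))

/-- The action of the generators on the basis of the representation of dimension `n + 1`. -/
noncomputable def repTuple (r ħ : ℝ) (n : ℕ) : Gen → Matrix (Fin (n + 1)) (Fin (n + 1)) ℂ
  | .H => Matrix.diagonal fun i => ((ħ * wtIdx n i : ℝ) : ℂ)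
  | .k => Matrix.diagonal fun i => ((Real.exp (-(r * (ħ * wtIdx n i) / 2)) : ℝ) : ℂ)
  | .kInv => Matrix.diagonal fun i => ((Real.exp (r * (ħ * wtIdx n i) / 2) : ℝ) : ℂ)
  | .E => Matrix.of fun i j =>
      if (i : ℕ) = j + 1 then ((ladder r ħ n (wtIdx n j + 1) : ℝ) : ℂ) else 0
  | .F => Matrix.of fun i j =>
      if (j : ℕ) = i + 1 then ((ladder r ħ n (wtIdx n j - 1) : ℝ) : ℂ) else 0

theorem wtIdx_sq_le (n : ℕ) (j : Fin (n + 1)) (ε : ℝ) (hε : ε ^ 2 = 1) :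
    (wtIdx n j + ε) ^ 2 ≤ ((n : ℝ) + 1) ^ 2 := by
  have h1 : ((j : ℕ) : ℝ) ≤ n := by exact_mod_cast Nat.lt_succ_iff.mp j.2
  have h2 : (0 : ℝ) ≤ ((j : ℕ) : ℝ) := Nat.cast_nonneg _
  have hε' : |ε| = 1 := by
    rw [← sq_abs] at hε
    nlinarith [abs_nonneg ε]
  refine sq_le_sq' ?_ ?_ <;> unfold wtIdx <;> cases abs_eq (zero_le_one) |>.mp hε' <;> linarith

theorem ladder_sq (r ħ : ℝ) (n : ℕ) (m : ℝ) (hm : m ^ 2 ≤ ((n : ℝ) + 1) ^ 2) :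
    ladder r ħ n m ^ 2 = if r = 0 then ħ ^ 2 / 4 * (((n : ℝ) + 1) ^ 2 - m ^ 2)
      else ħ / (2 * r * (Real.exp (r * ħ) - Real.exp (-(r * ħ)))) *
        (2 * Real.cosh (r * (ħ * n + ħ)) - 2 * Real.cosh (r * ħ * m)) := by
  unfold ladder
  split_ifs with hr
  · rw [mul_pow, Real.sq_sqrt (by linarith)]
    ring
  · have hc : Real.cosh (r * ħ * m) ≤ Real.cosh (r * (ħ * n + ħ)) := by
      rw [Real.cosh_le_cosh, ← sq_le_sq]
      have : (r * ħ) ^ 2 * m ^ 2 ≤ (r * ħ) ^ 2 * ((n : ℝ) + 1) ^ 2 :=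
        mul_le_mul_of_nonneg_left hm (sq_nonneg _)
      nlinarith
    have hn : 0 ≤ 2 * r * ħ / (Real.exp (r * ħ) - Real.exp (-(r * ħ))) := by
      rcases le_total 0 (r * ħ) with h | h
      · apply div_nonneg (by linarith)
        have := Real.exp_le_exp.mpr (show -(r * ħ) ≤ r * ħ by linarith)
        linarith
      · apply div_nonneg_of_nonpos (by linarith)
        have := Real.exp_le_exp.mpr (show r * ħ ≤ -(r * ħ) by linarith)
        linarith
    have e : Real.exp (r * (ħ * n + ħ)) + Real.exp (-(r * (ħ * n + ħ))) - Real.exp (r * ħ * m)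
        - Real.exp (-(r * ħ * m))
        = 2 * Real.cosh (r * (ħ * n + ħ)) - 2 * Real.cosh (r * ħ * m) := by
      rw [Real.cosh_eq, Real.cosh_eq]; ring
    rw [e, mul_pow, Real.sq_sqrt (by linarith), alphaConst, mul_pow, Real.sq_sqrt hn]
    field_simp

theorem ladder_edge (r ħ : ℝ) (n : ℕ) (m : ℝ) (hm : m ^ 2 = ((n : ℝ) + 1) ^ 2) :
    ladder r ħ n m ^ 2 = 0 := by
  rw [ladder_sq r ħ n m hm.le]
  split_ifs with hr
  · rw [hm]; ring
  · have : Real.cosh (r * ħ * m) = Real.cosh (r * (ħ * n + ħ)) := by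
      rcases sq_eq_sq_iff_eq_or_eq_neg.mp hm with h | h
      · rw [h]; ring_nf
      · rw [h, ← Real.cosh_neg]; ring_nf
    rw [this]; ring

theorem rep_EF (r ħ : ℝ) (n : ℕ) : repTuple r ħ n .E * repTuple r ħ n .F
    = Matrix.diagonal fun i => ((ladder r ħ n (wtIdx n i - 1) ^ 2 : ℝ) : ℂ) := by
  ext i j
  rw [Matrix.mul_apply, Matrix.diagonal_apply]
  simp only [repTuple, Matrix.of_apply]
  rcases Nat.eq_zero_or_pos (i : ℕ) with hi | hi
  · rw [Finset.sum_eq_zero]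
    · split_ifs with hij
      · rw [ladder_edge, Complex.ofReal_zero]
        simp only [wtIdx, hi]; push_cast; ring
      · rfl
    · intro l _
      rw [if_neg (by omega), zero_mul]
  · rw [Finset.sum_eq_single (⟨(i : ℕ) - 1, by omega⟩ : Fin (n + 1))]
    · rw [if_pos (by simp; omega)]
      by_cases hij : i = j
      · subst hij
        rw [if_pos (by simp; omega), if_pos rfl, ← Complex.ofReal_mul, pow_two]
        congr 3
        simp only [wtIdx]
        rw [Nat.cast_sub hi]; push_cast; ring
      · rw [if_neg hij, if_neg, mul_zero]
        intro h
        exact hij (Fin.ext (by simp at h; omega))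
    · intro l _ hl
      rw [if_neg, zero_mul]
      intro h
      exact hl (Fin.ext (by simp; omega))
    · simp

theorem rep_FE (r ħ : ℝ) (n : ℕ) : repTuple r ħ n .F * repTuple r ħ n .E
    = Matrix.diagonal fun i => ((ladder r ħ n (wtIdx n i + 1) ^ 2 : ℝ) : ℂ) := by
  ext i j
  rw [Matrix.mul_apply, Matrix.diagonal_apply]
  simp only [repTuple, Matrix.of_apply]
  rcases Nat.lt_or_ge (i : ℕ) n with hi | hi
  · rw [Finset.sum_eq_single (⟨(i : ℕ) + 1, by omega⟩ : Fin (n + 1))]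
    · rw [if_pos (by simp)]
      by_cases hij : i = j
      · subst hij
        rw [if_pos (by simp), if_pos rfl, ← Complex.ofReal_mul, pow_two]
        congr 3
        simp only [wtIdx]
        push_cast; ring
      · rw [if_neg hij, if_neg, mul_zero]
        intro h
        exact hij (Fin.ext (by simp at h; omega))
    · intro l _ hl
      rw [if_neg, zero_mul]
      intro h
      exact hl (Fin.ext (by simp; omega))
    · simp
  · have hi' : (i : ℕ) = n := by omega
    rw [Finset.sum_eq_zero]
    · split_ifs with hij
      · rw [ladder_edge, Complex.ofReal_zero]
        simp only [wtIdx, hi']; ring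
      · rfl
    · intro l _
      rw [if_neg (by omega), zero_mul]

theorem isQTuple_rep (r ħ : ℝ) (n : ℕ) : IsQTuple r (ħ : ℂ) (qPow r ħ) (repTuple r ħ n) where
  k_kInv := by
    simp [repTuple, Matrix.diagonal_mul_diagonal, ← Complex.exp_add]
  kInv_k := by
    simp [repTuple, Matrix.diagonal_mul_diagonal, ← Complex.exp_add]
  H_k := by simp only [repTuple, Matrix.diagonal_mul_diagonal, mul_comm]
  k_E := by
    ext i j
    simp only [repTuple, Matrix.mul_diagonal, Matrix.diagonal_mul, Matrix.smul_apply,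
      Matrix.of_apply, smul_eq_mul]
    split_ifs with h
    · rw [mul_right_comm, ← Complex.ofReal_mul, ← Real.exp_add, qPow]
      congr 3
      simp only [wtIdx, h]; push_cast; ring
    · simp
  k_F := by
    ext i j
    simp only [repTuple, Matrix.mul_diagonal, Matrix.diagonal_mul, Matrix.smul_apply,
      Matrix.of_apply, smul_eq_mul]
    split_ifs with h
    · rw [mul_right_comm, ← Complex.ofReal_mul, ← Real.exp_add, qPow, ← mul_assoc,
        ← Complex.ofReal_mul, ← Real.exp_add]
      have : -(r * ħ) + (-(r * (ħ * wtIdx n i) / 2) + r * (ħ * wtIdx n j) / 2) = 0 := by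
        simp only [wtIdx, h]; push_cast; ring
      rw [this]; simp
    · simp
  H_E := by
    ext i j
    simp only [repTuple, Matrix.mul_diagonal, Matrix.diagonal_mul, Matrix.smul_apply,
      Matrix.of_apply, smul_eq_mul, Matrix.sub_apply]
    split_ifs with h
    · simp only [wtIdx, h]; push_cast; ring
    · simp
  H_F := by
    ext i j
    simp only [repTuple, Matrix.mul_diagonal, Matrix.diagonal_mul, Matrix.smul_apply,
      Matrix.of_apply, smul_eq_mul, Matrix.sub_apply, Matrix.neg_apply]
    split_ifs with h
    · simp only [wtIdx, h]; push_cast; ring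
    · simp
  E_F := by
    rw [rep_EF, rep_FE]
    unfold curvedH
    have l1 := fun i => ladder_sq r ħ n (wtIdx n i + -1) (wtIdx_sq_le n i (-1) (by norm_num))
    have l2 := fun i => ladder_sq r ħ n (wtIdx n i + 1) (wtIdx_sq_le n i 1 (by norm_num))
    split_ifs with hr
    · simp only [hr, if_true] at l1 l2
      ext i j
      simp only [repTuple, Matrix.sub_apply, Matrix.smul_apply, Matrix.diagonal_apply]
      split_ifs with hij
      · rw [hr, l2 i, sub_eq_add_neg (wtIdx n i) 1, l1 i]
        simp only [smul_eq_mul]; push_cast; ring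
      · simp
    · simp only [hr, if_false] at l1 l2
      ext i j
      simp only [repTuple, Matrix.sub_apply, Matrix.smul_apply, Matrix.diagonal_mul_diagonal,
        Matrix.diagonal_apply]
      split_ifs with hij
      · rw [l2 i, sub_eq_add_neg (wtIdx n i) 1, l1 i]
        simp only [smul_eq_mul, Algebra.algebraMap_self, RingHom.id_apply]
        rw [← Complex.ofReal_mul, ← Complex.ofReal_mul, ← Real.exp_add, ← Real.exp_add]
        have key : ħ / (2 * r * (Real.exp (r * ħ) - Real.exp (-(r * ħ)))) *
            (2 * Real.cosh (r * (ħ * n + ħ)) - 2 * Real.cosh (r * ħ * (wtIdx n i + -1)))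
            - ħ / (2 * r * (Real.exp (r * ħ) - Real.exp (-(r * ħ)))) *
            (2 * Real.cosh (r * (ħ * n + ħ)) - 2 * Real.cosh (r * ħ * (wtIdx n i + 1)))
            = ħ * (1 / (2 * r) * (Real.exp (r * (ħ * wtIdx n i) / 2 + r * (ħ * wtIdx n i) / 2)
              - Real.exp (-(r * (ħ * wtIdx n i) / 2) + -(r * (ħ * wtIdx n i) / 2)))) := by
          rcases eq_or_ne ħ 0 with h0 | h0
          · simp [h0]
          have hd : Real.exp (r * ħ) - Real.exp (-(r * ħ)) ≠ 0 := by
            intro h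
            have := Real.exp_injective (sub_eq_zero.mp h)
            exact mul_ne_zero hr h0 (by linarith)
          have e1 : Real.exp (r * ħ * (wtIdx n i + -1))
              = Real.exp (r * ħ * wtIdx n i) * Real.exp (-(r * ħ)) := by
            rw [← Real.exp_add]; ring_nf
          have e2 : Real.exp (-(r * ħ * (wtIdx n i + -1)))
              = Real.exp (-(r * ħ * wtIdx n i)) * Real.exp (r * ħ) := by
            rw [← Real.exp_add]; ring_nf
          have e3 : Real.exp (r * ħ * (wtIdx n i + 1))
              = Real.exp (r * ħ * wtIdx n i) * Real.exp (r * ħ) := by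
            rw [← Real.exp_add]; ring_nf
          have e4 : Real.exp (-(r * ħ * (wtIdx n i + 1)))
              = Real.exp (-(r * ħ * wtIdx n i)) * Real.exp (-(r * ħ)) := by
            rw [← Real.exp_add]; ring_nf
          have e5 : r * (ħ * wtIdx n i) / 2 + r * (ħ * wtIdx n i) / 2 = r * ħ * wtIdx n i := by
            ring
          have e6 : -(r * (ħ * wtIdx n i) / 2) + -(r * (ħ * wtIdx n i) / 2)
              = -(r * ħ * wtIdx n i) := by ring
          rw [Real.cosh_eq (r * ħ * (wtIdx n i + -1)), Real.cosh_eq (r * ħ * (wtIdx n i + 1)),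
            e1, e2, e3, e4, e5, e6]
          generalize Real.exp (r * ħ) = a at *
          generalize Real.exp (-(r * ħ)) = b at *
          generalize Real.exp (r * ħ * wtIdx n i) = c
          generalize Real.exp (-(r * ħ * wtIdx n i)) = d
          field_simp
          ring
        have := congrArg (fun t : ℝ => (t : ℂ)) key
        push_cast at this ⊢
        exact this
      · simp
  flat := fun hr => by simp [repTuple, hr]

/-- The representation `V^q(ħ n)` of `U_q^ħ(sl₂)`, of dimension `n + 1`. -/
noncomputable def rep (r ħ : ℝ) (n : ℕ) : Uq r ħ →ₐ[ℂ] Matrix (Fin (n + 1)) (Fin (n + 1)) ℂ :=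
  liftHom (repTuple r ħ n) (isQTuple_rep r ħ n)

/-- The representation `V^q(ħ n₁) ⊗ V^q(ħ n₂)`, through the coproduct. -/
noncomputable def repTensor (r ħ : ℝ) (n₁ n₂ : ℕ) : Uq r ħ →ₐ[ℂ]
    Matrix (Fin (n₁ + 1) × Fin (n₂ + 1)) (Fin (n₁ + 1) × Fin (n₂ + 1)) ℂ :=
  ((Matrix.kroneckerAlgEquiv (Fin (n₁ + 1)) (Fin (n₂ + 1)) ℂ).toAlgHom.comp
    (Algebra.TensorProduct.map (rep r ħ n₁) (rep r ħ n₂))).comp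
    (coprod r (ħ : ℂ) (qPow r ħ))

/-- `q^{-H} = e^{rH} = K^{-1}`. -/
noncomputable def qNegH (r ħ : ℝ) : Uq r ħ :=
  gen r (ħ : ℂ) (qPow r ħ) .kInv * gen r (ħ : ℂ) (qPow r ħ) .kInv

/-- `Tr_{V^q(Λ^ħ)}(q^{-H} 𝓕) / Tr_{V^q(Λ^ħ)}(q^{-H})`. -/
noncomputable def weightedTrace (r Λ : ℝ) (𝓕 : Observable r) (ħ : ℝ) : ℂ :=
  (rep r ħ (level Λ ħ) (qNegH r ħ * specialize r ħ 𝓕)).trace /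
    (rep r ħ (level Λ ħ) (qNegH r ħ)).trace

/-- The same quotient of traces over `V^q(Λ₁^ħ) ⊗ V^q(Λ₂^ħ)`. -/
noncomputable def weightedTrace₂ (r Λ₁ Λ₂ : ℝ) (𝓕 : Observable r) (ħ : ℝ) : ℂ :=
  (repTensor r ħ (level Λ₁ ħ) (level Λ₂ ħ) (qNegH r ħ * specialize r ħ 𝓕)).trace /
    (repTensor r ħ (level Λ₁ ħ) (level Λ₂ ħ) (qNegH r ħ)).trace

/-! ### The operator `Λ^{r,ħ}` and the bottom row of the diagram -/

/-- The Casimir element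
`C^{r,ħ} = (4 r² E F + (e^{rħ} K + e^{-rħ} K⁻¹) · 2rħ / (e^{rħ} - e^{-rħ})) / 2`. -/
noncomputable def casimir (r ħ : ℝ) : Uq r ħ :=
  let x := gen r (ħ : ℂ) (qPow r ħ)
  (1 / 2 : ℂ) • (((4 * r ^ 2 : ℝ) : ℂ) • (x .E * x .F) +
    ((2 * r * ħ / (Real.exp (r * ħ) - Real.exp (-(r * ħ))) : ℝ) : ℂ) •
      (((Real.exp (r * ħ) : ℝ) : ℂ) • (x .k * x .k) +
        ((Real.exp (-(r * ħ)) : ℝ) : ℂ) • (x .kInv * x .kInv)))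

/-- The operator by which `Λ^{r,ħ} = arcosh((e^{rħ} - e^{-rħ}) / (2rħ) · C^{r,ħ}) / r - ħ` acts on
`V^q(ħ n₁) ⊗ V^q(ħ n₂)`, by functional calculus of a self-adjoint matrix. -/
noncomputable def lambdaOp (r ħ : ℝ) (n₁ n₂ : ℕ) :
    Matrix (Fin (n₁ + 1) × Fin (n₂ + 1)) (Fin (n₁ + 1) × Fin (n₂ + 1)) ℂ :=
  cfc (fun x : ℝ => Real.arcosh x / r - ħ)
    (repTensor r ħ n₁ n₂
      ((((Real.exp (r * ħ) - Real.exp (-(r * ħ))) / (2 * r * ħ) : ℝ) : ℂ) • casimir r ħ))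

/-- The normalized trace of `φ(Λ^{r,ħ}) ψ(H)` over `V^q(Λ₁^ħ) ⊗ V^q(Λ₂^ħ)`. -/
noncomputable def quantumCorner (Λ₁ Λ₂ : ℝ) (φ ψ : ℂ[X]) (r ħ : ℝ) : ℂ :=
  (aeval (lambdaOp r ħ (level Λ₁ ħ) (level Λ₂ ħ)) φ *
    aeval (repTensor r ħ (level Λ₁ ħ) (level Λ₂ ħ) (gen r (ħ : ℂ) (qPow r ħ) .H)) ψ).trace /
    (((level Λ₁ ħ : ℂ) + 1) * ((level Λ₂ ħ : ℂ) + 1))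

/-- The integrand `e^{-rH(g)} φ(Λ(g)) ψ(H(g))`. -/
noncomputable def crystalObservable (φ ψ : ℂ[X]) (r : ℝ) (g : SU2Star) : ℂ :=
  ((Real.exp (-(r * g.1)) : ℝ) : ℂ) * φ.eval (orbitParam r g : ℂ) * ψ.eval (g.1 : ℂ)

/-! ### Crystals and the top row of the diagram -/

/-- The crystal `B(ħ n)`, identified with its weights. -/
abbrev Crystal (n : ℕ) : Type := Fin (n + 1)

/-- The weight of an element of `B(ħ n)`. -/
noncomputable def crystalWt (ħ : ℝ) (n : ℕ) (b : Crystal n) : ℝ := ħ * wtIdx n b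

/-- The raising arrows of `B(ħ n)`: the weight increases by `2ħ`. -/
def crystalUp (n : ℕ) (b b' : Crystal n) : Prop := (b' : ℕ) = b + 1

/-- `ε(b)`: how many times the raising operator can be applied. -/
def crystalEps (n : ℕ) (b : Crystal n) : ℕ := n - b

/-- `φ(b)`: how many times the lowering operator can be applied. -/
def crystalPhi (n : ℕ) (b : Crystal n) : ℕ := b

/-- The raising arrows of `B(ħ n₁) ⊗ B(ħ n₂)`, by the tensor product rule: the raising operator acts
on the first factor if `φ(b₁) ≥ ε(b₂)`, and on the second factor otherwise. -/
def tensorUp (n₁ n₂ : ℕ) (b b' : Crystal n₁ × Crystal n₂) : Prop :=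
  (crystalEps n₂ b.2 ≤ crystalPhi n₁ b.1 ∧ crystalUp n₁ b.1 b'.1 ∧ b'.2 = b.2) ∨
  (crystalPhi n₁ b.1 < crystalEps n₂ b.2 ∧ b'.1 = b.1 ∧ crystalUp n₂ b.2 b'.2)

/-- `wt(b₁ ⊗ b₂) = wt(b₁) + wt(b₂)`. -/
noncomputable def tensorWt (ħ : ℝ) (n₁ n₂ : ℕ) (b : Crystal n₁ × Crystal n₂) : ℝ :=
  crystalWt ħ n₁ b.1 + crystalWt ħ n₂ b.2

/-- `hw(b₁ ⊗ b₂)`: the highest weight in the connected component of `b₁ ⊗ b₂`. -/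
noncomputable def tensorHw (ħ : ℝ) (n₁ n₂ : ℕ) (b : Crystal n₁ × Crystal n₂) : ℝ :=
  sSup (tensorWt ħ n₁ n₂ '' {b' | Relation.EqvGen (tensorUp n₁ n₂) b b'})

/-- The normalized sum of `φ(hw) ψ(wt)` over the crystal `B(Λ₁^ħ) ⊗ B(Λ₂^ħ)`. -/
noncomputable def crystalCorner (Λ₁ Λ₂ : ℝ) (φ ψ : ℂ[X]) (ħ : ℝ) : ℂ :=
  (∑ b : Crystal (level Λ₁ ħ) × Crystal (level Λ₂ ħ),
    φ.eval (tensorHw ħ (level Λ₁ ħ) (level Λ₂ ħ) b : ℂ) *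
      ψ.eval (tensorWt ħ (level Λ₁ ħ) (level Λ₂ ħ) b : ℂ)) /
    (((level Λ₁ ħ : ℂ) + 1) * ((level Λ₂ ħ : ℂ) + 1))

/-- The continuous rule `hw_{Λ₁,Λ₂}(μ₁, μ₂) = max (Λ₁ + μ₂) (-μ₁ + Λ₂)`. -/
noncomputable def contHw (Λ₁ Λ₂ μ₁ μ₂ : ℝ) : ℝ := max (Λ₁ + μ₂) (-μ₁ + Λ₂)

/-- The average of `φ(hw) ψ(μ₁ + μ₂)` over the rectangle `[-Λ₁, Λ₁] × [-Λ₂, Λ₂]`. -/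
noncomputable def continuousCorner (Λ₁ Λ₂ : ℝ) (φ ψ : ℂ[X]) : ℂ :=
  1 / (4 * Λ₁ * Λ₂) * ∫ μ₁ in (-Λ₁)..Λ₁, ∫ μ₂ in (-Λ₂)..Λ₂,
    φ.eval (contHw Λ₁ Λ₂ μ₁ μ₂ : ℂ) * ψ.eval ((μ₁ + μ₂ : ℝ) : ℂ)

end StaticLimits

namespace StaticLimits

/-! ### The Haar measure of `SU₂`: the squared modulus of an entry is uniformly distributed -/

section Haar

/-! One orbit. The factor `q^{-H} = e^{rH}` in the trace is the density of the orbit measure. Under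
Haar measure the squared modulus of an entry of `SU₂` is uniform on `[0, 1]` (`map_normSq_haarSU2`);
for `r ≠ 0` the function `e^{rH}` on the orbit is affine in it, so `H` has density proportional to
`e^{rH}` on `[-Λ, Λ]` (`integral_uniformOrbit_fst_eq`). Observables are spanned by words in the
generators. Words act with norms bounded uniformly as `ħ → 0`, and commutators of generators carry
coefficients that vanish at `ħ = 0`, so letters may be permuted in the limit
(`isNegligible_sub_of_perm`). A word with unequal numbers of `E` and `F` has zero trace, by the
weight grading, and zero mean, by rotation of `F`. Any other word can be reordered to act
diagonally, with `EF` having eigenvalues that tend to `|F|²` as a function of `H`; the quotient of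
traces is then a quotient of Riemann sums.

Two orbits. The coproduct on generators is the group law on coordinate functions and `q^{-H}` is
group-like. Trace and expectation are therefore the same finite sum of products of one-orbit
quantities, the expectation by independence.

The square. Two exact identities carry it. On the quantum side, for all `r, ħ > 0`, the trace of
`φ(Λ^{r,ħ}) ψ(H)` equals the crystal sum (`quantumCorner_eq_crystalCorner`). Indeed, on two adjacent
weight spaces the Casimir operator is, up to a constant factor, `FE` resp. `EF` plus a common scalar
`t`. Since positive powers of `FE` and `EF` have equal traces, the trace of `p(Casimir)` changes by
`p(t)` times the change of dimension. Crystal sums satisfy the same recursion (`levelSum_succ`), so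
no decomposition into irreducibles is needed.

On the classical side, `B_r = D` for every `r > 0` (`integral_crystalObservable`). The two-orbit
limit is applied to `K` times a power of the Casimir times `ψ(H)`; here `K` cancels `q^{-H}`, the
quantum identity turns the trace into a crystal sum, and the limit gives all moments of `cosh (r
Λ(g))`. These determine the integrals of polynomials in `Λ(g)`. Hence both limits `r → ∞` are limits
of constants, and both limits `ħ → 0` are the convergence of crystal sums to an integral. -/

instance : IsProbabilityMeasure haarSU2 := ⟨by
  have h := Measure.haarMeasure_self (K₀ := (⊤ : TopologicalSpace.PositiveCompacts SU2))
  simpa [haarSU2] using h⟩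

instance : haarSU2.IsMulLeftInvariant := by unfold haarSU2; infer_instance

theorem continuous_SU2_entry (i j : Fin 2) :
    Continuous fun k : SU2 => (k : Matrix (Fin 2) (Fin 2) ℂ) i j :=
  (continuous_apply_apply i j).comp continuous_subtype_val

theorem Continuous.integrable_haarSU2 {E : Type*} [NormedAddCommGroup E] {f : SU2 → E}
    (hf : Continuous f) : Integrable f haarSU2 :=
  hf.integrable_of_hasCompactSupport (HasCompactSupport.of_compactSpace f)

/-- The element of `SU₂` with first column `(u, v)`. -/
noncomputable def mkSU2 (u v : ℂ) (h : Complex.normSq u + Complex.normSq v = 1) : SU2 :=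
  ⟨!![u, -(starRingEnd ℂ) v; v, (starRingEnd ℂ) u], by
    have h' : u * (starRingEnd ℂ) u + v * (starRingEnd ℂ) v = 1 := by
      rw [Complex.mul_conj, Complex.mul_conj]; exact_mod_cast h
    rw [Matrix.mem_specialUnitaryGroup_iff, Matrix.mem_unitaryGroup_iff]
    constructor
    · ext i j
      fin_cases i <;> fin_cases j <;>
        simp [Matrix.mul_apply, Fin.sum_univ_two, Matrix.star_eq_conjTranspose] <;>
        first | linear_combination h' | ring
    · simp only [Matrix.det_fin_two_of]
      linear_combination h'⟩

theorem SU2_normSq_col (k : SU2) :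
    Complex.normSq ((k : Matrix (Fin 2) (Fin 2) ℂ) 0 0)
      + Complex.normSq ((k : Matrix (Fin 2) (Fin 2) ℂ) 1 0) = 1 := by
  have h := Matrix.mem_unitaryGroup_iff'.mp (Matrix.mem_specialUnitaryGroup_iff.mp k.2).1
  have h0 := congrFun (congrFun h 0) 0
  simp only [Matrix.mul_apply, Fin.sum_univ_two, Matrix.star_eq_conjTranspose,
    Matrix.conjTranspose_apply, Matrix.one_apply_eq] at h0
  have : ((Complex.normSq ((k : Matrix (Fin 2) (Fin 2) ℂ) 0 0)
      + Complex.normSq ((k : Matrix (Fin 2) (Fin 2) ℂ) 1 0) : ℝ) : ℂ) = 1 := by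
    rw [← h0]
    push_cast
    rw [← Complex.mul_conj, ← Complex.mul_conj]
    simp [mul_comm]
  exact_mod_cast this

/-- Unitarity makes the inverse the conjugate transpose, and determinant one makes it the adjugate.
Comparing the two expresses the second column through the first. -/
theorem SU2_eq_mk (k : SU2) : k = mkSU2 ((k : Matrix (Fin 2) (Fin 2) ℂ) 0 0)
    ((k : Matrix (Fin 2) (Fin 2) ℂ) 1 0) (SU2_normSq_col k) := by
  have h := Matrix.mem_unitaryGroup_iff'.mp (Matrix.mem_specialUnitaryGroup_iff.mp k.2).1
  have hd := (Matrix.mem_specialUnitaryGroup_iff.mp k.2).2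
  apply Subtype.ext
  have hadj : star (k : Matrix (Fin 2) (Fin 2) ℂ) = (k : Matrix (Fin 2) (Fin 2) ℂ).adjugate := by
    have h1 := Matrix.mul_adjugate (k : Matrix (Fin 2) (Fin 2) ℂ)
    rw [hd, one_smul] at h1
    calc star (k : Matrix (Fin 2) (Fin 2) ℂ)
        = star (k : Matrix (Fin 2) (Fin 2) ℂ) *
          ((k : Matrix (Fin 2) (Fin 2) ℂ) * (k : Matrix (Fin 2) (Fin 2) ℂ).adjugate) := by
            rw [h1, mul_one]
      _ = _ := by rw [← mul_assoc, h, one_mul]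
  rw [Matrix.adjugate_fin_two] at hadj
  have e1 := congrFun (congrFun hadj 0) 0
  have e2 := congrFun (congrFun hadj 0) 1
  simp at e1 e2
  ext i j
  fin_cases i <;> fin_cases j <;> simp [mkSU2, e1, e2]

/-- The mixed moments of the first column of a Haar distributed matrix. -/
noncomputable def haarMoment (m j l : ℕ) : ℂ :=
  ∫ k : SU2, (((k : Matrix (Fin 2) (Fin 2) ℂ) 0 0) ^ j *
    ((k : Matrix (Fin 2) (Fin 2) ℂ) 1 0) ^ (m - j)) *
    (starRingEnd ℂ) (((k : Matrix (Fin 2) (Fin 2) ℂ) 0 0) ^ l *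
    ((k : Matrix (Fin 2) (Fin 2) ℂ) 1 0) ^ (m - l)) ∂haarSU2

theorem continuous_haarMoment_integrand (m j l : ℕ) : Continuous fun k : SU2 =>
    (((k : Matrix (Fin 2) (Fin 2) ℂ) 0 0) ^ j * ((k : Matrix (Fin 2) (Fin 2) ℂ) 1 0) ^ (m - j)) *
    (starRingEnd ℂ) (((k : Matrix (Fin 2) (Fin 2) ℂ) 0 0) ^ l *
    ((k : Matrix (Fin 2) (Fin 2) ℂ) 1 0) ^ (m - l)) := by
  have h1 := continuous_SU2_entry 0 0
  have h2 := continuous_SU2_entry 1 0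
  exact ((h1.pow _).mul (h2.pow _)).mul
    (Complex.continuous_conj.comp ((h1.pow _).mul (h2.pow _)))

/-- Supplies a torus element at which a nontrivial character is `-1`. Translating an invariant
integral by it shows that the integral is its own negative. -/
theorem exists_unit_pow_eq_neg_one {d : ℤ} (hd : d ≠ 0) :
    ∃ z : ℂ, z * (starRingEnd ℂ) z = 1 ∧ z ^ (2 * d) = -1 := by
  refine ⟨Complex.exp (Real.pi / (2 * d) * Complex.I), ?_, ?_⟩
  · rw [← Complex.exp_conj, ← Complex.exp_add]
    simp [Complex.conj_ofReal, Complex.conj_ofNat]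
  · rw [← Complex.exp_int_mul]
    have hd' : (d : ℂ) ≠ 0 := by exact_mod_cast hd
    rw [show ((2 * d : ℤ) : ℂ) * (Real.pi / (2 * d) * Complex.I) = Real.pi * Complex.I by
      push_cast; field_simp, Complex.exp_pi_mul_I]

/-- Left translation by `diag(z, z̄)` multiplies the integrand by `z ^ (2 (j - l))`, and `z` is
chosen to make this factor `-1`. -/
theorem haarMoment_eq_zero {m j l : ℕ} (hj : j ≤ m) (hl : l ≤ m) (h : j ≠ l) :
    haarMoment m j l = 0 := by
  obtain ⟨z, hz, hzd⟩ := exists_unit_pow_eq_neg_one (d := (j : ℤ) - l) (by omega)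
  have hz' : Complex.normSq z + Complex.normSq 0 = 1 := by
    rw [map_zero, add_zero]
    have : (Complex.normSq z : ℂ) = 1 := by rw [← Complex.mul_conj, hz]
    exact_mod_cast this
  have hz0 : z ≠ 0 := by rintro rfl; simp at hz
  have hc : (starRingEnd ℂ) z = z⁻¹ := eq_inv_of_mul_eq_one_right hz
  have key := integral_mul_left_eq_self (μ := haarSU2) (fun k : SU2 =>
    (((k : Matrix (Fin 2) (Fin 2) ℂ) 0 0) ^ j *
    ((k : Matrix (Fin 2) (Fin 2) ℂ) 1 0) ^ (m - j)) *
    (starRingEnd ℂ) (((k : Matrix (Fin 2) (Fin 2) ℂ) 0 0) ^ l *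
    ((k : Matrix (Fin 2) (Fin 2) ℂ) 1 0) ^ (m - l))) (mkSU2 z 0 hz')
  change _ = haarMoment m j l at key
  have : ∀ k : SU2, (((mkSU2 z 0 hz' * k : SU2) : Matrix (Fin 2) (Fin 2) ℂ) 0 0) = z *
      ((k : Matrix (Fin 2) (Fin 2) ℂ) 0 0) ∧
      (((mkSU2 z 0 hz' * k : SU2) : Matrix (Fin 2) (Fin 2) ℂ) 1 0) = z⁻¹ *
      ((k : Matrix (Fin 2) (Fin 2) ℂ) 1 0) := by
    intro k
    constructor <;> simp [mkSU2, Matrix.mul_apply, Fin.sum_univ_two, hc]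
  have hp : z ^ j * z⁻¹ ^ (m - j) * (z⁻¹ ^ l * z ^ (m - l)) = -1 := by
    rw [← hzd]
    rw [← zpow_natCast, ← zpow_natCast, ← zpow_natCast, ← zpow_natCast, inv_zpow', inv_zpow',
      ← zpow_add₀ hz0, ← zpow_add₀ hz0, ← zpow_add₀ hz0]
    congr 1
    push_cast [Nat.cast_sub hj, Nat.cast_sub hl]
    ring
  have e : ∀ k : SU2, ((((mkSU2 z 0 hz' * k : SU2) : Matrix (Fin 2) (Fin 2) ℂ) 0 0) ^ j *
    (((mkSU2 z 0 hz' * k : SU2) : Matrix (Fin 2) (Fin 2) ℂ) 1 0) ^ (m - j)) *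
    (starRingEnd ℂ) ((((mkSU2 z 0 hz' * k : SU2) : Matrix (Fin 2) (Fin 2) ℂ) 0 0) ^ l *
    (((mkSU2 z 0 hz' * k : SU2) : Matrix (Fin 2) (Fin 2) ℂ) 1 0) ^ (m - l)) =
      (-1) * ((((k : Matrix (Fin 2) (Fin 2) ℂ) 0 0) ^ j *
    ((k : Matrix (Fin 2) (Fin 2) ℂ) 1 0) ^ (m - j)) *
    (starRingEnd ℂ) (((k : Matrix (Fin 2) (Fin 2) ℂ) 0 0) ^ l *
    ((k : Matrix (Fin 2) (Fin 2) ℂ) 1 0) ^ (m - l))) := by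
    intro k
    rw [(this k).1, (this k).2, ← hp]
    simp only [map_mul, map_pow, mul_pow, map_inv₀, hc, inv_inv]
    ring
  simp only [e] at key
  rw [integral_const_mul] at key
  change -1 * haarMoment m j l = _ at key
  have : (2 : ℂ) * haarMoment m j l = 0 := by linear_combination -key
  simpa using this

/-- Left translation by the real rotation with first row `(1, s) / √(1 + s²)` replaces `a` by `(a +
s b) / √(1 + s²)` in the integral of `|a|^{2m}`. After binomial expansion only the diagonal moments
survive. -/
theorem binomial_haarMoment (m : ℕ) (s : ℝ) :
    ∑ j ∈ Finset.range (m + 1), ((m.choose j : ℂ) ^ 2 * haarMoment m j j) *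
        ((s : ℂ) ^ 2) ^ (m - j)
      = (1 + (s : ℂ) ^ 2) ^ m * haarMoment m m m := by
  set c : ℝ := √(1 + s ^ 2) with hcdef
  have hc2 : c ^ 2 = 1 + s ^ 2 := Real.sq_sqrt (by positivity)
  have hc : 0 < c := Real.sqrt_pos.mpr (by positivity)
  have hn : Complex.normSq ((1 / c : ℝ) : ℂ) + Complex.normSq ((-(s / c) : ℝ) : ℂ) = 1 := by
    rw [Complex.normSq_ofReal, Complex.normSq_ofReal]
    field_simp
    linarith
  have key := integral_mul_left_eq_self (μ := haarSU2) (fun k : SU2 =>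
    (((k : Matrix (Fin 2) (Fin 2) ℂ) 0 0) ^ m *
    ((k : Matrix (Fin 2) (Fin 2) ℂ) 1 0) ^ (m - m)) *
    (starRingEnd ℂ) (((k : Matrix (Fin 2) (Fin 2) ℂ) 0 0) ^ m *
    ((k : Matrix (Fin 2) (Fin 2) ℂ) 1 0) ^ (m - m))) (mkSU2 _ _ hn)
  change _ = haarMoment m m m at key
  have this : ∀ k : SU2, (((mkSU2 _ _ hn * k : SU2) : Matrix (Fin 2) (Fin 2) ℂ) 0 0) =
      (1 / c : ℂ) * (((k : Matrix (Fin 2) (Fin 2) ℂ) 0 0) +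
        s * ((k : Matrix (Fin 2) (Fin 2) ℂ) 1 0)) := by
    intro k
    simp [mkSU2, Matrix.mul_apply, Fin.sum_univ_two]
    ring
  have hcc : (c : ℂ) ≠ 0 := by exact_mod_cast hc.ne'
  have hcc2 : (c : ℂ) ^ 2 = 1 + (s : ℂ) ^ 2 := by exact_mod_cast hc2
  simp only [this, Nat.sub_self, pow_zero, mul_one] at key
  have e : ∀ a b : ℂ, (1 / (c : ℂ) * (a + s * b)) ^ m *
      (starRingEnd ℂ) ((1 / (c : ℂ) * (a + s * b)) ^ m) =
      ∑ j ∈ Finset.range (m + 1), ∑ l ∈ Finset.range (m + 1),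
        (((1 + (s : ℂ) ^ 2) ^ m)⁻¹ * ((m.choose j : ℂ) * (m.choose l : ℂ) * (s : ℂ) ^ (m - j)
          * (s : ℂ) ^ (m - l))) *
        ((a ^ j * b ^ (m - j)) * (starRingEnd ℂ) (a ^ l * b ^ (m - l))) := by
    intro a b
    rw [← hcc2, mul_pow, add_pow]
    simp only [map_mul, map_sum, map_pow, map_div₀, map_one, Complex.conj_ofReal, map_natCast]
    rw [mul_mul_mul_comm, Finset.sum_mul_sum, Finset.mul_sum]
    refine Finset.sum_congr rfl fun j _ => ?_
    rw [Finset.mul_sum]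
    refine Finset.sum_congr rfl fun l _ => ?_
    rw [mul_pow, mul_pow, ← pow_mul, one_div, inv_pow, mul_comm 2 m, pow_mul, pow_two, mul_inv]
    ring
  have hint : ∀ (z : ℂ) (j l : ℕ), Integrable (fun k : SU2 => z *
      ((((k : Matrix (Fin 2) (Fin 2) ℂ) 0 0) ^ j * ((k : Matrix (Fin 2) (Fin 2) ℂ) 1 0) ^ (m - j)) *
        (starRingEnd ℂ) (((k : Matrix (Fin 2) (Fin 2) ℂ) 0 0) ^ l *
        ((k : Matrix (Fin 2) (Fin 2) ℂ) 1 0) ^ (m - l)))) haarSU2 := fun z j l =>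
    (Continuous.integrable_haarSU2 (continuous_haarMoment_integrand m j l)).const_mul z
  simp only [e] at key
  rw [integral_finsetSum _ (fun j _ => integrable_finsetSum _ fun l _ => hint _ j l)] at key
  have e2 : ∀ j ∈ Finset.range (m + 1), (∫ k : SU2, ∑ l ∈ Finset.range (m + 1),
      (((1 + (s : ℂ) ^ 2) ^ m)⁻¹ * ((m.choose j : ℂ) * (m.choose l : ℂ) * (s : ℂ) ^ (m - j)
        * (s : ℂ) ^ (m - l))) *
      ((((k : Matrix (Fin 2) (Fin 2) ℂ) 0 0) ^ j * ((k : Matrix (Fin 2) (Fin 2) ℂ) 1 0) ^ (m - j))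
        * (starRingEnd ℂ) (((k : Matrix (Fin 2) (Fin 2) ℂ) 0 0) ^ l *
          ((k : Matrix (Fin 2) (Fin 2) ℂ) 1 0) ^ (m - l))) ∂haarSU2) =
      ((1 + (s : ℂ) ^ 2) ^ m)⁻¹ * (((m.choose j : ℂ) ^ 2 * haarMoment m j j) *
      ((s : ℂ) ^ 2) ^ (m - j)) := by
    intro j hj
    rw [integral_finsetSum _ (fun l _ => hint _ j l)]
    rw [Finset.sum_eq_single j]
    · rw [integral_const_mul]
      change _ * haarMoment m j j = _
      ring
    · intro l hl hlj
      rw [integral_const_mul]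
      change _ * haarMoment m j l = _
      rw [haarMoment_eq_zero (by simpa [Nat.lt_succ_iff] using hj)
        (by simpa [Nat.lt_succ_iff] using hl) hlj.symm, mul_zero]
    · exact fun h => (h hj).elim
  rw [Finset.sum_congr rfl e2, ← Finset.mul_sum] at key
  have h0 : (1 + (s : ℂ) ^ 2) ^ m ≠ 0 := by rw [← hcc2]; positivity
  rw [← key, ← mul_assoc, mul_inv_cancel₀ h0, one_mul]

/-- Both sides of `binomial_haarMoment` are polynomials in `s²`; this is the comparison of
coefficients of degree `m - j`. -/
theorem choose_mul_haarMoment {m j : ℕ} (hj : j ≤ m) :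
    (m.choose j : ℂ) * haarMoment m j j = haarMoment m m m := by
  have hpoly : (∑ j ∈ Finset.range (m + 1), C ((m.choose j : ℂ) ^ 2 * haarMoment m j j) *
      (X : ℂ[X]) ^ (m - j)) = C (haarMoment m m m) * ((1 : ℂ[X]) + X) ^ m := by
    -- The variable stands for `s²`, so the identity is tested on the infinite set of squares of
    -- natural numbers.
    refine Polynomial.eq_of_infinite_eval_eq _ _ (Set.Infinite.mono ?_
      (Set.infinite_range_of_injective (f := fun n : ℕ => ((n : ℂ)) ^ 2) ?_))
    · rintro _ ⟨n, rfl⟩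
      have := binomial_haarMoment m n
      simp only [Complex.ofReal_natCast] at this
      simp only [Set.mem_ofPred_eq, eval_finsetSum, eval_mul, eval_C, eval_pow, eval_X, eval_add,
        eval_one]
      rw [this, mul_comm]
    · intro a b h
      have : (a ^ 2 : ℕ) = b ^ 2 := by
        have h' : ((a : ℂ)) ^ 2 = (b : ℂ) ^ 2 := h
        exact_mod_cast h'
      exact Nat.pow_left_injective (by norm_num : 2 ≠ 0) this
  have hco := congrArg (fun p : ℂ[X] => p.coeff (m - j)) hpoly
  simp only [finsetSum_coeff, coeff_C_mul, coeff_X_pow] at hco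
  rw [add_comm (1 : ℂ[X]) X, coeff_X_add_one_pow, Nat.choose_symm hj,
    Finset.sum_eq_single j] at hco
  · have h0 : (m.choose j : ℂ) ≠ 0 := by exact_mod_cast (Nat.choose_pos hj).ne'
    rw [if_pos rfl, mul_one] at hco
    apply mul_left_cancel₀ h0
    linear_combination hco
  · intro b hb hbj
    have : b ≤ m := by simpa [Nat.lt_succ_iff] using hb
    rw [if_neg (by omega), mul_zero]
  · intro h
    exact (h (by simp; omega)).elim

/-- Integrating `(|a|² + |b|²)^m = 1` gives `m + 1` binomial terms with sum `1`, and by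
`choose_mul_haarMoment` all of them are equal to the wanted moment. -/
theorem integral_haarSU2_normSq_pow (m : ℕ) :
    ∫ k : SU2, Complex.normSq ((k : Matrix (Fin 2) (Fin 2) ℂ) 0 0) ^ m ∂haarSU2
      = 1 / (m + 1 : ℝ) := by
  have hmm : haarMoment m m m = ((∫ k : SU2,
      Complex.normSq ((k : Matrix (Fin 2) (Fin 2) ℂ) 0 0) ^ m ∂haarSU2 : ℝ) : ℂ) := by
    rw [haarMoment, ← integral_complex_ofReal]
    refine integral_congr_ae (Eventually.of_forall fun k => ?_)
    simp only [Nat.sub_self, pow_zero, mul_one, Complex.mul_conj]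
    rw [map_pow]
  have h1 : ∑ j ∈ Finset.range (m + 1), (m.choose j : ℂ) * haarMoment m j j = 1 := by
    have e : ∀ k : SU2, ∑ j ∈ Finset.range (m + 1), (m.choose j : ℂ) *
        ((((k : Matrix (Fin 2) (Fin 2) ℂ) 0 0) ^ j *
        ((k : Matrix (Fin 2) (Fin 2) ℂ) 1 0) ^ (m - j)) *
        (starRingEnd ℂ) (((k : Matrix (Fin 2) (Fin 2) ℂ) 0 0) ^ j *
        ((k : Matrix (Fin 2) (Fin 2) ℂ) 1 0) ^ (m - j))) = 1 := by
      intro k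
      have h := congrArg (fun x : ℝ => ((x : ℂ)) ^ m) (SU2_normSq_col k)
      simp only [Complex.ofReal_add, Complex.ofReal_one, one_pow] at h
      rw [add_pow] at h
      rw [← h]
      refine Finset.sum_congr rfl fun j _ => ?_
      rw [Complex.mul_conj, map_mul, map_pow, map_pow]
      push_cast
      ring
    have h2 : ∫ k : SU2, (1 : ℂ) ∂haarSU2 = 1 := by simp
    rw [← h2]
    simp only [haarMoment, ← integral_const_mul]
    rw [← integral_finsetSum]
    · exact integral_congr_ae (Eventually.of_forall e)
    · intro j _
      refine (Continuous.integrable_haarSU2 ?_).const_mul _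
      exact continuous_haarMoment_integrand m j j
  rw [Finset.sum_congr rfl fun j hj => choose_mul_haarMoment
    (by simpa [Nat.lt_succ_iff] using hj), Finset.sum_const, Finset.card_range, hmm] at h1
  have h3 : ((m : ℝ) + 1) * ∫ k : SU2,
      Complex.normSq ((k : Matrix (Fin 2) (Fin 2) ℂ) 0 0) ^ m ∂haarSU2 = 1 := by
    rw [nsmul_eq_mul] at h1
    exact_mod_cast h1
  rw [eq_div_iff (by positivity)]
  linarith

end Haar

/-! ### Integrals determined by moments -/

theorem integrable_pow_mul_of_mem_Icc {α : Type*} [MeasurableSpace α] {μ : Measure α}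
    {u : ℝ → ℝ} (hu : Continuous u) {h : α → ℝ} {w : α → ℂ} (hh : AEMeasurable h μ)
    (hw : Integrable w μ) {A B : ℝ} (hAB : ∀ᵐ x ∂μ, h x ∈ Set.Icc A B) :
    Integrable (fun x => (u (h x) : ℂ) * w x) μ := by
  obtain ⟨M, hM⟩ := (isCompact_Icc (a := A) (b := B)).exists_bound_of_continuousOn hu.continuousOn
  refine hw.bdd_mul (c := M) ?_ ?_
  · exact (Complex.measurable_ofReal.comp_aemeasurable
      (hu.measurable.comp_aemeasurable hh)).aestronglyMeasurable
  · filter_upwards [hAB] with x hx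
    rw [Complex.norm_real]
    exact hM _ hx

theorem norm_integral_sub_le_of_near {α : Type*} [MeasurableSpace α] {μ : Measure α}
    {u v : ℝ → ℝ} (hu : Continuous u) (hv : Continuous v) {h : α → ℝ} {w : α → ℂ}
    (hh : AEMeasurable h μ) (hw : Integrable w μ) {A B : ℝ}
    (hAB : ∀ᵐ x ∂μ, h x ∈ Set.Icc A B) {ε : ℝ}
    (huv : ∀ x ∈ Set.Icc A B, |u x - v x| ≤ ε) :
    ‖(∫ x, (u (h x) : ℂ) * w x ∂μ) - ∫ x, (v (h x) : ℂ) * w x ∂μ‖ ≤ ε * ∫ x, ‖w x‖ ∂μ := by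
  rw [← integral_sub (integrable_pow_mul_of_mem_Icc hu hh hw hAB)
    (integrable_pow_mul_of_mem_Icc hv hh hw hAB), ← integral_const_mul]
  refine norm_integral_le_of_norm_le (hw.norm.const_mul ε) ?_
  filter_upwards [hAB] with x hx
  rw [← sub_mul, norm_mul, ← Complex.ofReal_sub, Complex.norm_real]
  exact mul_le_mul_of_nonneg_right (huv _ hx) (norm_nonneg _)

theorem integral_polynomial_comp_mul {α : Type*} [MeasurableSpace α] {μ : Measure α}
    {h : α → ℝ} {w : α → ℂ} (hh : AEMeasurable h μ) (hw : Integrable w μ) {A B : ℝ}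
    (hAB : ∀ᵐ x ∂μ, h x ∈ Set.Icc A B) (p : ℝ[X]) :
    ∫ x, ((p.eval (h x) : ℝ) : ℂ) * w x ∂μ
      = ∑ i ∈ Finset.range (p.natDegree + 1), (p.coeff i : ℂ) * ∫ x, (h x : ℂ) ^ i * w x ∂μ := by
  have e : ∀ x, ((p.eval (h x) : ℝ) : ℂ) * w x
      = ∑ i ∈ Finset.range (p.natDegree + 1), (p.coeff i : ℂ) * ((h x : ℂ) ^ i * w x) := by
    intro x
    rw [eval_eq_sum_range, Complex.ofReal_sum, Finset.sum_mul]
    refine Finset.sum_congr rfl fun i _ => ?_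
    push_cast
    ring
  simp only [e]
  rw [integral_finsetSum]
  · simp only [integral_const_mul]
  · intro i _
    have := integrable_pow_mul_of_mem_Icc (u := fun x => x ^ i) (by fun_prop) hh hw hAB
    simp only [Complex.ofReal_pow] at this
    exact this.const_mul _

/-- Weighted integrals of continuous functions of a bounded variable are determined by the
moments. -/
theorem integral_comp_eq_of_moments {α β : Type*} [MeasurableSpace α] [MeasurableSpace β]
    {μ : Measure α} {ν : Measure β} {h : α → ℝ} {w : α → ℂ} {h' : β → ℝ} {w' : β → ℂ}
    (hh : AEMeasurable h μ) (hw : Integrable w μ) (hh' : AEMeasurable h' ν)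
    (hw' : Integrable w' ν) {A B : ℝ} (hAB : ∀ᵐ x ∂μ, h x ∈ Set.Icc A B)
    (hAB' : ∀ᵐ y ∂ν, h' y ∈ Set.Icc A B)
    (hm : ∀ n : ℕ, ∫ x, (h x : ℂ) ^ n * w x ∂μ = ∫ y, (h' y : ℂ) ^ n * w' y ∂ν)
    {u : ℝ → ℝ} (hu : Continuous u) :
    ∫ x, (u (h x) : ℂ) * w x ∂μ = ∫ y, (u (h' y) : ℂ) * w' y ∂ν := by
  set N := (∫ x, ‖w x‖ ∂μ) + ∫ y, ‖w' y‖ ∂ν with hN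
  have hN0 : 0 ≤ N := add_nonneg (integral_nonneg fun _ => norm_nonneg _)
    (integral_nonneg fun _ => norm_nonneg _)
  rw [← sub_eq_zero, ← norm_eq_zero]
  refine le_antisymm (le_of_forall_pos_le_add fun δ hδ => ?_) (norm_nonneg _)
  rw [zero_add]
  -- Weierstrass approximation. `N` is the total mass of the two weights; the `+ 1` keeps the
  -- tolerance meaningful when `N = 0`.
  obtain ⟨p, hp⟩ := exists_polynomial_near_of_continuousOn A B u hu.continuousOn
    (δ / (N + 1)) (by positivity)
  have h1 := norm_integral_sub_le_of_near hu p.continuous hh hw hAB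
    (fun x hx => by rw [abs_sub_comm]; exact (hp x hx).le)
  have h2 := norm_integral_sub_le_of_near hu p.continuous hh' hw' hAB'
    (fun x hx => by rw [abs_sub_comm]; exact (hp x hx).le)
  have h3 : ∫ x, ((p.eval (h x) : ℝ) : ℂ) * w x ∂μ = ∫ y, ((p.eval (h' y) : ℝ) : ℂ) * w' y ∂ν := by
    rw [integral_polynomial_comp_mul hh hw hAB, integral_polynomial_comp_mul hh' hw' hAB']
    simp only [hm]
  have h4 : δ / (N + 1) * N ≤ δ := by
    rw [div_mul_eq_mul_div, div_le_iff₀ (by positivity)]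
    nlinarith
  calc ‖_ - _‖ = ‖((∫ x, (u (h x) : ℂ) * w x ∂μ) - ∫ x, ((p.eval (h x) : ℝ) : ℂ) * w x ∂μ)
        - ((∫ y, (u (h' y) : ℂ) * w' y ∂ν) - ∫ y, ((p.eval (h' y) : ℝ) : ℂ) * w' y ∂ν)‖ := by
          rw [h3]; congr 1; ring
    _ ≤ _ := norm_sub_le _ _
    _ ≤ δ / (N + 1) * N := by rw [hN, mul_add]; exact add_le_add h1 h2
    _ ≤ δ := h4

/-- The squared modulus of an entry of a Haar distributed matrix is uniformly distributed. -/
theorem map_normSq_haarSU2 :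
    haarSU2.map (fun k : SU2 => Complex.normSq ((k : Matrix (Fin 2) (Fin 2) ℂ) 0 0))
      = volume.restrict (Set.Icc (0 : ℝ) 1) := by
  have hc : Continuous fun k : SU2 => Complex.normSq ((k : Matrix (Fin 2) (Fin 2) ℂ) 0 0) :=
    Complex.continuous_normSq.comp (continuous_SU2_entry 0 0)
  have : IsProbabilityMeasure (haarSU2.map
      (fun k : SU2 => Complex.normSq ((k : Matrix (Fin 2) (Fin 2) ℂ) 0 0))) :=
    Measure.isProbabilityMeasure_map hc.measurable.aemeasurable
  refine ext_of_forall_integral_eq_of_IsFiniteMeasure fun f => ?_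
  rw [integral_map hc.measurable.aemeasurable f.continuous.aestronglyMeasurable]
  have key := integral_comp_eq_of_moments (μ := haarSU2)
    (ν := volume.restrict (Set.Icc (0 : ℝ) 1))
    (h := fun k : SU2 => Complex.normSq ((k : Matrix (Fin 2) (Fin 2) ℂ) 0 0)) (w := fun _ => 1)
    (h' := fun x => x) (w' := fun _ => 1) (A := 0) (B := 1) hc.measurable.aemeasurable
    (integrable_const _) aemeasurable_id (integrable_const _)
    (Eventually.of_forall fun k => ⟨Complex.normSq_nonneg _, by
      linarith [SU2_normSq_col k, Complex.normSq_nonneg ((k : Matrix (Fin 2) (Fin 2) ℂ) 1 0)]⟩)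
    (ae_restrict_mem measurableSet_Icc) (fun n => ?_) f.continuous
  · simp only [mul_one] at key
    rw [integral_complex_ofReal, integral_complex_ofReal] at key
    exact_mod_cast key
  · simp only [mul_one, ← Complex.ofReal_pow]
    rw [integral_complex_ofReal, integral_complex_ofReal, integral_haarSU2_normSq_pow,
      integral_Icc_eq_integral_Ioc, ← intervalIntegral.integral_of_le zero_le_one, integral_pow]
    simp

/-! ### The coordinates of a dressing orbit -/

section Orbit

variable (r Λ : ℝ)

theorem dressing_zero (k : SU2) : dressing 0 k (Λ, 0) =
    (Λ * (Complex.normSq ((k : Matrix (Fin 2) (Fin 2) ℂ) 0 0)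
      - Complex.normSq ((k : Matrix (Fin 2) (Fin 2) ℂ) 1 0)),
      Λ * ((k : Matrix (Fin 2) (Fin 2) ℂ) 1 0 *
        (starRingEnd ℂ) ((k : Matrix (Fin 2) (Fin 2) ℂ) 0 0))) := by
  obtain ⟨a, b, h, rfl⟩ : ∃ a b h, k = mkSU2 a b h := ⟨_, _, _, SU2_eq_mk k⟩
  unfold dressing
  rw [if_pos rfl]
  ext1
  · simp [mkSU2, Matrix.mul_apply, Fin.sum_univ_two, Complex.normSq_apply]
    ring
  · simp [mkSU2, Matrix.mul_apply, Fin.sum_univ_two]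
    ring

/-- The number `e^{rH}` on the dressing orbit, as a function of the squared modulus of an entry. -/
noncomputable def expHeight (x : ℝ) : ℝ := x * Real.exp (r * Λ) + (1 - x) * Real.exp (-(r * Λ))

theorem expHeight_pos {x : ℝ} (h0 : 0 ≤ x) (h1 : x ≤ 1) : 0 < expHeight r Λ x := by
  unfold expHeight
  have e1 := Real.exp_pos (r * Λ)
  have e2 := Real.exp_pos (-(r * Λ))
  rcases h0.eq_or_lt with rfl | h
  · simpa using e2
  · have := mul_pos h e1
    have := mul_nonneg (sub_nonneg.mpr h1) e2.le
    linarith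

/-- The base point is diagonal, so `(k b)(k b)ᴴ = k diag(e^{rΛ}, e^{-rΛ}) kᴴ`, whose first column
involves only the first column of `k`. -/
theorem dressing_of_ne_zero {r : ℝ} (hr : r ≠ 0) (k : SU2) : dressing r k (Λ, 0) =
    (Real.log (expHeight r Λ (Complex.normSq ((k : Matrix (Fin 2) (Fin 2) ℂ) 0 0))) / r,
      ((k : Matrix (Fin 2) (Fin 2) ℂ) 1 0 *
        (starRingEnd ℂ) ((k : Matrix (Fin 2) (Fin 2) ℂ) 0 0)) *
        ((Real.exp (r * Λ) - Real.exp (-(r * Λ)) : ℝ) : ℂ) / (2 * r *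
        ((√(expHeight r Λ (Complex.normSq ((k : Matrix (Fin 2) (Fin 2) ℂ) 0 0))) : ℝ) : ℂ))) := by
  obtain ⟨a, b, h, rfl⟩ : ∃ a b h, k = mkSU2 a b h := ⟨_, _, _, SU2_eq_mk k⟩
  unfold dressing
  rw [if_neg hr]
  have e1 : Real.exp (r * Λ / 2) * Real.exp (r * Λ / 2) = Real.exp (r * Λ) := by
    rw [← Real.exp_add]; ring_nf
  have e2 : Real.exp (-(r * Λ / 2)) * Real.exp (-(r * Λ / 2)) = Real.exp (-(r * Λ)) := by
    rw [← Real.exp_add]; ring_nf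
  have h00 : (((mkSU2 a b h : Matrix (Fin 2) (Fin 2) ℂ) * toNA r (Λ, 0)) *
      ((mkSU2 a b h : Matrix (Fin 2) (Fin 2) ℂ) * toNA r (Λ, 0))ᴴ) 0 0 =
      ((expHeight r Λ (Complex.normSq a) : ℝ) : ℂ) := by
    have hb : 1 - Complex.normSq a = Complex.normSq b := by linarith
    rw [expHeight, hb, ← e1, ← e2]
    push_cast
    rw [← Complex.mul_conj, ← Complex.mul_conj]
    simp [mkSU2, toNA, Matrix.mul_apply, Fin.sum_univ_two, ← Complex.exp_conj, Complex.conj_ofReal,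
      Complex.conj_ofNat]
    ring
  have h10 : (((mkSU2 a b h : Matrix (Fin 2) (Fin 2) ℂ) * toNA r (Λ, 0)) *
      ((mkSU2 a b h : Matrix (Fin 2) (Fin 2) ℂ) * toNA r (Λ, 0))ᴴ) 1 0 =
      b * (starRingEnd ℂ) a * ((Real.exp (r * Λ) - Real.exp (-(r * Λ)) : ℝ) : ℂ) := by
    rw [← e1, ← e2]
    push_cast
    simp [mkSU2, toNA, Matrix.mul_apply, Fin.sum_univ_two, ← Complex.exp_conj, Complex.conj_ofReal,
      Complex.conj_ofNat]
    ring
  simp only [h00, h10, Complex.ofReal_re]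
  simp [mkSU2]

theorem continuous_dressing : Continuous fun k : SU2 => dressing r k (Λ, 0) := by
  have h1 := continuous_SU2_entry 0 0
  have h2 := continuous_SU2_entry 1 0
  have h3 : Continuous fun k : SU2 => Complex.normSq ((k : Matrix (Fin 2) (Fin 2) ℂ) 0 0) :=
    Complex.continuous_normSq.comp h1
  have h4 : Continuous fun k : SU2 => Complex.normSq ((k : Matrix (Fin 2) (Fin 2) ℂ) 1 0) :=
    Complex.continuous_normSq.comp h2
  have h5 : Continuous fun k : SU2 => (k : Matrix (Fin 2) (Fin 2) ℂ) 1 0 *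
        (starRingEnd ℂ) ((k : Matrix (Fin 2) (Fin 2) ℂ) 0 0) :=
    h2.mul (Complex.continuous_conj.comp h1)
  by_cases hr : r = 0
  · subst hr
    simp only [dressing_zero]
    exact (continuous_const.mul (h3.sub h4)).prodMk (continuous_const.mul h5)
  · simp only [dressing_of_ne_zero Λ hr]
    have hpos : ∀ k : SU2, 0 < expHeight r Λ
        (Complex.normSq ((k : Matrix (Fin 2) (Fin 2) ℂ) 0 0)) := fun k =>
      expHeight_pos r Λ (Complex.normSq_nonneg _) (by
        linarith [SU2_normSq_col k, Complex.normSq_nonneg ((k : Matrix (Fin 2) (Fin 2) ℂ) 1 0)])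
    have hE : Continuous fun k : SU2 => expHeight r Λ
        (Complex.normSq ((k : Matrix (Fin 2) (Fin 2) ℂ) 0 0)) := by
      unfold expHeight; fun_prop
    refine Continuous.prodMk ((hE.log fun k => (hpos k).ne').div_const _) ?_
    refine (h5.mul continuous_const).div
      (continuous_const.mul (Complex.continuous_ofReal.comp hE.sqrt)) fun k => ?_
    have h : ((√(expHeight r Λ (Complex.normSq ((k : Matrix (Fin 2) (Fin 2) ℂ) 0 0))) : ℝ) : ℂ)
        ≠ 0 := by exact_mod_cast (Real.sqrt_pos.mpr (hpos k)).ne'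
    have hr' : (r : ℂ) ≠ 0 := by exact_mod_cast hr
    exact mul_ne_zero (mul_ne_zero two_ne_zero hr') h

/-- The function `H` on the dressing orbit, as a function of the squared modulus of an entry. -/
noncomputable def orbitHeight (x : ℝ) : ℝ :=
  if r = 0 then Λ * (2 * x - 1) else Real.log (expHeight r Λ x) / r

theorem dressing_fst (k : SU2) : (dressing r k (Λ, 0)).1
    = orbitHeight r Λ (Complex.normSq ((k : Matrix (Fin 2) (Fin 2) ℂ) 0 0)) := by
  unfold orbitHeight
  split_ifs with hr
  · subst hr
    rw [dressing_zero]
    have := SU2_normSq_col k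
    simp only
    rw [show Complex.normSq ((k : Matrix (Fin 2) (Fin 2) ℂ) 1 0)
      = 1 - Complex.normSq ((k : Matrix (Fin 2) (Fin 2) ℂ) 0 0) by linarith]
    ring
  · rw [dressing_of_ne_zero Λ hr]

/-- The function `|F|²` on the dressing orbit, as a function of the coordinate `H`. -/
noncomputable def radiusSq (x : ℝ) : ℝ :=
  if r = 0 then (Λ ^ 2 - x ^ 2) / 4 else (Real.cosh (r * Λ) - Real.cosh (r * x)) / (2 * r ^ 2)

/-- For `r ≠ 0` the trace of `b bᴴ`, which is `2 cosh (rH) + 4r²|F|²`, is constant along dressing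
orbits; for `r = 0` the invariant is `H² + 4|F|²`. Hence `H` determines `|F|²`. The proof checks
this in coordinates. -/
theorem dressing_snd (k : SU2) : Complex.normSq (dressing r k (Λ, 0)).2
    = radiusSq r Λ (dressing r k (Λ, 0)).1 := by
  have hc := SU2_normSq_col k
  have hb : Complex.normSq ((k : Matrix (Fin 2) (Fin 2) ℂ) 1 0)
      = 1 - Complex.normSq ((k : Matrix (Fin 2) (Fin 2) ℂ) 0 0) := by linarith
  unfold radiusSq
  split_ifs with hr
  · subst hr
    rw [dressing_zero]
    simp only [Complex.normSq_mul, Complex.normSq_conj, Complex.normSq_ofReal, hb]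
    ring
  · have hpos := expHeight_pos r Λ (Complex.normSq_nonneg ((k : Matrix (Fin 2) (Fin 2) ℂ) 0 0))
      (by linarith [Complex.normSq_nonneg ((k : Matrix (Fin 2) (Fin 2) ℂ) 1 0)])
    rw [dressing_of_ne_zero Λ hr]
    simp only [Complex.normSq_mul, Complex.normSq_div, Complex.normSq_conj, Complex.normSq_ofReal,
      hb, Real.mul_self_sqrt hpos.le]
    rw [mul_div_cancel₀ _ hr, Real.cosh_log hpos, Real.cosh_eq]
    have e : Real.exp (r * Λ) * Real.exp (-(r * Λ)) = 1 := by rw [← Real.exp_add]; simp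
    have h2 : Complex.normSq 2 = 4 := by norm_num [Complex.normSq_apply]
    rw [h2]
    field_simp
    unfold expHeight
    generalize Real.exp (r * Λ) = p at *
    generalize Real.exp (-(r * Λ)) = q at *
    generalize Complex.normSq ((k : Matrix (Fin 2) (Fin 2) ℂ) 0 0) = x at *
    linear_combination (-4 : ℝ) * e

/-- The diagonal torus acts on an orbit by rotating `F` and fixing `H`. This symmetry kills the
means of words of nonzero weight. -/
theorem dressing_phase (z : ℂ) (hz : Complex.normSq z + Complex.normSq 0 = 1) (k : SU2) :
    dressing r (mkSU2 z 0 hz * k) (Λ, 0) = ((dressing r k (Λ, 0)).1,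
      ((starRingEnd ℂ) z) ^ 2 * (dressing r k (Λ, 0)).2) := by
  have h1 : ((mkSU2 z 0 hz * k : SU2) : Matrix (Fin 2) (Fin 2) ℂ) 0 0 = z *
      ((k : Matrix (Fin 2) (Fin 2) ℂ) 0 0) := by
    simp [mkSU2, Matrix.mul_apply, Fin.sum_univ_two]
  have h2 : ((mkSU2 z 0 hz * k : SU2) : Matrix (Fin 2) (Fin 2) ℂ) 1 0 = (starRingEnd ℂ) z *
      ((k : Matrix (Fin 2) (Fin 2) ℂ) 1 0) := by
    simp [mkSU2, Matrix.mul_apply, Fin.sum_univ_two]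
  have hz' : Complex.normSq z = 1 := by simpa using hz
  by_cases hr : r = 0
  · subst hr
    rw [dressing_zero, dressing_zero, h1, h2]
    simp only [map_mul, hz', Complex.normSq_conj, one_mul]
    congr 1
    ring
  · rw [dressing_of_ne_zero Λ hr, dressing_of_ne_zero Λ hr, h1, h2]
    simp only [map_mul, hz', one_mul]
    congr 1
    ring

end Orbit

/-! ### The uniform measure of a dressing orbit -/

section Uniform

variable (r Λ : ℝ)

instance : IsProbabilityMeasure (uniformOrbit r Λ) :=
  Measure.isProbabilityMeasure_map (continuous_dressing r Λ).measurable.aemeasurable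

theorem isCompact_dressingOrbit : IsCompact (dressingOrbit r Λ) :=
  isCompact_range (continuous_dressing r Λ)

theorem ae_mem_dressingOrbit : ∀ᵐ g ∂uniformOrbit r Λ, g ∈ dressingOrbit r Λ := by
  exact (ae_map_iff (continuous_dressing r Λ).measurable.aemeasurable
    (p := fun g => g ∈ dressingOrbit r Λ) (isCompact_dressingOrbit r Λ).measurableSet).mpr
    (Eventually.of_forall fun k => ⟨k, rfl⟩)

theorem integral_uniformOrbit {f : SU2Star → ℂ} (hf : Continuous f) :
    ∫ g, f g ∂uniformOrbit r Λ = ∫ k, f (dressing r k (Λ, 0)) ∂haarSU2 :=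
  integral_map (continuous_dressing r Λ).measurable.aemeasurable hf.aestronglyMeasurable

theorem integral_uniformOrbit_eq_zero {f : SU2Star → ℂ} (hf : Continuous f) {z : ℂ}
    (hz : Complex.normSq z = 1) {c : ℂ} (hc : c ≠ 1)
    (h : ∀ g : SU2Star, f (g.1, ((starRingEnd ℂ) z) ^ 2 * g.2) = c * f g) :
    ∫ g, f g ∂uniformOrbit r Λ = 0 := by
  have hz' : Complex.normSq z + Complex.normSq 0 = 1 := by simpa using hz
  have key := integral_mul_left_eq_self (μ := haarSU2) (fun k => f (dressing r k (Λ, 0)))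
    (mkSU2 z 0 hz')
  simp only [dressing_phase, h] at key
  rw [integral_const_mul] at key
  rw [integral_uniformOrbit r Λ hf]
  have : (c - 1) * ∫ k, f (dressing r k (Λ, 0)) ∂haarSU2 = 0 := by linear_combination key
  exact (mul_eq_zero.mp this).resolve_left (sub_ne_zero.mpr hc)

theorem expHeight_continuous : Continuous (expHeight r Λ) := by
  unfold expHeight; fun_prop

theorem continuousOn_orbitHeight : ContinuousOn (orbitHeight r Λ) (Set.Icc 0 1) := by
  unfold orbitHeight
  split_ifs with hr
  · fun_prop
  · exact (ContinuousOn.log (expHeight_continuous r Λ).continuousOn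
      fun x hx => (expHeight_pos r Λ hx.1 hx.2).ne').div_const _

theorem integral_uniformOrbit_fst {G : ℝ → ℂ} (hG : Continuous G) :
    ∫ g, G g.1 ∂uniformOrbit r Λ = ∫ x in (0 : ℝ)..1, G (orbitHeight r Λ x) := by
  have hc : Continuous fun k : SU2 => Complex.normSq ((k : Matrix (Fin 2) (Fin 2) ℂ) 0 0) :=
    Complex.continuous_normSq.comp (continuous_SU2_entry 0 0)
  rw [integral_uniformOrbit r Λ (f := fun g => G g.1) (hG.comp continuous_fst)]
  simp only [dressing_fst]
  rw [intervalIntegral.integral_of_le zero_le_one, ← integral_Icc_eq_integral_Ioc,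
    ← map_normSq_haarSU2, integral_map hc.measurable.aemeasurable]
  rw [map_normSq_haarSU2]
  exact (hG.comp_continuousOn (continuousOn_orbitHeight r Λ)).aestronglyMeasurable
    measurableSet_Icc

variable {Λ}

/-- The density of `H` with respect to the uniform distribution is proportional to `e^{rH}`. -/
theorem integral_uniformOrbit_fst_eq (hΛ : 0 < Λ) {G : ℝ → ℂ} (hG : Continuous G) :
    ∫ g, G g.1 ∂uniformOrbit r Λ
      = (∫ t in (0 : ℝ)..1, ((Real.exp (r * (Λ * (2 * t - 1))) : ℝ) : ℂ) * G (Λ * (2 * t - 1))) /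
        ∫ t in (0 : ℝ)..1, ((Real.exp (r * (Λ * (2 * t - 1))) : ℝ) : ℂ) := by
  rw [integral_uniformOrbit_fst r Λ hG]
  by_cases hr : r = 0
  · subst hr
    simp [orbitHeight]
  set D := Real.exp (r * Λ) - Real.exp (-(r * Λ)) with hD
  have hD0 : D ≠ 0 := by
    intro h
    have := Real.exp_injective (sub_eq_zero.mp h)
    exact mul_ne_zero hr hΛ.ne' (by linarith)
  -- The change of variables that inverts `orbitHeight`: at `x = σ t` the height is `Λ (2t - 1)`.
  -- Its Jacobian is a constant times `e^{rH}`.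
  set σ : ℝ → ℝ := fun t => (Real.exp (r * (Λ * (2 * t - 1))) - Real.exp (-(r * Λ))) / D with hσ
  set c : ℝ := 2 * r * Λ / D with hcdef
  have hc0 : c ≠ 0 := div_ne_zero (mul_ne_zero (mul_ne_zero two_ne_zero hr) hΛ.ne') hD0
  have hσd : ∀ t, HasDerivAt σ (c * Real.exp (r * (Λ * (2 * t - 1)))) t := by
    intro t
    have h1 : HasDerivAt (fun t : ℝ => r * (Λ * (2 * t - 1))) (r * (Λ * (2 * 1))) t :=
      ((((hasDerivAt_id t).const_mul 2).sub_const 1).const_mul Λ).const_mul r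
    have h2 := (h1.exp.sub_const (Real.exp (-(r * Λ)))).div_const D
    refine h2.congr_deriv ?_
    rw [hcdef]
    ring
  have hσ0 : σ 0 = 0 := by simp [hσ]
  have hσ1 : σ 1 = 1 := by
    have : r * (Λ * (2 * 1 - 1)) = r * Λ := by ring
    simp only [hσ, this]
    exact div_self hD0
  have hσh : ∀ t, orbitHeight r Λ (σ t) = Λ * (2 * t - 1) := by
    intro t
    have : expHeight r Λ (σ t) = Real.exp (r * (Λ * (2 * t - 1))) := by
      have : expHeight r Λ (σ t) = σ t * D + Real.exp (-(r * Λ)) := by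
        rw [expHeight, hD]; ring
      rw [this, hσ]
      simp only
      rw [div_mul_cancel₀ _ hD0]
      ring
    rw [orbitHeight, if_neg hr, this, Real.log_exp, mul_div_cancel_left₀ _ hr]
  have hσm : ∀ t ∈ Set.Icc (0 : ℝ) 1, σ t ∈ Set.Icc (0 : ℝ) 1 := by
    -- No sign of `r` is assumed, so both monotonicities are allowed; the values `σ 0 = 0` and `σ 1
    -- = 1` then exclude the second.
    have hmono : Monotone σ ∨ Antitone σ := by
      rcases lt_or_gt_of_ne hc0 with h | h
      · exact Or.inr (antitone_of_hasDerivAt_nonpos hσd fun t => by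
          simpa using mul_nonpos_of_nonpos_of_nonneg h.le (Real.exp_pos _).le)
      · exact Or.inl (monotone_of_hasDerivAt_nonneg hσd fun t => by
          simpa using mul_nonneg h.le (Real.exp_pos _).le)
    intro t ht
    rcases hmono with h | h
    · have h0 := h ht.1
      have h1 := h ht.2
      rw [hσ0] at h0; rw [hσ1] at h1
      exact ⟨h0, h1⟩
    · have h0 := h (zero_le_one (α := ℝ))
      rw [hσ0, hσ1] at h0
      linarith
  have sub : ∀ G' : ℝ → ℂ, Continuous G' → ∫ x in (0 : ℝ)..1, G' (orbitHeight r Λ x)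
      = c * ∫ t in (0 : ℝ)..1, ((Real.exp (r * (Λ * (2 * t - 1))) : ℝ) : ℂ) *
          G' (Λ * (2 * t - 1)) := by
    intro G' hG'
    have h := intervalIntegral.integral_deriv_smul_comp'' (a := 0) (b := 1) (f := σ)
      (f' := fun t => c * Real.exp (r * (Λ * (2 * t - 1)))) (g := fun x => G' (orbitHeight r Λ x))
      (fun t _ => (hσd t).continuousAt.continuousWithinAt)
      (fun t _ => (hσd t).hasDerivWithinAt) (by fun_prop) ?_
    · rw [hσ0, hσ1] at h
      rw [← h, ← intervalIntegral.integral_const_mul]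
      refine intervalIntegral.integral_congr fun t _ => ?_
      simp only [Function.comp, hσh, Complex.real_smul]
      push_cast
      ring
    · refine (hG'.comp_continuousOn (continuousOn_orbitHeight r Λ)).mono ?_
      rintro _ ⟨t, ht, rfl⟩
      rw [Set.uIcc_of_le zero_le_one] at ht
      exact hσm t ht
  -- The constant function shows that the Jacobian constant `c` is the inverse of the normalizing
  -- integral.
  have h1 := sub (fun _ => 1) continuous_const
  simp only [mul_one, intervalIntegral.integral_const, sub_zero, one_smul] at h1
  rw [sub G hG]
  have hz : (∫ t in (0 : ℝ)..1, ((Real.exp (r * (Λ * (2 * t - 1))) : ℝ) : ℂ)) ≠ 0 := by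
    intro h
    rw [h, mul_zero] at h1
    exact one_ne_zero h1
  rw [eq_div_iff hz]
  linear_combination (-(∫ t in (0 : ℝ)..1, ((Real.exp (r * (Λ * (2 * t - 1))) : ℝ) : ℂ) *
          G (Λ * (2 * t - 1)))) * h1

/-! ### Orbits as level sets, and the orbit parameter -/

/-- One direction is the invariant of `dressing_snd`. For the other, an element of `SU₂` with first
column `(a, b)` is built: `|a|²` is read off from `e^{rH}`, `a` is taken real and nonnegative, and
`b` is then determined by `F` unless `a = 0`. -/
theorem mem_dressingOrbit_iff {r : ℝ} (hr : 0 < r) {Λ : ℝ} (hΛ : 0 ≤ Λ) (g : SU2Star) :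
    g ∈ dressingOrbit r Λ ↔
      Real.cosh (r * Λ) = Real.cosh (r * g.1) + 2 * r ^ 2 * Complex.normSq g.2 := by
  constructor
  · rintro ⟨k, rfl⟩
    have h := dressing_snd r Λ k
    simp only at h ⊢
    rw [h, radiusSq, if_neg hr.ne']
    field_simp
    ring
  · intro h
    have hle : Real.cosh (r * g.1) ≤ Real.cosh (r * Λ) := by
      rw [h]; nlinarith [Complex.normSq_nonneg g.2, sq_nonneg r]
    rw [Real.cosh_le_cosh, abs_of_nonneg (mul_nonneg hr.le hΛ)] at hle
    obtain ⟨hl, hu⟩ := abs_le.mp hle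
    obtain ⟨H, F⟩ := g
    simp only at h hl hu
    set p := Real.exp (r * Λ) with hp
    set q := Real.exp (-(r * Λ)) with hq
    set e := Real.exp (r * H) with he
    have hpq : p * q = 1 := by rw [hp, hq, ← Real.exp_add]; simp
    have he0 : 0 < e := Real.exp_pos _
    have hqe : q ≤ e := Real.exp_le_exp.mpr (by linarith)
    have hep : e ≤ p := Real.exp_le_exp.mpr hu
    -- The level set equation multiplied by `2e` and factored by means of `p q = 1`.
    have hF : 4 * r ^ 2 * Complex.normSq F * e = (e - q) * (p - e) := by
      rw [Real.cosh_eq, Real.cosh_eq, ← hp, ← hq, ← he, Real.exp_neg, ← he] at h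
      field_simp at h
      linear_combination (-1 : ℝ) * h + hpq
    have hlogH : Real.log e / r = H := by
      rw [he, Real.log_exp, mul_div_cancel_left₀ _ hr.ne']
    have hgoal : ∀ (a b : ℂ) (hab : Complex.normSq a + Complex.normSq b = 1),
        expHeight r Λ (Complex.normSq a) = e →
        b * (starRingEnd ℂ) a * ((p - q : ℝ) : ℂ) = F * (2 * r * ((√e : ℝ) : ℂ)) →
        ((H, F) : SU2Star) ∈ dressingOrbit r Λ := by
      intro a b hab h1 h2
      refine ⟨mkSU2 a b hab, ?_⟩
      simp only
      rw [dressing_of_ne_zero Λ hr.ne']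
      have e1 : ((mkSU2 a b hab : SU2) : Matrix (Fin 2) (Fin 2) ℂ) 0 0 = a := by simp [mkSU2]
      have e2 : ((mkSU2 a b hab : SU2) : Matrix (Fin 2) (Fin 2) ℂ) 1 0 = b := by simp [mkSU2]
      rw [e1, e2, h1, hlogH, h2, mul_div_cancel_right₀]
      have h3 : ((√e : ℝ) : ℂ) ≠ 0 := by exact_mod_cast (Real.sqrt_pos.mpr he0).ne'
      have hr' : (r : ℂ) ≠ 0 := by exact_mod_cast hr.ne'
      exact mul_ne_zero (mul_ne_zero two_ne_zero hr') h3
    -- The case `e = q` is the lowest point `H = -Λ`, `F = 0`, reached with `a = 0`. It contains the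
    -- one-point orbit `Λ = 0`, so `p - q` is positive in the other case.
    rcases hqe.eq_or_lt with hqe' | hqe'
    · have hF0 : F = 0 := by
        rw [← hqe', sub_self, zero_mul] at hF
        have : Complex.normSq F = 0 := by
          rcases mul_eq_zero.mp hF with h | h
          · rcases mul_eq_zero.mp h with h | h
            · exact absurd h (by positivity)
            · exact h
          · rw [hqe'] at h; exact absurd h he0.ne'
        exact Complex.normSq_eq_zero.mp this
      refine hgoal 0 1 (by simp) ?_ ?_
      · simp [expHeight, ← hqe', hq]
      · simp [hF0]
    · have hD : 0 < p - q := by linarith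
      set A := (e - q) / (p - q) with hA
      have hA0 : 0 < A := div_pos (by linarith) hD
      have hsA : (√A : ℝ) ^ 2 = A := Real.sq_sqrt hA0.le
      have hsA0 : 0 < √A := Real.sqrt_pos.mpr hA0
      have hAD : A * (p - q) = e - q := div_mul_cancel₀ _ hD.ne'
      have hse : (√e : ℝ) ^ 2 = e := Real.sq_sqrt he0.le
      refine hgoal ((√A : ℝ) : ℂ) (F * ((2 * r * √e / (√A * (p - q)) : ℝ) : ℂ)) ?_ ?_ ?_
      · rw [Complex.normSq_ofReal, Complex.normSq_mul, Complex.normSq_ofReal, ← pow_two, ← pow_two,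
          div_pow, mul_pow, mul_pow, mul_pow, hsA, hse]
        have h1 : Complex.normSq F * (2 ^ 2 * r ^ 2 * e / (A * (p - q) ^ 2)) = 1 - A := by
          clear_value A
          rw [← mul_div_assoc, div_eq_iff (by positivity)]
          linear_combination hF - (p - q - (A * (p - q) + (e - q))) * hAD
        rw [h1]
        ring
      · rw [Complex.normSq_ofReal, ← pow_two, hsA, expHeight]
        linear_combination hAD
      · rw [Complex.conj_ofReal]
        have h1 : ((√A : ℝ) : ℂ) ≠ 0 := by exact_mod_cast hsA0.ne'
        have h2 : ((p - q : ℝ) : ℂ) ≠ 0 := by exact_mod_cast hD.ne'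
        push_cast at h2 ⊢
        field_simp

/-- The hyperbolic cosine of `r Λ(g)`. -/
noncomputable def coshParam (g : SU2Star) : ℝ :=
  Real.cosh (r * g.1) + 2 * r ^ 2 * Complex.normSq g.2

theorem one_le_coshParam (g : SU2Star) : 1 ≤ coshParam r g := by
  unfold coshParam
  nlinarith [Real.one_le_cosh (r * g.1),
    mul_nonneg (sq_nonneg r) (Complex.normSq_nonneg g.2)]

theorem continuous_coshParam : Continuous (coshParam r) := by
  unfold coshParam
  exact (Real.continuous_cosh.comp (continuous_const.mul continuous_fst)).add
    (continuous_const.mul (Complex.continuous_normSq.comp continuous_snd))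

/-- Injectivity of `cosh` on `[0, ∞)` makes the set in the definition of `orbitParam` a singleton,
so its infimum is the actual parameter. -/
theorem orbitParam_eq {r : ℝ} (hr : 0 < r) (g : SU2Star) :
    orbitParam r g = Real.arcosh (coshParam r g) / r := by
  have h1 := one_le_coshParam r g
  have : {Λ | 0 ≤ Λ ∧ g ∈ dressingOrbit r Λ} = {Real.arcosh (coshParam r g) / r} := by
    ext Λ
    rw [Set.mem_singleton_iff]
    constructor
    · rintro ⟨h0, hm⟩
      rw [mem_dressingOrbit_iff hr h0] at hm
      rw [coshParam, ← hm, Real.arcosh_cosh (mul_nonneg hr.le h0), mul_div_cancel_left₀ _ hr.ne']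
    · rintro rfl
      have h0 : 0 ≤ Real.arcosh (coshParam r g) / r := div_nonneg (Real.arcosh_nonneg h1) hr.le
      refine ⟨h0, ?_⟩
      rw [mem_dressingOrbit_iff hr h0, mul_div_cancel₀ _ hr.ne', Real.cosh_arcosh h1]
      rfl
  rw [orbitParam, this, csInf_singleton]

end Uniform

/-! ### Averages over weights are Riemann sums -/

section Riemann

/-- The weights of the representation of dimension `n + 1`, as a step function on `[0, 1)`. -/
noncomputable def stepWt (ħ : ℝ) (n : ℕ) (t : ℝ) : ℝ := ħ * (2 * (⌊((n : ℝ) + 1) * t⌋₊ : ℝ) - n)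

theorem measurable_stepWt (ħ : ℝ) (n : ℕ) : Measurable (stepWt ħ n) := by
  unfold stepWt
  have : Measurable fun t : ℝ => ((⌊((n : ℝ) + 1) * t⌋₊ : ℕ) : ℝ) :=
    measurable_from_nat.comp (Nat.measurable_floor.comp (measurable_const.mul measurable_id))
  exact ((this.const_mul 2).sub_const _).const_mul _

theorem integral_floor (n : ℕ) (g : ℕ → ℂ) :
    ∫ t in (0 : ℝ)..1, g ⌊((n : ℝ) + 1) * t⌋₊ = (∑ i : Fin (n + 1), g i) / (n + 1) := by
  have hn : (0 : ℝ) < (n : ℝ) + 1 := by positivity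
  set a : ℕ → ℝ := fun k => k / ((n : ℝ) + 1) with ha
  have hle : ∀ k, a k ≤ a (k + 1) := fun k => by
    simp only [ha]; gcongr; simp
  have hfl : ∀ k, ∀ t ∈ Set.Ioo (a k) (a (k + 1)), g ⌊((n : ℝ) + 1) * t⌋₊ = g k := by
    intro k t ht
    have h1 : (k : ℝ) < ((n : ℝ) + 1) * t := by
      have := ht.1
      simp only [ha] at this
      rw [div_lt_iff₀ hn] at this
      linarith
    have h2 : ((n : ℝ) + 1) * t < (k : ℝ) + 1 := by
      have := ht.2
      simp only [ha] at this
      rw [lt_div_iff₀ hn] at this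
      push_cast at this
      linarith
    congr 1
    rw [Nat.floor_eq_iff (by linarith [Nat.cast_nonneg (α := ℝ) k])]
    exact ⟨h1.le, h2⟩
  have hae : ∀ k, ∀ᵐ t ∂(volume : Measure ℝ), t ∈ Set.uIoc (a k) (a (k + 1)) →
      g ⌊((n : ℝ) + 1) * t⌋₊ = g k := by
    intro k
    -- Interval integrals use half-open intervals closed on the right, where the floor has already
    -- jumped; this single point is discarded.
    have : ∀ᵐ t ∂(volume : Measure ℝ), t ≠ a (k + 1) := by
      simp [ae_iff, measure_singleton]
    filter_upwards [this] with t ht hmem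
    rw [Set.uIoc_of_le (hle k)] at hmem
    exact hfl k t ⟨hmem.1, lt_of_le_of_ne hmem.2 ht⟩
  have hint : ∀ k < n + 1, IntervalIntegrable (fun t => g ⌊((n : ℝ) + 1) * t⌋₊) volume
      (a k) (a (k + 1)) := by
    intro k _
    refine (intervalIntegrable_const (c := g k)).congr_ae ?_
    rw [Filter.EventuallyEq, ae_restrict_iff' measurableSet_uIoc]
    filter_upwards [hae k] with t ht hmem
    exact (ht hmem).symm
  have h := intervalIntegral.sum_integral_adjacent_intervals hint
  have h0 : a 0 = 0 := by simp [ha]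
  have h1 : a (n + 1) = 1 := by
    simp only [ha]; push_cast; exact div_self hn.ne'
  rw [h0, h1] at h
  rw [← h, Fin.sum_univ_eq_sum_range (fun i => g i), Finset.sum_div]
  refine Finset.sum_congr rfl fun k _ => ?_
  rw [intervalIntegral.integral_congr_ae (hae k), intervalIntegral.integral_const,
    Complex.real_smul]
  have : a (k + 1) - a k = 1 / ((n : ℝ) + 1) := by
    simp only [ha]; push_cast; field_simp; ring
  rw [this]
  push_cast
  ring

theorem average_eq_integral_stepWt (ħ : ℝ) (n : ℕ) (g : ℝ → ℂ) :
    (∑ i : Fin (n + 1), g (ħ * wtIdx n i)) / (n + 1) = ∫ t in (0 : ℝ)..1, g (stepWt ħ n t) :=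
  (integral_floor n fun i => g (ħ * (2 * (i : ℝ) - n))).symm

theorem level_mul_le {Λ ħ : ℝ} (hΛ : 0 < Λ) (hħ : 0 < ħ) : ħ * level Λ ħ ≤ Λ := by
  have h := Nat.floor_le (div_pos hΛ hħ).le
  rw [level]
  calc ħ * (⌊Λ / ħ⌋₊ : ℝ) ≤ ħ * (Λ / ħ) := by gcongr
    _ = Λ := mul_div_cancel₀ _ hħ.ne'

theorem lt_level_mul {Λ ħ : ℝ} (hħ : 0 < ħ) : Λ - ħ < ħ * level Λ ħ := by
  have h := Nat.lt_floor_add_one (Λ / ħ)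
  rw [level]
  have : ħ * (Λ / ħ) < ħ * ((⌊Λ / ħ⌋₊ : ℝ) + 1) := by gcongr
  rw [mul_div_cancel₀ _ hħ.ne'] at this
  linarith

theorem tendsto_level {Λ : ℝ} (hΛ : 0 < Λ) :
    Tendsto (fun ħ : ℝ => ħ * level Λ ħ) (𝓝[>] 0) (𝓝 Λ) := by
  have h0 : Tendsto (fun ħ : ℝ => Λ - ħ) (𝓝[>] 0) (𝓝 Λ) := by
    have : Tendsto (fun ħ : ℝ => Λ - ħ) (𝓝 0) (𝓝 (Λ - 0)) := by
      exact (continuous_const.sub continuous_id).tendsto 0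
    rw [sub_zero] at this
    exact this.mono_left nhdsWithin_le_nhds
  refine tendsto_of_tendsto_of_tendsto_of_le_of_le' h0 tendsto_const_nhds ?_ ?_
  · filter_upwards [self_mem_nhdsWithin] with ħ hħ using (lt_level_mul hħ).le
  · filter_upwards [self_mem_nhdsWithin] with ħ hħ using level_mul_le hΛ hħ

theorem abs_mul_wtIdx_le {ħ : ℝ} (hħ : 0 ≤ ħ) (n : ℕ) (i : Fin (n + 1)) :
    |ħ * wtIdx n i| ≤ ħ * n := by
  have h1 : ((i : ℕ) : ℝ) ≤ n := by exact_mod_cast Nat.lt_succ_iff.mp i.2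
  have h2 : (0 : ℝ) ≤ ((i : ℕ) : ℝ) := Nat.cast_nonneg _
  rw [abs_mul, abs_of_nonneg hħ]
  refine mul_le_mul_of_nonneg_left (abs_le.mpr ⟨?_, ?_⟩) hħ <;> unfold wtIdx <;> linarith

theorem stepWt_mem {Λ ħ : ℝ} (hΛ : 0 < Λ) (hħ : 0 < ħ) {t : ℝ} (h0 : 0 ≤ t) (h1 : t < 1) :
    stepWt ħ (level Λ ħ) t ∈ Set.Icc (-Λ) Λ := by
  set n := level Λ ħ
  -- At `t = 1` the floor would be `n + 1`, one step past the highest weight; hence the strict bound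
  -- on `t`.
  have hlt : ⌊((n : ℝ) + 1) * t⌋₊ < n + 1 := by
    rw [Nat.floor_lt (by positivity)]
    push_cast
    nlinarith [show (0 : ℝ) < (n : ℝ) + 1 by positivity]
  have h := (abs_mul_wtIdx_le hħ.le n ⟨_, hlt⟩).trans (level_mul_le hΛ hħ)
  exact abs_le.mp h

theorem tendsto_stepWt {Λ : ℝ} (hΛ : 0 < Λ) {t : ℝ} (h0 : 0 ≤ t) :
    Tendsto (fun ħ => stepWt ħ (level Λ ħ) t) (𝓝[>] 0) (𝓝 (Λ * (2 * t - 1))) := by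
  have hid : Tendsto (fun ħ : ℝ => ħ) (𝓝[>] 0) (𝓝 0) := tendsto_id.mono_left nhdsWithin_le_nhds
  have hl := tendsto_level hΛ
  have hfl : Tendsto (fun ħ : ℝ => ħ * (⌊((level Λ ħ : ℝ) + 1) * t⌋₊ : ℝ)) (𝓝[>] 0)
      (𝓝 (Λ * t)) := by
    have hu : Tendsto (fun ħ : ℝ => (ħ * level Λ ħ + ħ) * t) (𝓝[>] 0) (𝓝 (Λ * t)) := by
      simpa using (hl.add hid).mul_const t
    have hlo : Tendsto (fun ħ : ℝ => (ħ * level Λ ħ + ħ) * t - ħ) (𝓝[>] 0) (𝓝 (Λ * t)) := by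
      simpa using hu.sub hid
    refine tendsto_of_tendsto_of_tendsto_of_le_of_le' hlo hu ?_ ?_
    · filter_upwards [self_mem_nhdsWithin] with ħ hħ
      have hħ' : (0 : ℝ) < ħ := hħ
      have := Nat.lt_floor_add_one (((level Λ ħ : ℝ) + 1) * t)
      nlinarith
    · filter_upwards [self_mem_nhdsWithin] with ħ hħ
      have hħ' : (0 : ℝ) < ħ := hħ
      have := Nat.floor_le (show 0 ≤ ((level Λ ħ : ℝ) + 1) * t by positivity)
      nlinarith
  have := (hfl.const_mul 2).sub hl
  refine (this.congr fun ħ => ?_).trans (le_of_eq ?_)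
  · unfold stepWt; ring
  · congr 1; ring

variable {P : Type*} [TopologicalSpace P]

/-- Supplies the constant for dominated convergence when the integrand depends on a moving
parameter; compactness of `K` gives a neighbourhood of `p₀` common to all `y`. -/
theorem eventually_bounded_of_isCompact {Y : Type*} [TopologicalSpace Y] {Φ : P × Y → ℂ}
    (hΦ : Continuous Φ) {K : Set Y} (hK : IsCompact K) (p₀ : P) :
    ∃ C : ℝ, ∀ᶠ p in 𝓝 p₀, ∀ y ∈ K, ‖Φ (p, y)‖ ≤ C := by
  obtain ⟨C, hC⟩ := hK.exists_bound_of_continuousOn (f := fun y => Φ (p₀, y))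
    (by fun_prop)
  refine ⟨C + 1, ?_⟩
  refine hK.eventually_forall_of_forall_eventually fun y hy => ?_
  have : ∀ᶠ z in 𝓝 (p₀, y), ‖Φ z‖ < C + 1 :=
    (hΦ.norm.tendsto (p₀, y)).eventually_lt_const (by linarith [hC y hy])
  exact this.mono fun z hz => hz.le

/-- Averages over the weights of `V(Λ^ħ)` converge to averages over `[-Λ, Λ]`. -/
theorem tendsto_average {Φ : P × ℝ → ℂ} (hΦ : Continuous Φ) {p : ℝ → P} {p₀ : P}
    (hp : Tendsto p (𝓝[>] 0) (𝓝 p₀)) {Λ : ℝ} (hΛ : 0 < Λ) :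
    Tendsto (fun ħ => (∑ i : Fin (level Λ ħ + 1), Φ (p ħ, ħ * wtIdx (level Λ ħ) i)) /
      ((level Λ ħ : ℂ) + 1)) (𝓝[>] 0) (𝓝 (∫ t in (0 : ℝ)..1, Φ (p₀, Λ * (2 * t - 1)))) := by
  have e : ∀ ħ : ℝ, (∑ i : Fin (level Λ ħ + 1), Φ (p ħ, ħ * wtIdx (level Λ ħ) i)) /
      ((level Λ ħ : ℂ) + 1) = ∫ t in (0 : ℝ)..1, Φ (p ħ, stepWt ħ (level Λ ħ) t) := fun ħ =>
    average_eq_integral_stepWt ħ (level Λ ħ) fun x => Φ (p ħ, x)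
  simp only [e]
  obtain ⟨C, hC⟩ := eventually_bounded_of_isCompact hΦ (isCompact_Icc (a := -Λ) (b := Λ)) p₀
  refine intervalIntegral.tendsto_integral_filter_of_dominated_convergence (fun _ => C) ?_ ?_ ?_ ?_
  · refine Eventually.of_forall fun ħ => Measurable.aestronglyMeasurable ?_
    exact (hΦ.comp (continuous_const.prodMk continuous_id)).measurable.comp (measurable_stepWt ħ _)
  · filter_upwards [self_mem_nhdsWithin, hp.eventually hC] with ħ hħ hCħ
    have : ∀ᵐ t ∂(volume : Measure ℝ), t ≠ 1 := by
      simp [ae_iff, measure_singleton]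
    filter_upwards [this] with t ht hmem
    rw [Set.uIoc_of_le zero_le_one] at hmem
    exact hCħ _ (stepWt_mem hΛ hħ hmem.1.le (lt_of_le_of_ne hmem.2 ht))
  · exact intervalIntegrable_const
  · refine Eventually.of_forall fun t hmem => ?_
    rw [Set.uIoc_of_le zero_le_one] at hmem
    exact (hΦ.tendsto _).comp (hp.prodMk_nhds (tendsto_stepWt hΛ hmem.1.le))

/-- Averages over pairs of weights converge to averages over a rectangle. -/
theorem tendsto_average₂ {Φ : P × (ℝ × ℝ) → ℂ} (hΦ : Continuous Φ) {p : ℝ → P} {p₀ : P}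
    (hp : Tendsto p (𝓝[>] 0) (𝓝 p₀)) {Λ₁ Λ₂ : ℝ} (hΛ₁ : 0 < Λ₁) (hΛ₂ : 0 < Λ₂) :
    Tendsto (fun ħ => (∑ b : Fin (level Λ₁ ħ + 1) × Fin (level Λ₂ ħ + 1),
        Φ (p ħ, (ħ * wtIdx (level Λ₁ ħ) b.1, ħ * wtIdx (level Λ₂ ħ) b.2))) /
      (((level Λ₁ ħ : ℂ) + 1) * ((level Λ₂ ħ : ℂ) + 1))) (𝓝[>] 0)
      (𝓝 (∫ s in (0 : ℝ)..1, ∫ t in (0 : ℝ)..1,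
        Φ (p₀, (Λ₁ * (2 * s - 1), Λ₂ * (2 * t - 1))))) := by
  have e : ∀ ħ : ℝ, (∑ b : Fin (level Λ₁ ħ + 1) × Fin (level Λ₂ ħ + 1),
        Φ (p ħ, (ħ * wtIdx (level Λ₁ ħ) b.1, ħ * wtIdx (level Λ₂ ħ) b.2))) /
      (((level Λ₁ ħ : ℂ) + 1) * ((level Λ₂ ħ : ℂ) + 1)) =
      ∫ s in (0 : ℝ)..1, (∑ j : Fin (level Λ₂ ħ + 1),
        Φ (p ħ, (stepWt ħ (level Λ₁ ħ) s, ħ * wtIdx (level Λ₂ ħ) j))) /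
          ((level Λ₂ ħ : ℂ) + 1) := by
    intro ħ
    -- Only the outer average is turned into an integral; the inner one remains a sum, to which
    -- `tendsto_average` applies for each fixed outer variable.
    rw [← average_eq_integral_stepWt ħ (level Λ₁ ħ) fun x => (∑ j : Fin (level Λ₂ ħ + 1),
        Φ (p ħ, (x, ħ * wtIdx (level Λ₂ ħ) j))) / ((level Λ₂ ħ : ℂ) + 1), Fintype.sum_prod_type,
      ← Finset.sum_div, div_div, mul_comm ((level Λ₂ ħ : ℂ) + 1)]
  simp only [e]
  obtain ⟨C, hC⟩ := eventually_bounded_of_isCompact hΦ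
    ((isCompact_Icc (a := -Λ₁) (b := Λ₁)).prod (isCompact_Icc (a := -Λ₂) (b := Λ₂))) p₀
  refine intervalIntegral.tendsto_integral_filter_of_dominated_convergence (fun _ => C) ?_ ?_ ?_ ?_
  · refine Eventually.of_forall fun ħ => Measurable.aestronglyMeasurable ?_
    refine Measurable.div_const (Finset.measurable_sum _ fun j _ => ?_) _
    exact (hΦ.comp (continuous_const.prodMk
      (continuous_id.prodMk continuous_const))).measurable.comp (measurable_stepWt ħ _)
  · filter_upwards [self_mem_nhdsWithin, hp.eventually hC] with ħ hħ hCħ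
    have : ∀ᵐ t ∂(volume : Measure ℝ), t ≠ 1 := by
      simp [ae_iff, measure_singleton]
    filter_upwards [this] with s hs hmem
    rw [Set.uIoc_of_le zero_le_one] at hmem
    have hmem' := stepWt_mem hΛ₁ hħ hmem.1.le (lt_of_le_of_ne hmem.2 hs)
    have hN : ‖((level Λ₂ ħ : ℂ) + 1)‖ = (level Λ₂ ħ : ℝ) + 1 := by
      rw [← Nat.cast_succ, Complex.norm_natCast]; push_cast; rfl
    rw [norm_div, hN, div_le_iff₀ (by positivity)]
    refine (norm_sum_le _ _).trans ?_
    refine (Finset.sum_le_sum fun j _ => hCħ (_, _) (Set.mk_mem_prod hmem' (abs_le.mp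
      ((abs_mul_wtIdx_le (le_of_lt hħ) _ j).trans (level_mul_le hΛ₂ hħ))))).trans ?_
    rw [Finset.sum_const, Finset.card_univ, Fintype.card_fin, nsmul_eq_mul]
    push_cast
    linarith
  · exact intervalIntegrable_const
  · refine Eventually.of_forall fun s hmem => ?_
    rw [Set.uIoc_of_le zero_le_one] at hmem
    -- The outer weight at `s` joins the convergent parameters of the inner average.
    exact tendsto_average (P := P × ℝ) (Φ := fun z => Φ (z.1.1, (z.1.2, z.2)))
      (p := fun ħ => (p ħ, stepWt ħ (level Λ₁ ħ) s)) (p₀ := (p₀, Λ₁ * (2 * s - 1)))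
      (by fun_prop) (hp.prodMk_nhds (tendsto_stepWt hΛ₁ hmem.1.le)) hΛ₂

end Riemann

/-! ### Observables are spanned by words in the generators -/

section Words

theorem specialize_gen (r ħ : ℝ) (i : Gen) :
    specialize r ħ (gen r planckVar (planckQ r) i) = gen r (ħ : ℂ) (qPow r ħ) i := by
  let _ : Algebra planckRing (Uq r ħ) := Algebra.compHom (Uq r ħ) (evalPlanck ħ)
  exact liftHom_gen (S := planckRing) _ (isQTuple_specialize r ħ) i

theorem specialize_smul (r ħ : ℝ) (c : planckRing) (𝓕 : Observable r) :
    specialize r ħ (c • 𝓕) = evalPlanck ħ c • specialize r ħ 𝓕 := by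
  let _ : Algebra planckRing (Uq r ħ) := Algebra.compHom (Uq r ħ) (evalPlanck ħ)
  exact map_smul (liftHom (gen r (ħ : ℂ) (qPow r ħ)) (isQTuple_specialize r ħ) :
    Observable r →ₐ[planckRing] Uq r ħ) c 𝓕

theorem modHbar_gen (r : ℝ) (i : Gen) :
    modHbar r (gen r planckVar (planckQ r) i) = coordTuple r i := by
  rw [modHbar, RingHom.comp_apply, specialize_gen]
  exact liftHom_gen _ (isQTuple_coord r) i

theorem modHbar_smul (r : ℝ) (c : planckRing) (𝓕 : Observable r) :
    modHbar r (c • 𝓕) = evalPlanck 0 c • modHbar r 𝓕 := by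
  rw [modHbar, RingHom.comp_apply, specialize_smul]
  exact map_smul (liftHom (coordTuple r) (isQTuple_coord r) : Uq r 0 →ₐ[ℂ] (SU2Star → ℂ)) _ _

theorem tendsto_evalPlanck (c : planckRing) :
    Tendsto (fun ħ => evalPlanck ħ c) (𝓝[>] 0) (𝓝 (evalPlanck 0 c)) := by
  have h : ContDiffAt ℝ ((⊤ : ℕ∞) : WithTop ℕ∞) (c : ℝ → ℂ) 0 := c.2
  exact h.continuousAt.tendsto.mono_left nhdsWithin_le_nhds

/-- The word in the generators of the algebra of observables given by a list. -/
noncomputable def word (r : ℝ) (l : List Gen) : Observable r :=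
  (l.map (gen r planckVar (planckQ r))).prod

theorem span_range_word (r : ℝ) :
    Submodule.span planckRing (Set.range (word r)) = ⊤ := by
  have h1 : Algebra.adjoin planckRing (Set.range (gen r planckVar (planckQ r))) = ⊤ := by
    have h := congrArg (Subalgebra.map (RingQuot.mkAlgHom planckRing
      (QRel r planckVar (planckQ r)))) (FreeAlgebra.adjoin_range_ι planckRing Gen)
    rw [AlgHom.map_adjoin, ← Set.range_comp, Algebra.map_top,
      (AlgHom.range_eq_top _).mpr (RingQuot.mkAlgHom_surjective _ _)] at h
    exact h
  have h2 := congrArg Subalgebra.toSubmodule h1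
  rw [Algebra.adjoin_eq_span, Algebra.top_toSubmodule] at h2
  rw [← top_le_iff, ← h2]
  refine Submodule.span_mono fun x hx => ?_
  obtain ⟨l, hl, rfl⟩ := Submonoid.exists_list_of_mem_closure hx
  have : ∀ l : List (Observable r), (∀ y ∈ l, y ∈ Set.range (gen r planckVar (planckQ r))) →
      ∃ l' : List Gen, l'.map (gen r planckVar (planckQ r)) = l := by
    intro l
    induction l with
    | nil => exact fun _ => ⟨[], rfl⟩
    | cons a l ih =>
      intro h
      obtain ⟨i, hi⟩ := h a (by simp)
      obtain ⟨l', hl'⟩ := ih fun y hy => h y (by simp [hy])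
      exact ⟨i :: l', by simp [hi, hl']⟩
  obtain ⟨l', hl'⟩ := this l hl
  exact ⟨l', by rw [word, hl']⟩

/-- Both sides of the limit statements are additive and compatible with coefficients in
`planckRing`, so words suffice. -/
theorem observable_induction {r : ℝ} {p : Observable r → Prop} (hw : ∀ l, p (word r l))
    (hadd : ∀ x y, p x → p y → p (x + y)) (hsmul : ∀ (c : planckRing) x, p x → p (c • x))
    (𝓕 : Observable r) : p 𝓕 := by
  have h : 𝓕 ∈ Submodule.span planckRing (Set.range (word r)) := by
    rw [span_range_word]; trivial
  induction h using Submodule.span_induction with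
  | mem x hx => obtain ⟨l, rfl⟩ := hx; exact hw l
  | zero => simpa using hsmul 0 _ (hw [])
  | add x y _ _ hx hy => exact hadd x y hx hy
  | smul c x _ hx => exact hsmul c x hx

theorem continuous_coordTuple (r : ℝ) (i : Gen) : Continuous (coordTuple r i) := by
  cases i
  · exact Complex.continuous_ofReal.comp continuous_fst
  · exact Complex.continuous_ofReal.comp (Real.continuous_exp.comp (by fun_prop))
  · exact Complex.continuous_ofReal.comp (Real.continuous_exp.comp (by fun_prop))
  · exact Complex.continuous_conj.comp continuous_snd
  · exact continuous_snd

theorem modHbar_word (r : ℝ) (l : List Gen) :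
    modHbar r (word r l) = (l.map (coordTuple r)).prod := by
  rw [word, map_list_prod, List.map_map]
  congr 2
  funext i
  exact modHbar_gen r i

theorem continuous_modHbar (r : ℝ) (𝓕 : Observable r) : Continuous (modHbar r 𝓕) := by
  induction 𝓕 using observable_induction with
  | hw l =>
    rw [modHbar_word]
    induction l with
    | nil => exact continuous_one
    | cons i l ih =>
      rw [List.map_cons, List.prod_cons]
      exact (continuous_coordTuple r i).mul ih
  | hadd x y hx hy => rw [map_add]; exact hx.add hy
  | hsmul c x hx => rw [modHbar_smul]; exact hx.const_smul _

/-- The matrix by which an observable acts on `V^q(ħ n)`. -/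
noncomputable def obsMat (r ħ : ℝ) (n : ℕ) :
    Observable r →+* Matrix (Fin (n + 1)) (Fin (n + 1)) ℂ :=
  (rep r ħ n).toRingHom.comp (specialize r ħ)

theorem obsMat_gen (r ħ : ℝ) (n : ℕ) (i : Gen) :
    obsMat r ħ n (gen r planckVar (planckQ r) i) = repTuple r ħ n i := by
  rw [obsMat, RingHom.comp_apply, specialize_gen]
  exact liftHom_gen _ (isQTuple_rep r ħ n) i

theorem obsMat_smul (r ħ : ℝ) (n : ℕ) (c : planckRing) (𝓕 : Observable r) :
    obsMat r ħ n (c • 𝓕) = evalPlanck ħ c • obsMat r ħ n 𝓕 := by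
  rw [obsMat, RingHom.comp_apply, specialize_smul]
  exact map_smul (rep r ħ n) _ _

theorem obsMat_word (r ħ : ℝ) (n : ℕ) (l : List Gen) :
    obsMat r ħ n (word r l) = (l.map (repTuple r ħ n)).prod := by
  rw [word, map_list_prod, List.map_map]
  congr 2
  funext i
  exact obsMat_gen r ħ n i

theorem rep_qNegH (r ħ : ℝ) (n : ℕ) : rep r ħ n (qNegH r ħ)
    = Matrix.diagonal fun i => ((Real.exp (r * (ħ * wtIdx n i)) : ℝ) : ℂ) := by
  rw [qNegH, map_mul]
  have : rep r ħ n (gen r (ħ : ℂ) (qPow r ħ) .kInv) = repTuple r ħ n .kInv :=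
    liftHom_gen _ (isQTuple_rep r ħ n) _
  rw [this]
  simp only [repTuple, Matrix.diagonal_mul_diagonal, ← Complex.ofReal_mul, ← Real.exp_add]
  congr 1
  funext i
  congr 2
  ring

theorem weightedTrace_eq (r Λ : ℝ) (𝓕 : Observable r) (ħ : ℝ) : weightedTrace r Λ 𝓕 ħ
    = (∑ i, ((Real.exp (r * (ħ * wtIdx (level Λ ħ) i)) : ℝ) : ℂ) *
        obsMat r ħ (level Λ ħ) 𝓕 i i) /
      ∑ i, ((Real.exp (r * (ħ * wtIdx (level Λ ħ) i)) : ℝ) : ℂ) := by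
  rw [weightedTrace, map_mul, rep_qNegH, Matrix.trace_diagonal]
  congr 1
  rw [Matrix.trace]
  refine Finset.sum_congr rfl fun i _ => ?_
  rw [Matrix.diag_apply, Matrix.diagonal_mul]
  rfl

end Words

/-! ### Uniform bounds, and commutators vanish in the limit -/

section Asymptotics

attribute [local instance] Matrix.linftyOpNormedRing Matrix.linftyOpNormedAlgebra

theorem norm_entry_le_linfty {n : ℕ} (A : Matrix (Fin n) (Fin n) ℂ) (i j : Fin n) :
    ‖A i j‖ ≤ ‖A‖ := by
  rw [Matrix.linfty_opNorm_def]
  have h1 : ‖A i j‖₊ ≤ ∑ j, ‖A i j‖₊ :=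
    Finset.single_le_sum (f := fun j => ‖A i j‖₊) (fun _ _ => zero_le) (Finset.mem_univ j)
  have h2 := Finset.le_sup (f := fun i => ∑ j, ‖A i j‖₊) (Finset.mem_univ i)
  exact_mod_cast h1.trans h2

/-- With at most one nonzero entry in each row, the row sum is a single entry. The bound is thus
free of the dimension, which grows as `ħ → 0`; it is used for `E` and `F`. -/
theorem linfty_le_of_sparse {n : ℕ} (A : Matrix (Fin n) (Fin n) ℂ) {C : ℝ} (hC : 0 ≤ C)
    (hA : ∀ i j, ‖A i j‖ ≤ C) (hs : ∀ i j j', A i j ≠ 0 → A i j' ≠ 0 → j = j') : ‖A‖ ≤ C := by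
  lift C to NNReal using hC
  rw [Matrix.linfty_opNorm_def]
  norm_cast
  refine Finset.sup_le fun i _ => ?_
  by_cases h : ∃ j, A i j ≠ 0
  · obtain ⟨j, hj⟩ := h
    rw [Finset.sum_eq_single j]
    · exact_mod_cast hA i j
    · intro j' _ hj'
      by_contra h0
      exact hj' (hs i j' j (fun h => h0 (by simp [h])) hj)
    · simp
  · push Not at h
    simp [h]

/-- The bound is independent of `ħ`, `n` and `m`. For `r > 0` the inequality `x ≤ sinh x` bounds the
prefactor by `1 / (2r)`, and `Λ + 1` is slack. For `r = 0` the second summand is zero, since `1 / 0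
= 0`. -/
theorem ladder_abs_le {r ħ Λ : ℝ} (hr : 0 ≤ r) (h0 : 0 < ħ) (h1 : ħ ≤ 1) {n : ℕ}
    (hn : ħ * n ≤ Λ) (m : ℝ) : |ladder r ħ n m| ≤
      Λ + 1 + 1 / (2 * r) * √(Real.exp (r * (Λ + 1)) + 1) := by
  have hΛ : 0 ≤ Λ := le_trans (by positivity) hn
  unfold ladder
  split_ifs with hr0
  · subst hr0
    have hs : √(((n : ℝ) + 1) ^ 2 - m ^ 2) ≤ (n : ℝ) + 1 := by
      rw [Real.sqrt_le_left (by positivity)]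
      nlinarith [sq_nonneg m]
    rw [abs_of_nonneg (by positivity)]
    have := mul_le_mul_of_nonneg_left hs (show 0 ≤ ħ / 2 by positivity)
    simp only [mul_zero, div_zero, zero_mul, add_zero]
    nlinarith
  · have hr' : 0 < r := lt_of_le_of_ne hr (Ne.symm hr0)
    have hrh : 0 < r * ħ := mul_pos hr' h0
    have hs : 2 * r * ħ / (Real.exp (r * ħ) - Real.exp (-(r * ħ))) ≤ 1 := by
      have h := Real.self_le_sinh_iff.mpr hrh.le
      rw [Real.sinh_eq] at h
      rw [div_le_one (by linarith)]
      linarith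
    have ha : alphaConst r ħ ≤ 1 / (2 * r) := by
      unfold alphaConst
      have : √(2 * r * ħ / (Real.exp (r * ħ) - Real.exp (-(r * ħ)))) ≤ 1 :=
        Real.sqrt_le_one.mpr hs
      exact mul_le_of_le_one_right (by positivity) this
    have ha0 : 0 ≤ alphaConst r ħ := by unfold alphaConst; positivity
    have hb : √(Real.exp (r * (ħ * n + ħ)) + Real.exp (-(r * (ħ * n + ħ)))
        - Real.exp (r * ħ * m) - Real.exp (-(r * ħ * m))) ≤ √(Real.exp (r * (Λ + 1)) + 1) := by
      apply Real.sqrt_le_sqrt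
      have e1 : Real.exp (r * (ħ * n + ħ)) ≤ Real.exp (r * (Λ + 1)) := by gcongr
      have e2 : Real.exp (-(r * (ħ * n + ħ))) ≤ 1 := by
        rw [Real.exp_le_one_iff, neg_nonpos]; positivity
      linarith [Real.exp_pos (r * ħ * m), Real.exp_pos (-(r * ħ * m))]
    rw [abs_of_nonneg (by positivity)]
    have := mul_le_mul ha hb (Real.sqrt_nonneg _) (by positivity)
    linarith

/-- The observables whose norm on `V^q(Λ^ħ)` vanishes in the limit. -/
def IsNegligible (r Λ : ℝ) (𝓕 : Observable r) : Prop :=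
  Tendsto (fun ħ => ‖obsMat r ħ (level Λ ħ) 𝓕‖) (𝓝[>] 0) (𝓝 0)

theorem eventually_small {Λ : ℝ} (hΛ : 0 < Λ) :
    ∀ᶠ ħ : ℝ in 𝓝[>] 0, 0 < ħ ∧ ħ ≤ 1 ∧ ħ * level Λ ħ ≤ Λ := by
  have : ∀ᶠ ħ : ℝ in 𝓝[>] 0, ħ ≤ 1 :=
    nhdsWithin_le_nhds ((eventually_lt_nhds zero_lt_one).mono fun _ h => h.le)
  filter_upwards [self_mem_nhdsWithin, this] with ħ h0 h1
  exact ⟨h0, h1, level_mul_le hΛ h0⟩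

theorem gen_bounded {r : ℝ} (hr : 0 ≤ r) {Λ : ℝ} (hΛ : 0 < Λ) (i : Gen) :
    ∃ C : ℝ, ∀ᶠ ħ in 𝓝[>] 0, ‖repTuple r ħ (level Λ ħ) i‖ ≤ C := by
  have hexp : ∀ ħ : ℝ, 0 < ħ → ∀ j : Fin (level Λ ħ + 1),
      |r * (ħ * wtIdx (level Λ ħ) j) / 2| ≤ r * Λ := by
    intro ħ hħ j
    rw [abs_div, abs_mul, abs_of_nonneg hr, abs_two]
    have := (abs_mul_wtIdx_le hħ.le (level Λ ħ) j).trans (level_mul_le hΛ hħ)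
    have h2 := mul_le_mul_of_nonneg_left this hr
    have h3 : 0 ≤ r * |ħ * wtIdx (level Λ ħ) j| := by positivity
    linarith
  have hbd : ∀ ħ : ℝ, 0 < ħ → ħ ≤ 1 → ħ * level Λ ħ ≤ Λ → ∀ m : ℝ,
      ‖((ladder r ħ (level Λ ħ) m : ℝ) : ℂ)‖ ≤
        Λ + 1 + 1 / (2 * r) * √(Real.exp (r * (Λ + 1)) + 1) := fun ħ h0 h1 h2 m => by
    rw [Complex.norm_real]
    exact ladder_abs_le hr h0 h1 h2 m
  have hC0 : 0 ≤ Λ + 1 + 1 / (2 * r) * √(Real.exp (r * (Λ + 1)) + 1) := by positivity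
  cases i
  · refine ⟨Λ, (eventually_small hΛ).mono fun ħ ⟨h0, h1, h2⟩ => ?_⟩
    simp only [repTuple]
    rw [Matrix.linfty_opNorm_diagonal, pi_norm_le_iff_of_nonneg hΛ.le]
    intro j
    rw [Complex.norm_real]
    exact (abs_mul_wtIdx_le h0.le _ j).trans h2
  · refine ⟨Real.exp (r * Λ), (eventually_small hΛ).mono fun ħ ⟨h0, h1, h2⟩ => ?_⟩
    simp only [repTuple]
    rw [Matrix.linfty_opNorm_diagonal, pi_norm_le_iff_of_nonneg (Real.exp_pos _).le]
    intro j
    rw [Complex.norm_real, Real.norm_of_nonneg (Real.exp_pos _).le, Real.exp_le_exp]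
    linarith [(abs_le.mp (hexp ħ h0 j)).1]
  · refine ⟨Real.exp (r * Λ), (eventually_small hΛ).mono fun ħ ⟨h0, h1, h2⟩ => ?_⟩
    simp only [repTuple]
    rw [Matrix.linfty_opNorm_diagonal, pi_norm_le_iff_of_nonneg (Real.exp_pos _).le]
    intro j
    rw [Complex.norm_real, Real.norm_of_nonneg (Real.exp_pos _).le, Real.exp_le_exp]
    exact (abs_le.mp (hexp ħ h0 j)).2
  · refine ⟨_, (eventually_small hΛ).mono fun ħ ⟨h0, h1, h2⟩ =>
      linfty_le_of_sparse _ hC0 (fun i j => ?_) (fun i j j' h h' => ?_)⟩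
    · simp only [repTuple, Matrix.of_apply]
      split_ifs
      · exact hbd ħ h0 h1 h2 _
      · simpa using hC0
    · simp only [repTuple, Matrix.of_apply, ne_eq, ite_eq_right_iff, Classical.not_imp] at h h'
      exact Fin.ext (by omega)
  · refine ⟨_, (eventually_small hΛ).mono fun ħ ⟨h0, h1, h2⟩ =>
      linfty_le_of_sparse _ hC0 (fun i j => ?_) (fun i j j' h h' => ?_)⟩
    · simp only [repTuple, Matrix.of_apply]
      split_ifs
      · exact hbd ħ h0 h1 h2 _
      · simpa using hC0
    · simp only [repTuple, Matrix.of_apply, ne_eq, ite_eq_right_iff, Classical.not_imp] at h h'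
      exact Fin.ext (by omega)

theorem word_bounded {r : ℝ} (hr : 0 ≤ r) {Λ : ℝ} (hΛ : 0 < Λ) (l : List Gen) :
    ∃ C : ℝ, ∀ᶠ ħ in 𝓝[>] 0, ‖obsMat r ħ (level Λ ħ) (word r l)‖ ≤ C := by
  simp only [obsMat_word]
  induction l with
  | nil =>
    refine ⟨1, Eventually.of_forall fun ħ => ?_⟩
    rw [List.map_nil, List.prod_nil, ← Matrix.diagonal_one, Matrix.linfty_opNorm_diagonal]
    exact (pi_norm_le_iff_of_nonneg zero_le_one).mpr fun _ => by simp
  | cons i l ih =>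
    obtain ⟨C, hC⟩ := ih
    obtain ⟨D, hD⟩ := gen_bounded hr hΛ i
    refine ⟨D * C, ?_⟩
    filter_upwards [hC, hD] with ħ h1 h2
    rw [List.map_cons, List.prod_cons]
    exact (norm_mul_le _ _).trans
      (mul_le_mul h2 h1 (norm_nonneg _) ((norm_nonneg _).trans h2))

theorem tendsto_zero_of_le_mul {f g : ℝ → ℝ} {C : ℝ} (hf : ∀ ħ, 0 ≤ f ħ)
    (hg : Tendsto g (𝓝[>] 0) (𝓝 0)) (h : ∀ᶠ ħ in 𝓝[>] 0, f ħ ≤ C * g ħ) :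
    Tendsto f (𝓝[>] 0) (𝓝 0) := by
  have h2 := hg.const_mul C
  rw [mul_zero] at h2
  exact tendsto_of_tendsto_of_tendsto_of_le_of_le' tendsto_const_nhds h2
    (Eventually.of_forall hf) h

variable {r Λ : ℝ}

theorem IsNegligible.zero : IsNegligible r Λ 0 := by
  simp [IsNegligible]

theorem IsNegligible.add {x y : Observable r} (hx : IsNegligible r Λ x)
    (hy : IsNegligible r Λ y) : IsNegligible r Λ (x + y) := by
  have h := Tendsto.add hx hy
  rw [add_zero] at h
  refine tendsto_zero_of_le_mul (C := 1) (fun _ => norm_nonneg _) h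
    (Eventually.of_forall fun ħ => ?_)
  rw [map_add, one_mul]
  exact norm_add_le _ _

theorem IsNegligible.neg {x : Observable r} (hx : IsNegligible r Λ x) :
    IsNegligible r Λ (-x) := by
  unfold IsNegligible at *
  simpa only [map_neg, norm_neg] using hx

theorem IsNegligible.word_mul (hr : 0 ≤ r) (hΛ : 0 < Λ) {x : Observable r}
    (hx : IsNegligible r Λ x) (l : List Gen) : IsNegligible r Λ (word r l * x) := by
  obtain ⟨C, hC⟩ := word_bounded hr hΛ l
  refine tendsto_zero_of_le_mul (C := C) (fun _ => norm_nonneg _) hx ?_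
  filter_upwards [hC] with ħ h
  rw [map_mul]
  exact (norm_mul_le _ _).trans (mul_le_mul_of_nonneg_right h (norm_nonneg _))

theorem IsNegligible.mul_word (hr : 0 ≤ r) (hΛ : 0 < Λ) {x : Observable r}
    (hx : IsNegligible r Λ x) (l : List Gen) : IsNegligible r Λ (x * word r l) := by
  obtain ⟨C, hC⟩ := word_bounded hr hΛ l
  refine tendsto_zero_of_le_mul (C := C) (fun _ => norm_nonneg _) hx ?_
  filter_upwards [hC] with ħ h
  rw [map_mul, mul_comm C]
  exact (norm_mul_le _ _).trans (mul_le_mul_of_nonneg_left h (norm_nonneg _))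

theorem isNegligible_smul_word (hr : 0 ≤ r) (hΛ : 0 < Λ) {c : planckRing}
    (hc : evalPlanck 0 c = 0) (l : List Gen) : IsNegligible r Λ (c • word r l) := by
  obtain ⟨C, hC⟩ := word_bounded hr hΛ l
  have h := (tendsto_evalPlanck c).norm
  rw [hc, norm_zero] at h
  refine tendsto_zero_of_le_mul (C := C) (fun _ => norm_nonneg _) h ?_
  filter_upwards [hC] with ħ h
  rw [obsMat_smul, norm_smul, mul_comm]
  exact mul_le_mul_of_nonneg_right h (norm_nonneg _)

/-- At `ħ = 0` each defining relation becomes commutativity: a commutator of generators is zero or a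
combination of words with coefficients multiples of `ħ` or `q^ħ - 1`. Words are uniformly bounded,
so these combinations are negligible. -/
theorem isNegligible_commutator (hr : 0 ≤ r) (hΛ : 0 < Λ) (i j : Gen) :
    IsNegligible r Λ (word r [i, j] - word r [j, i]) := by
  set x := gen r planckVar (planckQ r) with hxdef
  have hx : IsQTuple r planckVar (planckQ r) x := isQTuple_gen r planckVar (planckQ r)
  have w1 : ∀ i, word r [i] = x i := fun i => by simp [word, hxdef]
  have w2 : ∀ i j, word r [i, j] = x i * x j := fun i j => by simp [word, hxdef]
  have hh : evalPlanck 0 planckVar = 0 := by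
    change (((0 : ℝ)) : ℂ) = 0; simp
  have hQ : evalPlanck 0 (planckQ r) = 1 := by
    change qPow r 0 = 1; simp [qPow]
  have hQ1 : evalPlanck 0 (planckQ r - 1) = 0 := by rw [map_sub, hQ, map_one, sub_self]
  have h2h : evalPlanck 0 (2 * planckVar) = 0 := by rw [map_mul, hh, mul_zero]
  have hsub : ∀ (c : planckRing) (a : Observable r), c • a - a = (c - 1) • a := fun c a => by
    have h := sub_smul c 1 a
    rw [one_smul] at h
    exact h.symm
  have symm : ∀ i j, IsNegligible r Λ (word r [i, j] - word r [j, i]) →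
      IsNegligible r Λ (word r [j, i] - word r [i, j]) := fun i j h => by
    simpa using h.neg
  have self : ∀ i, IsNegligible r Λ (word r [i, i] - word r [i, i]) := fun i => by
    rw [sub_self]; exact IsNegligible.zero
  have Hk : IsNegligible r Λ (word r [.H, .k] - word r [.k, .H]) := by
    rw [w2, w2, hx.H_k, sub_self]; exact IsNegligible.zero
  have HkI : IsNegligible r Λ (word r [.H, .kInv] - word r [.kInv, .H]) := by
    rw [w2, w2, hx.kInv_H, sub_self]; exact IsNegligible.zero
  have kkI : IsNegligible r Λ (word r [.k, .kInv] - word r [.kInv, .k]) := by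
    rw [w2, w2, hx.k_kInv, hx.kInv_k, sub_self]; exact IsNegligible.zero
  have HE : IsNegligible r Λ (word r [.H, .E] - word r [.E, .H]) := by
    rw [w2, w2, hx.H_E, ← w1]; exact isNegligible_smul_word hr hΛ h2h _
  have HF : IsNegligible r Λ (word r [.H, .F] - word r [.F, .H]) := by
    rw [w2, w2, hx.H_F, ← w1]; exact (isNegligible_smul_word hr hΛ h2h _).neg
  have kE : IsNegligible r Λ (word r [.k, .E] - word r [.E, .k]) := by
    rw [w2, w2, hx.kE, ← w2, hsub]
    exact isNegligible_smul_word hr hΛ hQ1 _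
  have Fk : IsNegligible r Λ (word r [.F, .k] - word r [.k, .F]) := by
    rw [w2, w2, hx.kF, ← w2, hsub]
    exact isNegligible_smul_word hr hΛ hQ1 _
  have EkI : IsNegligible r Λ (word r [.E, .kInv] - word r [.kInv, .E]) := by
    rw [w2, w2, hx.EkInv, ← w2, hsub]
    exact isNegligible_smul_word hr hΛ hQ1 _
  have kIF : IsNegligible r Λ (word r [.kInv, .F] - word r [.F, .kInv]) := by
    rw [w2, w2, hx.kInvF, ← w2, hsub]
    exact isNegligible_smul_word hr hΛ hQ1 _
  have EF : IsNegligible r Λ (word r [.E, .F] - word r [.F, .E]) := by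
    rw [w2, w2, hx.E_F]
    unfold curvedH
    split_ifs
    · rw [← w1]; exact isNegligible_smul_word hr hΛ hh _
    · rw [← w2, ← w2, smul_smul, smul_sub, sub_eq_add_neg]
      have h0 : evalPlanck 0 (planckVar * algebraMap ℂ planckRing (1 / (2 * r))) = 0 := by
        rw [map_mul, hh, zero_mul]
      exact (isNegligible_smul_word hr hΛ h0 _).add (isNegligible_smul_word hr hΛ h0 _).neg
  match i, j with
  | .H, .H => exact self _
  | .H, .k => exact Hk
  | .H, .kInv => exact HkI
  | .H, .E => exact HE
  | .H, .F => exact HF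
  | .k, .H => exact symm _ _ Hk
  | .k, .k => exact self _
  | .k, .kInv => exact kkI
  | .k, .E => exact kE
  | .k, .F => exact symm _ _ Fk
  | .kInv, .H => exact symm _ _ HkI
  | .kInv, .k => exact symm _ _ kkI
  | .kInv, .kInv => exact self _
  | .kInv, .E => exact symm _ _ EkI
  | .kInv, .F => exact kIF
  | .E, .H => exact symm _ _ HE
  | .E, .k => exact symm _ _ kE
  | .E, .kInv => exact EkI
  | .E, .E => exact self _
  | .E, .F => exact EF
  | .F, .H => exact symm _ _ HF
  | .F, .k => exact Fk
  | .F, .kInv => exact symm _ _ kIF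
  | .F, .E => exact symm _ _ EF
  | .F, .F => exact self _

theorem word_append (l l' : List Gen) : word r (l ++ l') = word r l * word r l' := by
  simp [word]

/-- Permuting the letters of a word changes the observable by a negligible amount. -/
theorem isNegligible_sub_of_perm (hr : 0 ≤ r) (hΛ : 0 < Λ) {l l' : List Gen} (h : l.Perm l') :
    IsNegligible r Λ (word r l - word r l') := by
  induction h with
  | nil => rw [sub_self]; exact IsNegligible.zero
  | cons x _ ih =>
    have := ih.word_mul hr hΛ [x]
    rwa [mul_sub, ← word_append, ← word_append] at this
  | swap x y l =>
    have := (isNegligible_commutator (Λ := Λ) hr hΛ y x).mul_word hr hΛ l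
    rwa [sub_mul, ← word_append, ← word_append] at this
  | trans _ _ ih₁ ih₂ =>
    have := ih₁.add ih₂
    rwa [sub_add_sub_cancel] at this

/-- The weighted trace is a convex combination of diagonal entries, because `q^{-H}` is diagonal
with positive entries. -/
theorem norm_weightedTrace_le (r Λ : ℝ) (𝓕 : Observable r) (ħ : ℝ) :
    ‖weightedTrace r Λ 𝓕 ħ‖ ≤ ‖obsMat r ħ (level Λ ħ) 𝓕‖ := by
  rw [weightedTrace_eq, ← Complex.ofReal_sum, norm_div, Complex.norm_real]
  have hpos : 0 < ∑ i, Real.exp (r * (ħ * wtIdx (level Λ ħ) i)) :=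
    Finset.sum_pos (fun _ _ => Real.exp_pos _) Finset.univ_nonempty
  rw [Real.norm_of_nonneg hpos.le, div_le_iff₀ hpos, Finset.mul_sum]
  refine (norm_sum_le _ _).trans (Finset.sum_le_sum fun i _ => ?_)
  rw [norm_mul, Complex.norm_real, Real.norm_of_nonneg (Real.exp_pos _).le, mul_comm]
  exact mul_le_mul_of_nonneg_right (norm_entry_le_linfty _ i i) (Real.exp_pos _).le

theorem weightedTrace_add (r Λ : ℝ) (x y : Observable r) (ħ : ℝ) :
    weightedTrace r Λ (x + y) ħ = weightedTrace r Λ x ħ + weightedTrace r Λ y ħ := by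
  simp only [weightedTrace_eq, map_add, Matrix.add_apply, mul_add, Finset.sum_add_distrib, add_div]

theorem weightedTrace_smul (r Λ : ℝ) (c : planckRing) (x : Observable r) (ħ : ℝ) :
    weightedTrace r Λ (c • x) ħ = evalPlanck ħ c * weightedTrace r Λ x ħ := by
  simp only [weightedTrace_eq, obsMat_smul, Matrix.smul_apply, smul_eq_mul, mul_div_assoc',
    Finset.mul_sum]
  congr 1
  exact Finset.sum_congr rfl fun i _ => by ring

theorem IsNegligible.tendsto_weightedTrace {x : Observable r} (hx : IsNegligible r Λ x) :
    Tendsto (weightedTrace r Λ x) (𝓝[>] 0) (𝓝 0) :=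
  squeeze_zero_norm (norm_weightedTrace_le r Λ x) hx

end Asymptotics

/-! ### The semiclassical limit on one orbit -/

section OneOrbit

instance : DecidableEq Gen := fun a b => by
  cases a <;> cases b <;> first | exact isTrue rfl | exact isFalse nofun

/-- The weight of a generator, in units of `2ħ`. -/
def Gen.degree : Gen → ℤ
  | .E => 1
  | .F => -1
  | _ => 0

/-- The weight of a word, in units of `2ħ`. -/
def wordDegree (l : List Gen) : ℤ := (l.map Gen.degree).sum

theorem wordDegree_eq (l : List Gen) : wordDegree l = (l.count .E : ℤ) - l.count .F := by
  induction l with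
  | nil => rfl
  | cons i l ih =>
    have : wordDegree (i :: l) = i.degree + wordDegree l := by simp [wordDegree]
    rw [this, ih]
    cases i <;> simp [Gen.degree] <;> ring

theorem repTuple_entry_degree (r ħ : ℝ) (n : ℕ) (x : Gen) (i j : Fin (n + 1))
    (h : repTuple r ħ n x i j ≠ 0) : ((i : ℕ) : ℤ) = (j : ℕ) + x.degree := by
  cases x <;> simp only [repTuple, Matrix.diagonal_apply, Matrix.of_apply, Gen.degree] at h ⊢ <;>
    split_ifs at h with hij
  all_goals first
    | (exfalso; exact h rfl)
    | (subst hij; simp)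
    | (rw [hij]; push_cast; ring)

theorem word_entry_degree (r ħ : ℝ) (n : ℕ) (l : List Gen) (i j : Fin (n + 1))
    (h : (l.map (repTuple r ħ n)).prod i j ≠ 0) : ((i : ℕ) : ℤ) = (j : ℕ) + wordDegree l := by
  induction l generalizing i with
  | nil =>
    by_cases hij : i = j
    · subst hij; simp [wordDegree]
    · exact absurd (Matrix.one_apply_ne hij) h
  | cons x l ih =>
    rw [List.map_cons, List.prod_cons, Matrix.mul_apply] at h
    obtain ⟨m, _, hm⟩ := Finset.exists_ne_zero_of_sum_ne_zero h
    have h1 := repTuple_entry_degree r ħ n x i m (left_ne_zero_of_mul hm)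
    have h2 := ih m (right_ne_zero_of_mul hm)
    have : wordDegree (x :: l) = x.degree + wordDegree l := by simp [wordDegree]
    rw [this]
    linarith

/-- The word shifts the basis index by the difference of the two counts, so its diagonal vanishes.
-/
theorem weightedTrace_word_eq_zero (r Λ ħ : ℝ) {l : List Gen} (hl : l.count .E ≠ l.count .F) :
    weightedTrace r Λ (word r l) ħ = 0 := by
  rw [weightedTrace_eq, Finset.sum_eq_zero, zero_div]
  intro i _
  rw [obsMat_word]
  by_contra h
  have := word_entry_degree r ħ _ l i i (right_ne_zero_of_mul h)
  rw [wordDegree_eq] at this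
  omega

theorem coordTuple_phase (r : ℝ) {ζ : ℂ} (hζ : ζ * (starRingEnd ℂ) ζ = 1) (x : Gen)
    (g : SU2Star) : coordTuple r x (g.1, ζ * g.2) = ζ ^ (-x.degree) * coordTuple r x g := by
  have hc : (starRingEnd ℂ) ζ = ζ⁻¹ := eq_inv_of_mul_eq_one_right hζ
  cases x <;> simp [coordTuple, Gen.degree, hc]

theorem modHbar_word_phase (r : ℝ) {ζ : ℂ} (hζ : ζ * (starRingEnd ℂ) ζ = 1) (l : List Gen)
    (g : SU2Star) :
    modHbar r (word r l) (g.1, ζ * g.2) = ζ ^ (-wordDegree l) * modHbar r (word r l) g := by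
  have h0 : ζ ≠ 0 := by rintro rfl; simp at hζ
  simp only [modHbar_word]
  induction l with
  | nil => simp [wordDegree]
  | cons x l ih =>
    have : wordDegree (x :: l) = x.degree + wordDegree l := by simp [wordDegree]
    rw [List.map_cons, List.prod_cons, Pi.mul_apply, Pi.mul_apply, ih, coordTuple_phase r hζ, this,
      neg_add, zpow_add₀ h0]
    ring

/-- Classical counterpart of `weightedTrace_word_eq_zero`: rotating `F` by `z̄²` multiplies the
function by `z ^ (2d)`, with `d` the degree of the word, and `z` is chosen to make this `-1`. -/
theorem integral_modHbar_word_eq_zero (r Λ : ℝ) {l : List Gen} (hl : l.count .E ≠ l.count .F) :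
    ∫ g, modHbar r (word r l) g ∂uniformOrbit r Λ = 0 := by
  have hd : wordDegree l ≠ 0 := by rw [wordDegree_eq]; omega
  obtain ⟨z, hz, hzd⟩ := exists_unit_pow_eq_neg_one hd
  have hn : Complex.normSq z = 1 := by
    have : (Complex.normSq z : ℂ) = 1 := by rw [← Complex.mul_conj, hz]
    exact_mod_cast this
  have hc : (starRingEnd ℂ) z = z⁻¹ := eq_inv_of_mul_eq_one_right hz
  refine integral_uniformOrbit_eq_zero r Λ (continuous_modHbar r _) hn (c := -1) (by norm_num)
    fun g => ?_
  rw [modHbar_word_phase]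
  · congr 1
    rw [← hzd, hc, ← zpow_natCast, ← zpow_mul, inv_zpow']
    congr 1
    push_cast
    ring
  · rw [map_pow, ← mul_pow, Complex.conj_conj, mul_comm, hz, one_pow]

/-- The normally ordered word of weight zero. -/
def zeroWord (a b c d : ℕ) : List Gen :=
  List.replicate a .H ++ List.replicate b .k ++ List.replicate c .kInv
    ++ (List.replicate d [Gen.E, Gen.F]).flatten

theorem perm_zeroWord {l : List Gen} (hl : l.count .E = l.count .F) :
    l.Perm (zeroWord (l.count .H) (l.count .k) (l.count .kInv) (l.count .E)) := by
  rw [List.perm_iff_count]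
  intro x
  simp only [zeroWord, List.count_append, List.count_flatten, List.map_replicate,
    List.sum_replicate, List.count_replicate]
  cases x <;> simp [hl]

theorem prod_map_zeroWord {A : Type*} [Monoid A] (x : Gen → A) (a b c d : ℕ) :
    ((zeroWord a b c d).map x).prod = x .H ^ a * x .k ^ b * x .kInv ^ c * (x .E * x .F) ^ d := by
  have : ∀ d : ℕ, ((List.replicate d [Gen.E, Gen.F]).flatten.map x).prod = (x .E * x .F) ^ d := by
    intro d
    induction d with
    | zero => simp
    | succ d ih =>
      rw [List.replicate_succ, List.flatten_cons, List.map_append, List.prod_append, ih, pow_succ']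
      simp
  rw [zeroWord, List.map_append, List.prod_append, this]
  simp [mul_assoc]

/-- The diagonal coefficients of `EF`, as a function of the parameters `s`, `ħ n`, `ħ` and of the
weight. -/
noncomputable def quantumRadiusSq (r : ℝ) (z : (ℝ × ℝ × ℝ) × ℝ) : ℝ :=
  if r = 0 then ((z.1.2.1 + z.1.2.2) ^ 2 - (z.2 - z.1.2.2) ^ 2) / 4
  else z.1.1 * (Real.cosh (r * (z.1.2.1 + z.1.2.2)) - Real.cosh (r * (z.2 - z.1.2.2)))

theorem continuous_quantumRadiusSq (r : ℝ) : Continuous (quantumRadiusSq r) := by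
  unfold quantumRadiusSq
  split_ifs
  · fun_prop
  · have := Real.continuous_cosh
    fun_prop

/-- The constant `ħ / (r (e^{rħ} - e^{-rħ}))`. -/
noncomputable def radiusConst (r ħ : ℝ) : ℝ := ħ / (r * (Real.exp (r * ħ) - Real.exp (-(r * ħ))))

/-- Up to the factor `r`, the inverse is the difference quotient at zero of `e^{rt} - e^{-rt}`,
whose derivative there is `2r`. -/
theorem tendsto_radiusConst {r : ℝ} (hr : r ≠ 0) :
    Tendsto (radiusConst r) (𝓝[>] 0) (𝓝 (1 / (2 * r ^ 2))) := by
  have h1 : HasDerivAt (fun t : ℝ => Real.exp (r * t) - Real.exp (-(r * t))) (2 * r) 0 := by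
    have e1 : HasDerivAt (fun t : ℝ => r * t) r 0 := by
      simpa using (hasDerivAt_id (0 : ℝ)).const_mul r
    refine (e1.exp.sub e1.neg.exp).congr_deriv ?_
    simp
    ring
  have h2 := h1.tendsto_slope_zero_right
  simp only [zero_add, mul_zero, neg_zero, sub_self, sub_zero, smul_eq_mul] at h2
  have h3 := (h2.const_mul r).inv₀ (mul_ne_zero hr (mul_ne_zero two_ne_zero hr))
  refine (h3.congr fun ħ => ?_).trans (le_of_eq ?_)
  · rw [radiusConst, mul_inv, mul_inv, inv_inv, div_eq_mul_inv, mul_inv]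
    ring
  · congr 1
    field_simp

theorem ladder_sq_eq_quantumRadiusSq (r ħ : ℝ) (n : ℕ) (i : Fin (n + 1)) :
    ladder r ħ n (wtIdx n i - 1) ^ 2
      = quantumRadiusSq r ((radiusConst r ħ, ħ * n, ħ), ħ * wtIdx n i) := by
  have h := ladder_sq r ħ n (wtIdx n i + -1) (wtIdx_sq_le n i (-1) (by norm_num))
  rw [sub_eq_add_neg, h, quantumRadiusSq]
  split_ifs with hr
  · ring
  · simp only [radiusConst]
    rw [show r * (ħ * wtIdx n i - ħ) = r * ħ * (wtIdx n i + -1) by ring]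
    generalize Real.cosh (r * (ħ * n + ħ)) = A
    generalize Real.cosh (r * ħ * (wtIdx n i + -1)) = B
    by_cases hD : Real.exp (r * ħ) - Real.exp (-(r * ħ)) = 0
    · simp [hD]
    · field_simp

theorem quantumRadiusSq_limit (r Λ x : ℝ) :
    quantumRadiusSq r ((1 / (2 * r ^ 2), Λ, 0), x) = radiusSq r Λ x := by
  unfold quantumRadiusSq radiusSq
  split_ifs with hr
  · simp
  · simp only [add_zero, sub_zero]
    ring

/-- The symbol of a normally ordered word of weight zero. -/
noncomputable def zeroSymbol (r : ℝ) (a b c d : ℕ) (z : (ℝ × ℝ × ℝ) × ℝ) : ℂ :=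
  (z.2 : ℂ) ^ a * ((Real.exp (-(r * z.2 / 2)) : ℝ) : ℂ) ^ b *
    ((Real.exp (r * z.2 / 2) : ℝ) : ℂ) ^ c * (quantumRadiusSq r z : ℂ) ^ d

theorem continuous_zeroSymbol (r : ℝ) (a b c d : ℕ) : Continuous (zeroSymbol r a b c d) := by
  unfold zeroSymbol
  have := continuous_quantumRadiusSq r
  fun_prop

theorem obsMat_zeroWord (r ħ : ℝ) (n a b c d : ℕ) :
    obsMat r ħ n (word r (zeroWord a b c d)) = Matrix.diagonal fun i =>
      zeroSymbol r a b c d ((radiusConst r ħ, ħ * n, ħ), ħ * wtIdx n i) := by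
  rw [obsMat_word, prod_map_zeroWord, rep_EF]
  simp only [ladder_sq_eq_quantumRadiusSq]
  simp only [repTuple, Matrix.diagonal_pow, Matrix.diagonal_mul_diagonal]
  rfl

theorem modHbar_zeroWord (r Λ : ℝ) (a b c d : ℕ) {g : SU2Star} (hg : g ∈ dressingOrbit r Λ) :
    modHbar r (word r (zeroWord a b c d)) g
      = zeroSymbol r a b c d ((1 / (2 * r ^ 2), Λ, 0), g.1) := by
  obtain ⟨k, rfl⟩ := hg
  have h := dressing_snd r Λ k
  simp only at h ⊢
  rw [modHbar_word, prod_map_zeroWord, zeroSymbol, quantumRadiusSq_limit, ← h]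
  simp only [Pi.mul_apply, Pi.pow_apply, coordTuple]
  rw [mul_comm ((starRingEnd ℂ) _), Complex.mul_conj]

variable {r Λ : ℝ}

/-- The word acts diagonally through its symbol, and on the orbit its classical function is the
limiting symbol in the variable `H`. Numerator and denominator are Riemann sums with weight
`e^{rH}`, which is the density of `H` up to normalization. -/
theorem tendsto_weightedTrace_zeroWord (r : ℝ) (hΛ : 0 < Λ) (a b c d : ℕ) :
    Tendsto (weightedTrace r Λ (word r (zeroWord a b c d))) (𝓝[>] 0)
      (𝓝 (∫ g, modHbar r (word r (zeroWord a b c d)) g ∂uniformOrbit r Λ)) := by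
  set s₀ : ℝ × ℝ × ℝ := (1 / (2 * r ^ 2), Λ, 0) with hs₀
  have hΦ : Continuous fun x : ℝ => zeroSymbol r a b c d (s₀, x) :=
    (continuous_zeroSymbol r a b c d).comp (by fun_prop)
  have e1 : ∫ g, modHbar r (word r (zeroWord a b c d)) g ∂uniformOrbit r Λ
      = ∫ g, zeroSymbol r a b c d (s₀, g.1) ∂uniformOrbit r Λ :=
    integral_congr_ae ((ae_mem_dressingOrbit r Λ).mono fun g hg =>
      modHbar_zeroWord r Λ a b c d hg)
  rw [e1, integral_uniformOrbit_fst_eq r hΛ hΦ]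
  have hid : Tendsto (fun ħ : ℝ => ħ) (𝓝[>] 0) (𝓝 0) := tendsto_id.mono_left nhdsWithin_le_nhds
  have hden := tendsto_average (P := Unit)
    (Φ := fun z => ((Real.exp (r * z.2) : ℝ) : ℂ)) (by fun_prop) (p := fun _ => ()) (p₀ := ())
    tendsto_const_nhds hΛ
  have hnum : Tendsto (fun ħ => (∑ i : Fin (level Λ ħ + 1),
      ((Real.exp (r * (ħ * wtIdx (level Λ ħ) i)) : ℝ) : ℂ) *
        zeroSymbol r a b c d ((radiusConst r ħ, ħ * level Λ ħ, ħ), ħ * wtIdx (level Λ ħ) i)) /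
      ((level Λ ħ : ℂ) + 1)) (𝓝[>] 0) (𝓝 (∫ t in (0 : ℝ)..1,
        ((Real.exp (r * (Λ * (2 * t - 1))) : ℝ) : ℂ) *
          zeroSymbol r a b c d (s₀, Λ * (2 * t - 1)))) := by
    by_cases hr : r = 0
    -- For `r = 0` the symbol ignores its first parameter, which is replaced by a constant because
    -- `tendsto_radiusConst` requires `r ≠ 0`.
    · have hq : ∀ s s' L h x, zeroSymbol r a b c d ((s, L, h), x)
          = zeroSymbol r a b c d ((s', L, h), x) := by
        intro s s' L h x
        simp [zeroSymbol, quantumRadiusSq, hr]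
      have := tendsto_average (P := ℝ × ℝ × ℝ)
        (Φ := fun z => ((Real.exp (r * z.2) : ℝ) : ℂ) * zeroSymbol r a b c d z)
        (by have := continuous_zeroSymbol r a b c d; fun_prop)
        (p := fun ħ => (1 / (2 * r ^ 2), ħ * level Λ ħ, ħ)) (p₀ := s₀)
        (tendsto_const_nhds.prodMk_nhds ((tendsto_level hΛ).prodMk_nhds hid)) hΛ
      refine this.congr fun ħ => ?_
      simp only [hq (1 / (2 * r ^ 2)) (radiusConst r ħ)]
    · exact tendsto_average (P := ℝ × ℝ × ℝ)
        (Φ := fun z => ((Real.exp (r * z.2) : ℝ) : ℂ) * zeroSymbol r a b c d z)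
        (by have := continuous_zeroSymbol r a b c d; fun_prop)
        (p := fun ħ => (radiusConst r ħ, ħ * level Λ ħ, ħ)) (p₀ := s₀)
        ((tendsto_radiusConst hr).prodMk_nhds ((tendsto_level hΛ).prodMk_nhds hid)) hΛ
  have hz : (∫ t in (0 : ℝ)..1, ((Real.exp (r * (Λ * (2 * t - 1))) : ℝ) : ℂ)) ≠ 0 := by
    rw [intervalIntegral.integral_ofReal]
    have : 0 < ∫ t in (0 : ℝ)..1, Real.exp (r * (Λ * (2 * t - 1))) :=
      intervalIntegral.intervalIntegral_pos_of_pos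
        (Continuous.intervalIntegrable (by fun_prop) _ _) (fun _ => Real.exp_pos _) zero_lt_one
    exact_mod_cast this.ne'
  refine (hnum.div hden hz).congr fun ħ => ?_
  have hN : ((level Λ ħ : ℂ) + 1) ≠ 0 := Nat.cast_add_one_ne_zero _
  rw [Pi.div_apply, div_div_div_cancel_right₀ hN, weightedTrace_eq]
  simp only [obsMat_zeroWord, Matrix.diagonal_apply_eq]

theorem integrable_modHbar (r Λ : ℝ) (𝓕 : Observable r) :
    Integrable (modHbar r 𝓕) (uniformOrbit r Λ) := by
  obtain ⟨C, hC⟩ := (isCompact_dressingOrbit r Λ).exists_bound_of_continuousOn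
    (continuous_modHbar r 𝓕).continuousOn
  exact Integrable.of_bound (continuous_modHbar r 𝓕).aestronglyMeasurable C
    ((ae_mem_dressingOrbit r Λ).mono hC)

/-- The weighted traces over `V^q(Λ^ħ)` converge to the mean over the dressing orbit. -/
theorem tendsto_weightedTrace (hr : 0 ≤ r) (hΛ : 0 < Λ) (𝓕 : Observable r) :
    Tendsto (weightedTrace r Λ 𝓕) (𝓝[>] 0)
      (𝓝 (∫ g, modHbar r 𝓕 g ∂uniformOrbit r Λ)) := by
  induction 𝓕 using observable_induction with
  | hw l =>
    -- In the balanced case the word is reordered at negligible cost; the classical functions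
    -- commute, so their product does not change. In the other case both sides vanish.
    by_cases hl : l.count .E = l.count .F
    · set l' := zeroWord (l.count .H) (l.count .k) (l.count .kInv) (l.count .E)
      have hp : l.Perm l' := perm_zeroWord hl
      have h1 := (isNegligible_sub_of_perm hr hΛ hp).tendsto_weightedTrace
      have h2 := h1.add (tendsto_weightedTrace_zeroWord r hΛ (l.count .H) (l.count .k)
        (l.count .kInv) (l.count .E))
      have h3 : modHbar r (word r l) = modHbar r (word r l') := by
        rw [modHbar_word, modHbar_word]
        exact (hp.map _).prod_eq
      rw [h3]
      rw [zero_add] at h2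
      refine h2.congr fun ħ => ?_
      rw [← weightedTrace_add, sub_add_cancel]
    · rw [integral_modHbar_word_eq_zero r Λ hl]
      exact tendsto_const_nhds.congr fun ħ => (weightedTrace_word_eq_zero r Λ ħ hl).symm
  | hadd x y hx hy =>
    have e : ∫ g, modHbar r (x + y) g ∂uniformOrbit r Λ
        = ∫ g, modHbar r x g ∂uniformOrbit r Λ + ∫ g, modHbar r y g ∂uniformOrbit r Λ := by
      rw [map_add]
      exact integral_add (integrable_modHbar r Λ x) (integrable_modHbar r Λ y)
    rw [e]
    exact (hx.add hy).congr fun ħ => (weightedTrace_add r Λ x y ħ).symm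
  | hsmul c x hx =>
    have e : ∫ g, modHbar r (c • x) g ∂uniformOrbit r Λ
        = evalPlanck 0 c * ∫ g, modHbar r x g ∂uniformOrbit r Λ := by
      rw [modHbar_smul]
      exact integral_const_mul _ _
    rw [e]
    exact ((tendsto_evalPlanck c).mul hx).congr fun ħ => (weightedTrace_smul r Λ c x ħ).symm

end OneOrbit

/-! ### The semiclassical limit on two orbits -/

section TwoOrbits

open scoped Kronecker

/-- The matrix by which an observable acts on `V^q(ħ n₁) ⊗ V^q(ħ n₂)`. -/
noncomputable def obsMat₂ (r ħ : ℝ) (n₁ n₂ : ℕ) : Observable r →+*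
    Matrix (Fin (n₁ + 1) × Fin (n₂ + 1)) (Fin (n₁ + 1) × Fin (n₂ + 1)) ℂ :=
  (repTensor r ħ n₁ n₂).toRingHom.comp (specialize r ħ)

/-- The action of the generators on `V^q(ħ n₁) ⊗ V^q(ħ n₂)`. -/
noncomputable def tensorTuple (r ħ : ℝ) (n₁ n₂ : ℕ) :
    Gen → Matrix (Fin (n₁ + 1) × Fin (n₂ + 1)) (Fin (n₁ + 1) × Fin (n₂ + 1)) ℂ
  | .H => repTuple r ħ n₁ .H ⊗ₖ 1 + 1 ⊗ₖ repTuple r ħ n₂ .H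
  | .k => repTuple r ħ n₁ .k ⊗ₖ repTuple r ħ n₂ .k
  | .kInv => repTuple r ħ n₁ .kInv ⊗ₖ repTuple r ħ n₂ .kInv
  | .E => repTuple r ħ n₁ .E ⊗ₖ repTuple r ħ n₂ .kInv + repTuple r ħ n₁ .k ⊗ₖ repTuple r ħ n₂ .E
  | .F => repTuple r ħ n₁ .F ⊗ₖ repTuple r ħ n₂ .kInv + repTuple r ħ n₁ .k ⊗ₖ repTuple r ħ n₂ .F

theorem repTensor_gen (r ħ : ℝ) (n₁ n₂ : ℕ) (i : Gen) :
    repTensor r ħ n₁ n₂ (gen r (ħ : ℂ) (qPow r ħ) i) = tensorTuple r ħ n₁ n₂ i := by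
  have h1 : ∀ i, rep r ħ n₁ (gen r (ħ : ℂ) (qPow r ħ) i) = repTuple r ħ n₁ i :=
    liftHom_gen _ (isQTuple_rep r ħ n₁)
  have h2 : ∀ i, rep r ħ n₂ (gen r (ħ : ℂ) (qPow r ħ) i) = repTuple r ħ n₂ i :=
    liftHom_gen _ (isQTuple_rep r ħ n₂)
  have h3 : coprod r (ħ : ℂ) (qPow r ħ) (gen r (ħ : ℂ) (qPow r ħ) i)
      = coprodTuple (gen r (ħ : ℂ) (qPow r ħ)) (gen r (ħ : ℂ) (qPow r ħ)) i :=
    liftHom_gen _ _ i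
  have h4 : ∀ (A : Matrix (Fin (n₁ + 1)) (Fin (n₁ + 1)) ℂ)
      (B : Matrix (Fin (n₂ + 1)) (Fin (n₂ + 1)) ℂ),
      Matrix.kroneckerAlgEquiv (Fin (n₁ + 1)) (Fin (n₂ + 1)) ℂ (A ⊗ₜ[ℂ] B) = A ⊗ₖ B :=
    fun _ _ => rfl
  change (Matrix.kroneckerAlgEquiv (Fin (n₁ + 1)) (Fin (n₂ + 1)) ℂ)
    (Algebra.TensorProduct.map (rep r ħ n₁) (rep r ħ n₂) (coprod r (ħ : ℂ) (qPow r ħ) _)) = _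
  rw [h3]
  cases i <;>
    simp only [coprodTuple, map_add, Algebra.TensorProduct.map_tmul, map_one, h1, h2, h4,
      tensorTuple]

theorem obsMat₂_gen (r ħ : ℝ) (n₁ n₂ : ℕ) (i : Gen) :
    obsMat₂ r ħ n₁ n₂ (gen r planckVar (planckQ r) i) = tensorTuple r ħ n₁ n₂ i := by
  rw [obsMat₂, RingHom.comp_apply, specialize_gen]
  exact repTensor_gen r ħ n₁ n₂ i

theorem obsMat₂_smul (r ħ : ℝ) (n₁ n₂ : ℕ) (c : planckRing) (𝓕 : Observable r) :
    obsMat₂ r ħ n₁ n₂ (c • 𝓕) = evalPlanck ħ c • obsMat₂ r ħ n₁ n₂ 𝓕 := by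
  rw [obsMat₂, RingHom.comp_apply, specialize_smul]
  exact map_smul (repTensor r ħ n₁ n₂) _ _

/-- The families `a`, `b` of observables expand the coproduct of `𝓕`. -/
def IsCoproductOf {r : ℝ} (𝓕 : Observable r) {ι : Type} [Fintype ι] (a b : ι → Observable r) :
    Prop :=
  (∀ (ħ : ℝ) (n₁ n₂ : ℕ),
    obsMat₂ r ħ n₁ n₂ 𝓕 = ∑ i, obsMat r ħ n₁ (a i) ⊗ₖ obsMat r ħ n₂ (b i)) ∧
  ∀ g g' : SU2Star, modHbar r 𝓕 (starMul r g g') = ∑ i, modHbar r (a i) g * modHbar r (b i) g'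

theorem IsCoproductOf.mul {r : ℝ} {x y : Observable r} {ι κ : Type} [Fintype ι] [Fintype κ]
    {a b : ι → Observable r} {c d : κ → Observable r} (hx : IsCoproductOf x a b)
    (hy : IsCoproductOf y c d) :
    IsCoproductOf (x * y) (fun i : ι × κ => a i.1 * c i.2) (fun i : ι × κ => b i.1 * d i.2) := by
  constructor
  · intro ħ n₁ n₂
    rw [map_mul, hx.1, hy.1, Finset.sum_mul_sum, Fintype.sum_prod_type]
    simp only [map_mul, Matrix.mul_kronecker_mul]
  · intro g g'
    rw [map_mul, Pi.mul_apply, hx.2, hy.2, Finset.sum_mul_sum, Fintype.sum_prod_type]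
    simp only [map_mul, Pi.mul_apply, mul_mul_mul_comm]

theorem IsCoproductOf.add {r : ℝ} {x y : Observable r} {ι κ : Type} [Fintype ι] [Fintype κ]
    {a b : ι → Observable r} {c d : κ → Observable r} (hx : IsCoproductOf x a b)
    (hy : IsCoproductOf y c d) :
    IsCoproductOf (x + y) (Sum.elim a c) (Sum.elim b d) := by
  constructor
  · intro ħ n₁ n₂
    rw [map_add, hx.1, hy.1, Fintype.sum_sum_type]
    simp only [Sum.elim_inl, Sum.elim_inr]
  · intro g g'
    rw [map_add, Pi.add_apply, hx.2, hy.2, Fintype.sum_sum_type]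
    simp only [Sum.elim_inl, Sum.elim_inr]

theorem IsCoproductOf.smul {r : ℝ} {x : Observable r} {ι : Type} [Fintype ι]
    {a b : ι → Observable r} (c : planckRing) (hx : IsCoproductOf x a b) :
    IsCoproductOf (c • x) (fun i => c • a i) b := by
  constructor
  · intro ħ n₁ n₂
    rw [obsMat₂_smul, hx.1, Finset.smul_sum]
    simp only [obsMat_smul, Matrix.smul_kronecker]
  · intro g g'
    rw [modHbar_smul, Pi.smul_apply, hx.2, Finset.smul_sum]
    simp only [modHbar_smul, Pi.smul_apply, smul_mul_assoc]

theorem isCoproductOf_one (r : ℝ) :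
    IsCoproductOf (1 : Observable r) (fun _ : Unit => 1) (fun _ : Unit => 1) := by
  constructor
  · intro ħ n₁ n₂
    simp
  · intro g g'
    simp

/-- The place where the coproduct and the group law meet: the coordinates of a product of two points
expand by the same formulas as `Δ_r` of the generators. -/
theorem exists_isCoproductOf_gen (r : ℝ) (i : Gen) : ∃ (ι : Type) (_ : Fintype ι)
    (a b : ι → Observable r), IsCoproductOf (gen r planckVar (planckQ r) i) a b := by
  set x := gen r planckVar (planckQ r) with hx
  have e1 : ∀ g g' : SU2Star, Real.exp (r * (g.1 + g'.1) / 2)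
      = Real.exp (r * g.1 / 2) * Real.exp (r * g'.1 / 2) := fun g g' => by
    rw [← Real.exp_add]; ring_nf
  have e2 : ∀ g g' : SU2Star, Real.exp (-(r * (g.1 + g'.1) / 2))
      = Real.exp (-(r * g.1 / 2)) * Real.exp (-(r * g'.1 / 2)) := fun g g' => by
    rw [← Real.exp_add]; ring_nf
  cases i
  · refine ⟨Fin 2, inferInstance, ![x .H, 1], ![1, x .H], fun ħ n₁ n₂ => ?_, fun g g' => ?_⟩
    · simp [hx, obsMat_gen, obsMat₂_gen, tensorTuple, Fin.sum_univ_two]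
    · simp [hx, modHbar_gen, coordTuple, starMul, Fin.sum_univ_two]
  · refine ⟨Unit, inferInstance, fun _ => x .k, fun _ => x .k, fun ħ n₁ n₂ => ?_, fun g g' => ?_⟩
    · simp [hx, obsMat_gen, obsMat₂_gen, tensorTuple]
    · simp only [hx, modHbar_gen, coordTuple, starMul, e2]
      simp
  · refine ⟨Unit, inferInstance, fun _ => x .kInv, fun _ => x .kInv, fun ħ n₁ n₂ => ?_,
      fun g g' => ?_⟩
    · simp [hx, obsMat_gen, obsMat₂_gen, tensorTuple]
    · simp only [hx, modHbar_gen, coordTuple, starMul, e1]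
      simp
  · refine ⟨Fin 2, inferInstance, ![x .E, x .k], ![x .kInv, x .E], fun ħ n₁ n₂ => ?_,
      fun g g' => ?_⟩
    · simp [hx, obsMat_gen, obsMat₂_gen, tensorTuple, Fin.sum_univ_two]
    · simp [hx, modHbar_gen, coordTuple, starMul, Fin.sum_univ_two, ← Complex.exp_conj,
        Complex.conj_ofReal, Complex.conj_ofNat]
  · refine ⟨Fin 2, inferInstance, ![x .F, x .k], ![x .kInv, x .F], fun ħ n₁ n₂ => ?_,
      fun g g' => ?_⟩
    · simp [hx, obsMat_gen, obsMat₂_gen, tensorTuple, Fin.sum_univ_two]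
    · simp [hx, modHbar_gen, coordTuple, starMul, Fin.sum_univ_two]

theorem exists_isCoproductOf {r : ℝ} (𝓕 : Observable r) : ∃ (ι : Type) (_ : Fintype ι)
    (a b : ι → Observable r), IsCoproductOf 𝓕 a b := by
  induction 𝓕 using observable_induction with
  | hw l =>
    induction l with
    | nil => exact ⟨_, _, _, _, isCoproductOf_one r⟩
    | cons i l ih =>
      obtain ⟨ι, _, a, b, h⟩ := ih
      obtain ⟨κ, _, c, d, h'⟩ := exists_isCoproductOf_gen r i
      exact ⟨_, _, _, _, h'.mul h⟩
  | hadd x y hx hy =>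
    obtain ⟨ι, _, a, b, h⟩ := hx
    obtain ⟨κ, _, c, d, h'⟩ := hy
    exact ⟨_, _, _, _, h.add h'⟩
  | hsmul c x hx =>
    obtain ⟨ι, _, a, b, h⟩ := hx
    exact ⟨_, _, _, _, h.smul c⟩

theorem repTensor_qNegH (r ħ : ℝ) (n₁ n₂ : ℕ) :
    repTensor r ħ n₁ n₂ (qNegH r ħ) = rep r ħ n₁ (qNegH r ħ) ⊗ₖ rep r ħ n₂ (qNegH r ħ) := by
  have h1 : rep r ħ n₁ (gen r (ħ : ℂ) (qPow r ħ) .kInv) = repTuple r ħ n₁ .kInv :=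
    liftHom_gen _ (isQTuple_rep r ħ n₁) _
  have h2 : rep r ħ n₂ (gen r (ħ : ℂ) (qPow r ħ) .kInv) = repTuple r ħ n₂ .kInv :=
    liftHom_gen _ (isQTuple_rep r ħ n₂) _
  rw [qNegH, map_mul, map_mul, map_mul, repTensor_gen, h1, h2, Matrix.mul_kronecker_mul]
  rfl

/-- `q^{-H}` is group-like and the trace of a Kronecker product is the product of the traces, so
each term of the expansion splits. -/
theorem IsCoproductOf.weightedTrace₂_eq {r : ℝ} {𝓕 : Observable r} {ι : Type} [Fintype ι]
    {a b : ι → Observable r} (h : IsCoproductOf 𝓕 a b) (Λ₁ Λ₂ ħ : ℝ) :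
    weightedTrace₂ r Λ₁ Λ₂ 𝓕 ħ
      = ∑ i, weightedTrace r Λ₁ (a i) ħ * weightedTrace r Λ₂ (b i) ħ := by
  have e : repTensor r ħ (level Λ₁ ħ) (level Λ₂ ħ) (specialize r ħ 𝓕)
      = ∑ i, rep r ħ (level Λ₁ ħ) (specialize r ħ (a i)) ⊗ₖ
        rep r ħ (level Λ₂ ħ) (specialize r ħ (b i)) := h.1 ħ _ _
  rw [weightedTrace₂, map_mul, repTensor_qNegH, e, Matrix.trace_kronecker, Finset.mul_sum,
    Matrix.trace_sum, Finset.sum_div]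
  refine Finset.sum_congr rfl fun i _ => ?_
  rw [← Matrix.mul_kronecker_mul, Matrix.trace_kronecker, weightedTrace, weightedTrace, map_mul,
    map_mul, mul_div_mul_comm]

variable {Ω : Type*} [MeasurableSpace Ω] {P : Measure Ω}
  {g₁ g₂ : Ω → SU2Star} {r Λ₁ Λ₂ : ℝ}

theorem integral_comp_hasLaw (h : HasLaw g₁ (uniformOrbit r Λ₁) P) {f : SU2Star → ℂ}
    (hf : Continuous f) : ∫ ω, f (g₁ ω) ∂P = ∫ g, f g ∂uniformOrbit r Λ₁ :=
  h.integral_comp hf.aestronglyMeasurable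

theorem ae_mem_dressingOrbit_of_hasLaw (h : HasLaw g₁ (uniformOrbit r Λ₁) P) :
    ∀ᵐ ω ∂P, g₁ ω ∈ dressingOrbit r Λ₁ := by
  have := ae_mem_dressingOrbit r Λ₁
  rw [← h.map_eq] at this
  exact ae_of_ae_map h.aemeasurable this

theorem integrable_comp_hasLaw [IsProbabilityMeasure P] (h : HasLaw g₁ (uniformOrbit r Λ₁) P) {f : SU2Star → ℂ}
    (hf : Continuous f) : Integrable (fun ω => f (g₁ ω)) P := by
  obtain ⟨C, hC⟩ := (isCompact_dressingOrbit r Λ₁).exists_bound_of_continuousOn hf.continuousOn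
  refine Integrable.of_bound (C := C) ?_ ?_
  · exact (hf.measurable.comp_aemeasurable h.aemeasurable).aestronglyMeasurable
  · exact (ae_mem_dressingOrbit_of_hasLaw h).mono fun ω hω => hC _ hω

theorem continuous_starMul (r : ℝ) : Continuous fun z : SU2Star × SU2Star => starMul r z.1 z.2 := by
  unfold starMul
  fun_prop

theorem aemeasurable_starMul (h₁ : HasLaw g₁ (uniformOrbit r Λ₁) P)
    (h₂ : HasLaw g₂ (uniformOrbit r Λ₂) P) : AEMeasurable (fun ω => starMul r (g₁ ω) (g₂ ω)) P :=
  (continuous_starMul r).measurable.comp_aemeasurable (h₁.aemeasurable.prodMk h₂.aemeasurable)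

theorem exists_compact_starMul (r Λ₁ Λ₂ : ℝ) : ∃ K : Set SU2Star, IsCompact K ∧
    ∀ g ∈ dressingOrbit r Λ₁, ∀ g' ∈ dressingOrbit r Λ₂, starMul r g g' ∈ K :=
  ⟨_, ((isCompact_dressingOrbit r Λ₁).prod (isCompact_dressingOrbit r Λ₂)).image
    (continuous_starMul r), fun g hg g' hg' => ⟨(g, g'), ⟨hg, hg'⟩, rfl⟩⟩

theorem integrable_comp_starMul [IsProbabilityMeasure P] (h₁ : HasLaw g₁ (uniformOrbit r Λ₁) P)
    (h₂ : HasLaw g₂ (uniformOrbit r Λ₂) P) {f : SU2Star → ℂ} (hf : Continuous f) :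
    Integrable (fun ω => f (starMul r (g₁ ω) (g₂ ω))) P := by
  obtain ⟨K, hK, hmem⟩ := exists_compact_starMul r Λ₁ Λ₂
  obtain ⟨C, hC⟩ := hK.exists_bound_of_continuousOn hf.continuousOn
  refine Integrable.of_bound (C := C) ?_ ?_
  · exact (hf.measurable.comp_aemeasurable (aemeasurable_starMul h₁ h₂)).aestronglyMeasurable
  · filter_upwards [ae_mem_dressingOrbit_of_hasLaw h₁, ae_mem_dressingOrbit_of_hasLaw h₂]
      with ω h1 h2
    exact hC _ (hmem _ h1 _ h2)

/-- A single expansion, independent of `ħ`, governs both sides. Independence splits the expectation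
as the Kronecker product splits the trace, and the one-orbit limit applies to every factor. -/
theorem tendsto_weightedTrace₂ [IsProbabilityMeasure P] (hr : 0 ≤ r) (hΛ₁ : 0 < Λ₁) (hΛ₂ : 0 < Λ₂)
    (h₁ : HasLaw g₁ (uniformOrbit r Λ₁) P) (h₂ : HasLaw g₂ (uniformOrbit r Λ₂) P)
    (hind : IndepFun g₁ g₂ P) (𝓕 : Observable r) :
    Tendsto (weightedTrace₂ r Λ₁ Λ₂ 𝓕) (𝓝[>] 0)
      (𝓝 (∫ ω, modHbar r 𝓕 (starMul r (g₁ ω) (g₂ ω)) ∂P)) := by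
  obtain ⟨ι, _, a, b, h⟩ := exists_isCoproductOf 𝓕
  have e : ∫ ω, modHbar r 𝓕 (starMul r (g₁ ω) (g₂ ω)) ∂P
      = ∑ i, (∫ g, modHbar r (a i) g ∂uniformOrbit r Λ₁) *
        ∫ g, modHbar r (b i) g ∂uniformOrbit r Λ₂ := by
    have hi : ∀ i, IndepFun (fun ω => modHbar r (a i) (g₁ ω)) (fun ω => modHbar r (b i) (g₂ ω)) P :=
      fun i => hind.comp (continuous_modHbar r (a i)).measurable
        (continuous_modHbar r (b i)).measurable
    have i1 := fun i => integrable_comp_hasLaw h₁ (continuous_modHbar r (a i))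
    have i2 := fun i => integrable_comp_hasLaw h₂ (continuous_modHbar r (b i))
    simp only [h.2]
    rw [integral_finsetSum]
    · refine Finset.sum_congr rfl fun i _ => ?_
      rw [(hi i).integral_fun_mul_eq_mul_integral (i1 i).aestronglyMeasurable
        (i2 i).aestronglyMeasurable, integral_comp_hasLaw h₁ (continuous_modHbar r (a i)),
        integral_comp_hasLaw h₂ (continuous_modHbar r (b i))]
    · exact fun i _ => (hi i).integrable_mul (i1 i) (i2 i)
  rw [e]
  refine (tendsto_finsetSum _ fun i _ => (tendsto_weightedTrace hr hΛ₁ (a i)).mul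
    (tendsto_weightedTrace hr hΛ₂ (b i))).congr fun ħ => ?_
  rw [h.weightedTrace₂_eq]

end TwoOrbits

/-! ### Crystals -/

section Crystals

/-- The weight of `b₁ ⊗ b₂`, in units of `ħ`. -/
def weightInt (n₁ n₂ : ℕ) (b : Crystal n₁ × Crystal n₂) : ℤ :=
  2 * ((b.1 : ℕ) + (b.2 : ℕ)) - (n₁ + n₂)

/-- The highest weight of the component of `b₁ ⊗ b₂`, in units of `ħ`. -/
def highestInt (n₁ n₂ i j : ℕ) : ℤ := max (n₁ + (2 * (j : ℤ) - n₂)) (n₁ + n₂ - 2 * i)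

theorem tensorWt_eq (ħ : ℝ) (n₁ n₂ : ℕ) (b : Crystal n₁ × Crystal n₂) :
    tensorWt ħ n₁ n₂ b = ħ * weightInt n₁ n₂ b := by
  simp only [tensorWt, crystalWt, wtIdx, weightInt]
  push_cast
  ring

/-- With indices `i, j` of the two factors, the rule `φ(b₁) ≥ ε(b₂)` reads `i + j ≥ n₂`. The maximum
is then its first entry, which does not involve the index `i` being raised; otherwise it is the
second, which does not involve `j`. -/
theorem highestInt_eq_of_tensorUp {n₁ n₂ : ℕ} {b b' : Crystal n₁ × Crystal n₂}
    (h : tensorUp n₁ n₂ b b') : highestInt n₁ n₂ b.1 b.2 = highestInt n₁ n₂ b'.1 b'.2 := by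
  simp only [tensorUp, crystalEps, crystalPhi, crystalUp] at h
  simp only [highestInt]
  rcases h with ⟨h1, h2, h3⟩ | ⟨h1, h2, h3⟩
  · rw [h2, h3]; omega
  · rw [h2, h3]; omega

theorem highestInt_eq_of_eqvGen {n₁ n₂ : ℕ} {b b' : Crystal n₁ × Crystal n₂}
    (h : Relation.EqvGen (tensorUp n₁ n₂) b b') :
    highestInt n₁ n₂ b.1 b.2 = highestInt n₁ n₂ b'.1 b'.2 := by
  induction h with
  | rel _ _ h => exact highestInt_eq_of_tensorUp h
  | refl => rfl
  | symm _ _ _ ih => exact ih.symm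
  | trans _ _ _ _ _ ih₁ ih₂ => exact ih₁.trans ih₂

theorem weightInt_le_highestInt (n₁ n₂ : ℕ) (b : Crystal n₁ × Crystal n₂) :
    weightInt n₁ n₂ b ≤ highestInt n₁ n₂ b.1 b.2 := by
  have h1 := b.1.2
  simp only [weightInt, highestInt]
  omega

/-- Each raising arrow increases `i + j` by one and `m` bounds the number of steps left. The climb
stops only at `i = n₁` with `i + j ≥ n₂`, where weight and highest weight agree. -/
theorem exists_eqvGen_weightInt_eq {n₁ n₂ : ℕ} (m : ℕ) (b : Crystal n₁ × Crystal n₂)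
    (hm : n₁ + n₂ ≤ (b.1 : ℕ) + b.2 + m) : ∃ b', Relation.EqvGen (tensorUp n₁ n₂) b b' ∧
      weightInt n₁ n₂ b' = highestInt n₁ n₂ b'.1 b'.2 := by
  have h1 := b.1.2
  have h2 := b.2.2
  induction m generalizing b with
  | zero =>
    refine ⟨b, .refl _, ?_⟩
    simp only [weightInt, highestInt]
    omega
  | succ m ih =>
    by_cases hc : crystalEps n₂ b.2 ≤ crystalPhi n₁ b.1
    · by_cases htop : (b.1 : ℕ) = n₁
      · refine ⟨b, .refl _, ?_⟩
        simp only [weightInt, highestInt, crystalEps, crystalPhi] at hc ⊢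
        omega
      · let b₁ : Crystal n₁ × Crystal n₂ := (⟨b.1 + 1, by omega⟩, b.2)
        have hup : tensorUp n₁ n₂ b b₁ := Or.inl ⟨hc, rfl, rfl⟩
        obtain ⟨b', hb', hw⟩ := ih b₁ (by simp only [b₁]; omega) b₁.1.2 b₁.2.2
        exact ⟨b', .trans _ _ _ (.rel _ _ hup) hb', hw⟩
    · have hlt : (b.2 : ℕ) + 1 < n₂ + 1 := by
        simp only [crystalEps, crystalPhi] at hc
        omega
      let b₁ : Crystal n₁ × Crystal n₂ := (b.1, ⟨b.2 + 1, hlt⟩)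
      have hup : tensorUp n₁ n₂ b b₁ := Or.inr ⟨not_le.mp hc, rfl, rfl⟩
      obtain ⟨b', hb', hw⟩ := ih b₁ (by simp only [b₁]; omega) b₁.1.2 b₁.2.2
      exact ⟨b', .trans _ _ _ (.rel _ _ hup) hb', hw⟩

theorem tensorHw_eq {ħ : ℝ} (hħ : 0 < ħ) (n₁ n₂ : ℕ) (b : Crystal n₁ × Crystal n₂) :
    tensorHw ħ n₁ n₂ b = ħ * highestInt n₁ n₂ b.1 b.2 := by
  refine IsGreatest.csSup_eq ⟨?_, ?_⟩
  · obtain ⟨b', hb', hw⟩ := exists_eqvGen_weightInt_eq (n₁ + n₂) b (by omega)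
    exact ⟨b', hb', by rw [tensorWt_eq, hw, highestInt_eq_of_eqvGen hb']⟩
  · rintro _ ⟨b', hb', rfl⟩
    rw [tensorWt_eq, highestInt_eq_of_eqvGen hb']
    have : (weightInt n₁ n₂ b' : ℝ) ≤ highestInt n₁ n₂ b'.1 b'.2 := by
      exact_mod_cast weightInt_le_highestInt n₁ n₂ b'
    gcongr

theorem highestInt_real (ħ : ℝ) (hħ : 0 < ħ) (n₁ n₂ : ℕ) (b : Crystal n₁ × Crystal n₂) :
    ħ * (highestInt n₁ n₂ b.1 b.2 : ℝ) =
      max (ħ * n₁ + crystalWt ħ n₂ b.2) (-crystalWt ħ n₁ b.1 + ħ * n₂) := by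
  simp only [highestInt, crystalWt, wtIdx]
  push_cast
  rw [mul_max_of_nonneg _ _ hħ.le]
  congr 1 <;> ring

/-- The sum of a function of the highest weight over the elements of given weight. -/
noncomputable def levelSum (n₁ n₂ : ℕ) (g : ℤ → ℂ) (M : ℕ) : ℂ :=
  ∑ b : Crystal n₁ × Crystal n₂,
    if (b.1 : ℕ) + b.2 = M then g (highestInt n₁ n₂ b.1 b.2) else 0

/-- For `i + j ≤ n₂` the highest weight depends on `i` alone, so `i` parametrizes the level; in
`levelSum_of_ge` the roles are exchanged. -/
theorem levelSum_of_le {n₁ n₂ M : ℕ} (hM : M ≤ n₂) (g : ℤ → ℂ) :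
    levelSum n₁ n₂ g M = ∑ i : Fin (n₁ + 1),
      if (i : ℕ) ≤ M then g (n₁ + n₂ - 2 * (i : ℕ)) else 0 := by
  rw [levelSum, Fintype.sum_prod_type]
  refine Finset.sum_congr rfl fun i _ => ?_
  by_cases hi : (i : ℕ) ≤ M
  · rw [if_pos hi, Finset.sum_eq_single (⟨M - i, by omega⟩ : Fin (n₂ + 1))]
    · rw [if_pos (by simp only; omega)]
      congr 1
      simp only [highestInt]
      omega
    · intro j _ hj
      rw [if_neg]
      intro h
      exact hj (Fin.ext (by simp only at h ⊢; omega))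
    · simp
  · rw [if_neg hi, Finset.sum_eq_zero]
    intro j _
    rw [if_neg (by simp only; omega)]

theorem levelSum_of_ge {n₁ n₂ M : ℕ} (hM : n₂ ≤ M) (g : ℤ → ℂ) :
    levelSum n₁ n₂ g M = ∑ j : Fin (n₂ + 1),
      if M ≤ n₁ + (j : ℕ) then g (n₁ + (2 * (j : ℕ) - n₂)) else 0 := by
  rw [levelSum, Fintype.sum_prod_type_right]
  refine Finset.sum_congr rfl fun j _ => ?_
  have hj := j.2
  by_cases hi : M ≤ n₁ + (j : ℕ)
  · rw [if_pos hi, Finset.sum_eq_single (⟨M - j, by omega⟩ : Fin (n₁ + 1))]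
    · rw [if_pos (by simp only; omega)]
      congr 1
      simp only [highestInt]
      omega
    · intro i _ hi
      rw [if_neg]
      intro h
      exact hi (Fin.ext (by simp only at h ⊢; omega))
    · simp
  · rw [if_neg hi, Finset.sum_eq_zero]
    intro i _
    have := i.2
    rw [if_neg (by simp only; omega)]

theorem levelSum_zero (n₁ n₂ : ℕ) (g : ℤ → ℂ) : levelSum n₁ n₂ g 0 = g (n₁ + n₂) := by
  rw [levelSum_of_le (Nat.zero_le _), Finset.sum_eq_single 0]
  · simp
  · intro i _ hi
    rw [if_neg]
    intro h
    exact hi (Fin.ext (by simpa using h))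
  · simp

/-- From weight `w = 2M - (n₁ + n₂)` to `w + 2` at most one string of the crystal changes: one
begins, with highest weight `-(w + 2)`, or one ends, with highest weight `w`. Both values are `|w +
1| - 1`. As `δ` does not depend on `g`, `levelSum_succ` can compute it from `g = 1`. -/
theorem exists_levelSum_succ (n₁ n₂ M : ℕ) : ∃ δ : ℂ, ∀ g : ℤ → ℂ,
    levelSum n₁ n₂ g (M + 1) = levelSum n₁ n₂ g M + δ * g (|2 * (M : ℤ) - (n₁ + n₂) + 1| - 1) := by
  rcases lt_or_ge M n₂ with hM | hM
  · refine ⟨if M + 1 ≤ n₁ then 1 else 0, fun g => ?_⟩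
    rw [levelSum_of_le hM, levelSum_of_le hM.le, ← sub_eq_iff_eq_add', ← Finset.sum_sub_distrib]
    split_ifs with h
    · rw [Finset.sum_eq_single (⟨M + 1, by omega⟩ : Fin (n₁ + 1))]
      · rw [if_pos (by simp), if_neg (by simp), sub_zero, one_mul]
        congr 1
        rw [abs_of_nonpos (by omega)]
        simp only
        omega
      · intro i _ hi
        have : (i : ℕ) ≠ M + 1 := fun h => hi (Fin.ext h)
        by_cases h' : (i : ℕ) ≤ M
        · rw [if_pos h', if_pos (by omega), sub_self]
        · rw [if_neg h', if_neg (by omega), sub_self]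
      · simp
    · rw [zero_mul, Finset.sum_eq_zero]
      intro i _
      have := i.2
      rw [if_pos (by omega), if_pos (by omega), sub_self]
  · refine ⟨if n₁ ≤ M ∧ M ≤ n₁ + n₂ then -1 else 0, fun g => ?_⟩
    rw [levelSum_of_ge (by omega : n₂ ≤ M + 1), levelSum_of_ge hM, ← sub_eq_iff_eq_add',
      ← Finset.sum_sub_distrib]
    split_ifs with h
    · rw [Finset.sum_eq_single (⟨M - n₁, by omega⟩ : Fin (n₂ + 1))]
      · rw [if_neg (by simp only; omega), if_pos (by simp only; omega), zero_sub, neg_one_mul]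
        congr 2
        rw [abs_of_nonneg (by omega)]
        simp only
        omega
      · intro i _ hi
        have : (i : ℕ) ≠ M - n₁ := fun h => hi (Fin.ext h)
        by_cases h' : M ≤ n₁ + (i : ℕ)
        · rw [if_pos h', if_pos (by omega), sub_self]
        · rw [if_neg h', if_neg (by omega), sub_self]
      · simp
    · rw [zero_mul, Finset.sum_eq_zero]
      intro i _
      have := i.2
      by_cases h' : M ≤ n₁ + (i : ℕ)
      · rw [if_pos h', if_pos (by omega), sub_self]
      · rw [if_neg h', if_neg (by omega), sub_self]

theorem levelSum_succ (n₁ n₂ M : ℕ) (g : ℤ → ℂ) :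
    levelSum n₁ n₂ g (M + 1) = levelSum n₁ n₂ g M +
      (levelSum n₁ n₂ (fun _ => 1) (M + 1) - levelSum n₁ n₂ (fun _ => 1) M) *
        g (|2 * (M : ℤ) - (n₁ + n₂) + 1| - 1) := by
  obtain ⟨δ, h⟩ := exists_levelSum_succ n₁ n₂ M
  rw [h g, h fun _ => 1]
  ring

theorem zero_le_highestInt (n₁ n₂ : ℕ) (b : Crystal n₁ × Crystal n₂) :
    0 ≤ highestInt n₁ n₂ b.1 b.2 := by
  have h1 := b.1.2
  simp only [highestInt]
  omega

end Crystals

/-! ### The trace of a function of the Casimir operator and of the weight -/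

section TraceIdentity

open scoped Kronecker

variable {ι : Type*} [Fintype ι] [DecidableEq ι]

/-- `A` acts as `VU` on the range of `P` and as `UV` on that of `P'`; positive powers of the two
have the same trace by cyclicity. The power zero is excluded because it measures the rank. -/
theorem trace_pow_mul_eq {A U V P P' : Matrix ι ι ℂ} (hU : P' * U = U * P) (hV : V * P' = P * V)
    (hA : A * P = V * U * P) (hA' : A * P' = U * V * P') (k : ℕ) :
    (A ^ (k + 1) * P').trace = (A ^ (k + 1) * P).trace := by
  have c1 : V * U * P = P * (V * U) := by rw [mul_assoc, ← hU, ← mul_assoc, hV, mul_assoc]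
  have c2 : U * V * P' = P' * (U * V) := by rw [mul_assoc, hV, ← mul_assoc, ← hU, mul_assoc]
  have h1 : ∀ k : ℕ, A ^ k * P = (V * U) ^ k * P := fun k => by
    induction k with
    | zero => simp
    | succ k ih => rw [pow_succ, mul_assoc, hA, c1, ← mul_assoc, ih, mul_assoc, ← c1, ← mul_assoc,
        ← pow_succ]
  have h2 : ∀ k : ℕ, A ^ k * P' = (U * V) ^ k * P' := fun k => by
    induction k with
    | zero => simp
    | succ k ih => rw [pow_succ, mul_assoc, hA', c2, ← mul_assoc, ih, mul_assoc, ← c2, ← mul_assoc,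
        ← pow_succ]
  have h3 : (U * V) ^ (k + 1) * P' = U * ((V * U) ^ k * P * V) := by
    rw [pow_succ, ← mul_assoc, mul_pow_mul, mul_assoc, mul_assoc, hV, mul_assoc]
  rw [h1, h2, h3, Matrix.trace_mul_comm, mul_assoc, mul_assoc, ← c1, ← mul_assoc, ← pow_succ]

/-- Expanding `p` in powers of `T - t`, the positive powers contribute equally, and the constant
term `p(t)` sees the difference of ranks. -/
theorem trace_aeval_mul_eq {T U V P P' : Matrix ι ι ℂ} {t : ℂ} (hU : P' * U = U * P)
    (hV : V * P' = P * V) (hT : T * P = V * U * P + t • P) (hT' : T * P' = U * V * P' + t • P')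
    (p : ℂ[X]) :
    (aeval T p * P').trace = (aeval T p * P).trace + p.eval t * (P'.trace - P.trace) := by
  set A := T - algebraMap ℂ (Matrix ι ι ℂ) t with hAdef
  have hA : A * P = V * U * P := by
    rw [hAdef, sub_mul, hT, Algebra.algebraMap_eq_smul_one, smul_one_mul, add_sub_cancel_right]
  have hA' : A * P' = U * V * P' := by
    rw [hAdef, sub_mul, hT', Algebra.algebraMap_eq_smul_one, smul_one_mul, add_sub_cancel_right]
  have key : ∀ q : ℂ[X],
      (aeval A q * P').trace = (aeval A q * P).trace + q.eval 0 * (P'.trace - P.trace) := by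
    intro q
    induction q using Polynomial.induction_on' with
    | add p q hp hq =>
      simp only [map_add, add_mul, Matrix.trace_add, hp, hq, eval_add]
      ring
    | monomial k a =>
      rw [aeval_monomial, Algebra.algebraMap_eq_smul_one, smul_one_mul, smul_mul_assoc,
        smul_mul_assoc, Matrix.trace_smul, Matrix.trace_smul]
      cases k with
      | zero => simp; ring
      | succ k => simp [trace_pow_mul_eq hU hV hA hA' k]
  have h := key (p.comp (Polynomial.X + C t))
  rw [aeval_comp] at h
  simpa [hAdef] using h

/-- The projection to a weight space of `V^q(ħ n₁) ⊗ V^q(ħ n₂)`. -/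
noncomputable def weightProj (n₁ n₂ M : ℕ) :
    Matrix (Fin (n₁ + 1) × Fin (n₂ + 1)) (Fin (n₁ + 1) × Fin (n₂ + 1)) ℂ :=
  Matrix.diagonal fun b => if (b.1 : ℕ) + b.2 = M then 1 else 0

variable (r ħ : ℝ) (n₁ n₂ : ℕ)

theorem tensorTuple_H : tensorTuple r ħ n₁ n₂ .H
    = Matrix.diagonal fun b => ((ħ * weightInt n₁ n₂ b : ℝ) : ℂ) := by
  rw [tensorTuple, repTuple, repTuple, ← Matrix.diagonal_one, ← Matrix.diagonal_one,
    Matrix.diagonal_kronecker_diagonal, Matrix.diagonal_kronecker_diagonal, Matrix.diagonal_add]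
  congr 1
  ext b
  simp only [wtIdx, weightInt]
  push_cast
  ring

theorem tensorTuple_k_mul_k : tensorTuple r ħ n₁ n₂ .k * tensorTuple r ħ n₁ n₂ .k
    = Matrix.diagonal fun b => ((Real.exp (-(r * ħ * weightInt n₁ n₂ b)) : ℝ) : ℂ) := by
  rw [tensorTuple, repTuple, repTuple, Matrix.diagonal_kronecker_diagonal,
    Matrix.diagonal_mul_diagonal]
  congr 1
  ext b
  simp only [← Complex.ofReal_mul, ← Real.exp_add, wtIdx, weightInt]
  congr 2
  push_cast
  ring

theorem tensorTuple_kInv_mul_kInv : tensorTuple r ħ n₁ n₂ .kInv * tensorTuple r ħ n₁ n₂ .kInv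
    = Matrix.diagonal fun b => ((Real.exp (r * ħ * weightInt n₁ n₂ b) : ℝ) : ℂ) := by
  rw [tensorTuple, repTuple, repTuple, Matrix.diagonal_kronecker_diagonal,
    Matrix.diagonal_mul_diagonal]
  congr 1
  ext b
  simp only [← Complex.ofReal_mul, ← Real.exp_add, wtIdx, weightInt]
  congr 2
  push_cast
  ring

theorem tensorTuple_F_eq_conjTranspose :
    tensorTuple r ħ n₁ n₂ .F = (tensorTuple r ħ n₁ n₂ .E)ᴴ := by
  have h : ∀ n, (repTuple r ħ n .E)ᴴ = repTuple r ħ n .F := fun n => by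
    ext i j
    simp only [repTuple, Matrix.conjTranspose_apply, Matrix.of_apply]
    split_ifs with hij
    · rw [Complex.star_def, Complex.conj_ofReal]
      congr 2
      simp only [wtIdx, hij]
      push_cast
      ring
    · simp
  have hk : ∀ n, (repTuple r ħ n .k)ᴴ = repTuple r ħ n .k := fun n => by
    rw [repTuple, Matrix.diagonal_conjTranspose]
    congr 1
    ext i
    exact Complex.conj_ofReal _
  have hkInv : ∀ n, (repTuple r ħ n .kInv)ᴴ = repTuple r ħ n .kInv := fun n => by
    rw [repTuple, Matrix.diagonal_conjTranspose]
    congr 1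
    ext i
    exact Complex.conj_ofReal _
  simp only [tensorTuple, Matrix.conjTranspose_add, Matrix.conjTranspose_kronecker, h, hk, hkInv]

variable {r ħ n₁ n₂}

theorem tensorTuple_E_eq_zero {a b : Fin (n₁ + 1) × Fin (n₂ + 1)}
    (h : (a.1 : ℕ) + a.2 ≠ b.1 + b.2 + 1) : tensorTuple r ħ n₁ n₂ .E a b = 0 := by
  obtain ⟨a₁, a₂⟩ := a
  obtain ⟨b₁, b₂⟩ := b
  simp only [tensorTuple, repTuple, Matrix.add_apply, Matrix.kroneckerMap_apply, Matrix.of_apply,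
    Matrix.diagonal_apply, Fin.ext_iff] at h ⊢
  split_ifs <;> first | omega | simp

theorem weightProj_succ_mul_E (M : ℕ) : weightProj n₁ n₂ (M + 1) * tensorTuple r ħ n₁ n₂ .E
    = tensorTuple r ħ n₁ n₂ .E * weightProj n₁ n₂ M := by
  ext a b
  rw [weightProj, weightProj, Matrix.diagonal_mul, Matrix.mul_diagonal]
  by_cases h : (a.1 : ℕ) + a.2 = b.1 + b.2 + 1
  · simp only [h, add_left_inj]
    rw [mul_comm]
  · rw [tensorTuple_E_eq_zero h, mul_zero, zero_mul]

theorem conjTranspose_weightProj (M : ℕ) : (weightProj n₁ n₂ M)ᴴ = weightProj n₁ n₂ M := by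
  rw [weightProj, Matrix.diagonal_conjTranspose]
  congr 1
  ext b
  simp only [Pi.star_apply]
  split_ifs <;> simp

theorem F_mul_weightProj_succ (M : ℕ) : tensorTuple r ħ n₁ n₂ .F * weightProj n₁ n₂ (M + 1)
    = weightProj n₁ n₂ M * tensorTuple r ħ n₁ n₂ .F := by
  have := congrArg Matrix.conjTranspose (weightProj_succ_mul_E (r := r) (ħ := ħ) (n₁ := n₁)
    (n₂ := n₂) M)
  simpa only [Matrix.conjTranspose_mul, conjTranspose_weightProj,
    ← tensorTuple_F_eq_conjTranspose] using this

theorem F_mul_weightProj_zero : tensorTuple r ħ n₁ n₂ .F * weightProj n₁ n₂ 0 = 0 := by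
  have : weightProj n₁ n₂ 0 * tensorTuple r ħ n₁ n₂ .E = 0 := by
    ext a b
    rw [weightProj, Matrix.diagonal_mul]
    by_cases h : (a.1 : ℕ) + a.2 = b.1 + b.2 + 1
    · rw [if_neg (by omega), zero_mul, Matrix.zero_apply]
    · rw [tensorTuple_E_eq_zero h, mul_zero, Matrix.zero_apply]
  have := congrArg Matrix.conjTranspose this
  simpa only [Matrix.conjTranspose_mul, conjTranspose_weightProj,
    ← tensorTuple_F_eq_conjTranspose, Matrix.conjTranspose_zero] using this

/-- The action of `cosh (r (Λ^{r,ħ} + ħ))`. -/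
noncomputable def coshCasimir (r ħ : ℝ) (n₁ n₂ : ℕ) :
    Matrix (Fin (n₁ + 1) × Fin (n₂ + 1)) (Fin (n₁ + 1) × Fin (n₂ + 1)) ℂ :=
  repTensor r ħ n₁ n₂
    ((((Real.exp (r * ħ) - Real.exp (-(r * ħ))) / (2 * r * ħ) : ℝ) : ℂ) • casimir r ħ)

theorem exp_sub_exp_neg_ne_zero {x : ℝ} (hx : x ≠ 0) : Real.exp x - Real.exp (-x) ≠ 0 := by
  intro h
  have := Real.exp_injective (sub_eq_zero.mp h)
  exact hx (by linarith)

/-! ### The Casimir operator in the orderings `EF` and `FE` -/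

theorem diagonal_cosh_eq : (Matrix.diagonal fun b : Fin (n₁ + 1) × Fin (n₂ + 1) =>
    ((Real.cosh (r * ħ * (weightInt n₁ n₂ b - 1)) : ℝ) : ℂ)) = ((1 / 2 : ℝ) : ℂ) •
      (((Real.exp (r * ħ) : ℝ) : ℂ) • (tensorTuple r ħ n₁ n₂ .k * tensorTuple r ħ n₁ n₂ .k) +
      ((Real.exp (-(r * ħ)) : ℝ) : ℂ) •
        (tensorTuple r ħ n₁ n₂ .kInv * tensorTuple r ħ n₁ n₂ .kInv)) := by
  have e : ∀ b : Fin (n₁ + 1) × Fin (n₂ + 1), Real.cosh (r * ħ * (weightInt n₁ n₂ b - 1))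
      = 1 / 2 * (Real.exp (r * ħ) * Real.exp (-(r * ħ * weightInt n₁ n₂ b))
        + Real.exp (-(r * ħ)) * Real.exp (r * ħ * weightInt n₁ n₂ b)) := fun b => by
    rw [Real.cosh_eq, ← Real.exp_add, ← Real.exp_add]
    ring_nf
  rw [tensorTuple_k_mul_k, tensorTuple_kInv_mul_kInv, ← Matrix.diagonal_smul,
    ← Matrix.diagonal_smul, Matrix.diagonal_add, ← Matrix.diagonal_smul]
  congr 1
  ext b
  rw [e b]
  simp only [Pi.smul_apply, smul_eq_mul]
  push_cast
  rfl

theorem coshCasimir_eq_EF (hr : r ≠ 0) (hħ : ħ ≠ 0) : coshCasimir r ħ n₁ n₂ =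
    ((r * (Real.exp (r * ħ) - Real.exp (-(r * ħ))) / ħ : ℝ) : ℂ) •
      (tensorTuple r ħ n₁ n₂ .E * tensorTuple r ħ n₁ n₂ .F) +
    Matrix.diagonal fun b => ((Real.cosh (r * ħ * (weightInt n₁ n₂ b - 1)) : ℝ) : ℂ) := by
  have hd := exp_sub_exp_neg_ne_zero (mul_ne_zero hr hħ)
  rw [coshCasimir, casimir, diagonal_cosh_eq]
  simp only [map_smul, map_add, map_mul, repTensor_gen, smul_add, smul_smul]
  rw [show (1 / 2 : ℂ) = ((1 / 2 : ℝ) : ℂ) by norm_num]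
  simp only [← Complex.ofReal_mul]
  refine congrArg₂ _ (congrArg (fun z : ℝ => (z : ℂ) • _) ?_)
    (congrArg₂ _ (congrArg (fun z : ℝ => (z : ℂ) • _) ?_) (congrArg (fun z : ℝ => (z : ℂ) • _) ?_))
  · field_simp
    ring
  · field_simp
  · field_simp

theorem tensorTuple_E_mul_F (hr : r ≠ 0) :
    tensorTuple r ħ n₁ n₂ .E * tensorTuple r ħ n₁ n₂ .F =
    tensorTuple r ħ n₁ n₂ .F * tensorTuple r ħ n₁ n₂ .E + Matrix.diagonal fun b =>
      ((ħ / (2 * r) * (Real.exp (r * ħ * weightInt n₁ n₂ b)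
        - Real.exp (-(r * ħ * weightInt n₁ n₂ b))) : ℝ) : ℂ) := by
  have h := congrArg (repTensor r ħ n₁ n₂) (isQTuple_gen r (ħ : ℂ) (qPow r ħ)).E_F
  rw [map_smul, map_curvedH, map_sub, map_mul, map_mul] at h
  simp only [repTensor_gen, curvedH, if_neg hr] at h
  rw [tensorTuple_k_mul_k, tensorTuple_kInv_mul_kInv, Matrix.diagonal_sub, sub_eq_iff_eq_add'] at h
  rw [h, Algebra.algebraMap_self, RingHom.id_apply, ← Matrix.diagonal_smul, ← Matrix.diagonal_smul]
  congr 2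
  ext b
  simp only [Pi.smul_apply, smul_eq_mul]
  push_cast
  ring

/-- The scalar part is `cosh (rħ(w + 1))` at weight `w` here and `cosh (rħ(w - 1))` in
`coshCasimir_eq_EF`. It therefore has a common value at `w` in this ordering and at `w + 2` in the
other, as `trace_aeval_mul_eq` requires. -/
theorem coshCasimir_eq_FE (hr : r ≠ 0) (hħ : ħ ≠ 0) : coshCasimir r ħ n₁ n₂ =
    ((r * (Real.exp (r * ħ) - Real.exp (-(r * ħ))) / ħ : ℝ) : ℂ) •
      (tensorTuple r ħ n₁ n₂ .F * tensorTuple r ħ n₁ n₂ .E) +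
    Matrix.diagonal fun b => ((Real.cosh (r * ħ * (weightInt n₁ n₂ b + 1)) : ℝ) : ℂ) := by
  rw [coshCasimir_eq_EF hr hħ, tensorTuple_E_mul_F hr, smul_add, add_assoc, ← Matrix.diagonal_smul,
    Matrix.diagonal_add]
  congr 2
  ext b
  simp only [Pi.smul_apply, smul_eq_mul]
  rw [← Complex.ofReal_mul, ← Complex.ofReal_add]
  congr 1
  have e1 : Real.exp (r * ħ * (weightInt n₁ n₂ b - 1))
      = Real.exp (r * ħ * weightInt n₁ n₂ b) * Real.exp (-(r * ħ)) := by
    rw [← Real.exp_add]; ring_nf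
  have e2 : Real.exp (-(r * ħ * (weightInt n₁ n₂ b - 1)))
      = Real.exp (-(r * ħ * weightInt n₁ n₂ b)) * Real.exp (r * ħ) := by
    rw [← Real.exp_add]; ring_nf
  have e3 : Real.exp (r * ħ * (weightInt n₁ n₂ b + 1))
      = Real.exp (r * ħ * weightInt n₁ n₂ b) * Real.exp (r * ħ) := by
    rw [← Real.exp_add]; ring_nf
  have e4 : Real.exp (-(r * ħ * (weightInt n₁ n₂ b + 1)))
      = Real.exp (-(r * ħ * weightInt n₁ n₂ b)) * Real.exp (-(r * ħ)) := by
    rw [← Real.exp_add]; ring_nf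
  rw [Real.cosh_eq, Real.cosh_eq, e1, e2, e3, e4]
  field_simp
  ring

theorem diagonal_mul_weightProj (f : ℤ → ℂ) (M : ℕ) :
    (Matrix.diagonal fun b => f (weightInt n₁ n₂ b)) * weightProj n₁ n₂ M
      = f (2 * M - (n₁ + n₂)) • weightProj n₁ n₂ M := by
  rw [weightProj, Matrix.diagonal_mul_diagonal, ← Matrix.diagonal_smul]
  congr 1
  ext b
  simp only [Pi.smul_apply, smul_eq_mul]
  split_ifs with h
  · rw [weightInt, ← h]
    push_cast
    rfl
  · simp

theorem trace_weightProj (M : ℕ) :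
    (weightProj n₁ n₂ M).trace = levelSum n₁ n₂ (fun _ => 1) M := by
  rw [weightProj, Matrix.trace_diagonal, levelSum]

/-- Induction upwards from the lowest weight space. The trace obeys the recursion of
`trace_aeval_mul_eq`, the crystal sum that of `levelSum_succ`, and the two coincide. -/
theorem trace_aeval_coshCasimir_mul_weightProj (hr : r ≠ 0) (hħ : ħ ≠ 0) (p : ℂ[X]) (M : ℕ) :
    (aeval (coshCasimir r ħ n₁ n₂) p * weightProj n₁ n₂ M).trace
      = levelSum n₁ n₂ (fun h => p.eval ((Real.cosh (r * ħ * (h + 1)) : ℝ) : ℂ)) M := by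
  set c : ℂ := ((r * (Real.exp (r * ħ) - Real.exp (-(r * ħ))) / ħ : ℝ) : ℂ) with hc
  have hEF := diagonal_mul_weightProj (n₁ := n₁) (n₂ := n₂)
    fun w => ((Real.cosh (r * ħ * (w - 1)) : ℝ) : ℂ)
  have hFE := diagonal_mul_weightProj (n₁ := n₁) (n₂ := n₂)
    fun w => ((Real.cosh (r * ħ * (w + 1)) : ℝ) : ℂ)
  induction M with
  | zero =>
    set P := weightProj n₁ n₂ 0 with hP
    set T := coshCasimir r ħ n₁ n₂ with hT
    -- `F` kills the lowest weight space, so the `EF` form is scalar there; evenness of `cosh`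
    -- replaces `-(n₁ + n₂) - 1` by `n₁ + n₂ + 1`.
    have h1 : T * P = ((Real.cosh (r * ħ * ((n₁ + n₂ : ℤ) + 1)) : ℝ) : ℂ) • P := by
      rw [hT, coshCasimir_eq_EF hr hħ, add_mul, hEF, smul_mul_assoc, mul_assoc,
        F_mul_weightProj_zero, mul_zero, smul_zero, zero_add, ← Real.cosh_neg]
      congr 4
      push_cast
      ring
    have h2 : ∀ p : ℂ[X], aeval T p * P
        = p.eval ((Real.cosh (r * ħ * ((n₁ + n₂ : ℤ) + 1)) : ℝ) : ℂ) • P := by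
      intro p
      induction p using Polynomial.induction_on with
      | C a => rw [aeval_C, eval_C, Algebra.algebraMap_eq_smul_one, smul_one_mul]
      | add p q hp hq => rw [map_add, add_mul, hp, hq, eval_add, add_smul]
      | monomial k a ih =>
        rw [pow_succ, ← mul_assoc, map_mul, aeval_X, mul_assoc, h1, mul_smul_comm, ih, smul_smul,
          eval_mul (q := Polynomial.X), eval_X, mul_comm]
    rw [h2, Matrix.trace_smul, trace_weightProj, levelSum_zero, levelSum_zero, smul_eq_mul,
      mul_one]
  | succ M ih =>
    -- Evenness of `cosh` again: the scalar at weight `w` depends on `|w + 1|`, that is, on the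
    -- highest weight of the string that begins or ends there.
    have ht : Real.cosh (r * ħ * ((2 * M - (n₁ + n₂) : ℤ) + 1))
        = Real.cosh (r * ħ * ((|2 * (M : ℤ) - (n₁ + n₂) + 1| - 1 : ℤ) + 1)) := by
      push_cast
      rw [sub_add_cancel]
      rcases abs_cases (2 * (M : ℝ) - (n₁ + n₂) + 1) with h | h
      · rw [h.1]
      · rw [h.1, mul_neg, Real.cosh_neg]
    rw [trace_aeval_mul_eq (U := c • tensorTuple r ħ n₁ n₂ .E) (V := tensorTuple r ħ n₁ n₂ .F)
      (t := ((Real.cosh (r * ħ * ((2 * M - (n₁ + n₂) : ℤ) + 1)) : ℝ) : ℂ))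
      (P := weightProj n₁ n₂ M), ih, levelSum_succ, trace_weightProj, trace_weightProj, ht, mul_comm
        (eval _ p)]
    · rw [mul_smul_comm, smul_mul_assoc, weightProj_succ_mul_E]
    · exact F_mul_weightProj_succ M
    · rw [coshCasimir_eq_FE hr hħ, add_mul, hFE, mul_smul_comm]
    · simp only [coshCasimir_eq_EF hr hħ, add_mul, hEF, smul_mul_assoc]
      congr 4
      push_cast
      ring

theorem aeval_diagonal (d : ι → ℂ) (p : ℂ[X]) :
    aeval (Matrix.diagonal d) p = Matrix.diagonal fun i => p.eval (d i) := by
  have h := aeval_algHom_apply (Matrix.diagonalAlgHom (n := ι) (α := ℂ) ℂ) d p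
  have h' : aeval d p = fun i => p.eval (d i) := by
    ext i
    simp [coe_aeval_eq_eval]
  rw [h'] at h
  exact h

theorem trace_aeval_coshCasimir_mul_aeval_H (hr : r ≠ 0) (hħ : ħ ≠ 0) (p ψ : ℂ[X]) :
    (aeval (coshCasimir r ħ n₁ n₂) p * aeval (tensorTuple r ħ n₁ n₂ .H) ψ).trace
      = ∑ b : Crystal n₁ × Crystal n₂,
        p.eval ((Real.cosh (r * ħ * (highestInt n₁ n₂ b.1 b.2 + 1)) : ℝ) : ℂ) *
          ψ.eval ((ħ * weightInt n₁ n₂ b : ℝ) : ℂ) := by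
  have h1 : aeval (tensorTuple r ħ n₁ n₂ .H) ψ = ∑ M ∈ Finset.range (n₁ + n₂ + 1),
      ψ.eval ((ħ * ((2 * M - (n₁ + n₂) : ℤ) : ℝ) : ℝ) : ℂ) • weightProj n₁ n₂ M := by
    have h2 : (1 : Matrix (Fin (n₁ + 1) × Fin (n₂ + 1)) (Fin (n₁ + 1) × Fin (n₂ + 1)) ℂ)
        = ∑ M ∈ Finset.range (n₁ + n₂ + 1), weightProj n₁ n₂ M := by
      ext a b
      rw [Matrix.sum_apply]
      by_cases hab : a = b
      · subst hab
        have ha := a.1.2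
        have ha' := a.2.2
        simp only [weightProj, Matrix.diagonal_apply_eq, Matrix.one_apply_eq]
        rw [Finset.sum_ite_eq, if_pos (Finset.mem_range.2 (by omega))]
      · simp only [weightProj, Matrix.diagonal_apply_ne _ hab, Matrix.one_apply_ne hab,
          Finset.sum_const_zero]
    rw [tensorTuple_H, aeval_diagonal, ← mul_one (Matrix.diagonal _), h2, Finset.mul_sum]
    refine Finset.sum_congr rfl fun M _ => ?_
    exact diagonal_mul_weightProj (fun w => ψ.eval ((ħ * (w : ℝ) : ℝ) : ℂ)) M
  rw [h1, Finset.mul_sum, Matrix.trace_sum]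
  simp only [mul_smul_comm, Matrix.trace_smul, trace_aeval_coshCasimir_mul_weightProj hr hħ,
    levelSum, Finset.smul_sum]
  rw [Finset.sum_comm]
  refine Finset.sum_congr rfl fun b _ => ?_
  have hb := b.1.2
  have hb' := b.2.2
  simp only [smul_ite, smul_zero]
  rw [Finset.sum_ite_eq, if_pos (Finset.mem_range.2 (by omega)), smul_eq_mul, mul_comm, weightInt]
  push_cast
  rfl

theorem isSelfAdjoint_coshCasimir (hr : r ≠ 0) (hħ : ħ ≠ 0) :
    IsSelfAdjoint (coshCasimir r ħ n₁ n₂) := by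
  rw [isSelfAdjoint_iff, Matrix.star_eq_conjTranspose, coshCasimir_eq_EF hr hħ,
    Matrix.conjTranspose_add, Matrix.conjTranspose_smul, Matrix.conjTranspose_mul,
    Matrix.diagonal_conjTranspose, tensorTuple_F_eq_conjTranspose,
    Matrix.conjTranspose_conjTranspose, Complex.star_def, Complex.conj_ofReal]
  congr 2
  ext b
  exact Complex.conj_ofReal _

theorem exists_polynomial_eval_eq {s : Set ℝ} (hs : s.Finite) (f : ℝ → ℝ) :
    ∃ p : ℝ[X], ∀ x ∈ s, p.eval x = f x :=
  ⟨Lagrange.interpolate hs.toFinset id f, fun _ hx =>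
    Lagrange.eval_interpolate_at_node (v := id) f Function.injective_id.injOn
      (hs.mem_toFinset.2 hx)⟩

theorem trace_aeval_lambdaOp_mul_aeval_H (hr : 0 < r) (hħ : 0 < ħ) (φ ψ : ℂ[X]) :
    (aeval (lambdaOp r ħ n₁ n₂) φ * aeval (tensorTuple r ħ n₁ n₂ .H) ψ).trace
      = ∑ b : Crystal n₁ × Crystal n₂,
        φ.eval ((ħ * highestInt n₁ n₂ b.1 b.2 : ℝ) : ℂ) *
          ψ.eval ((ħ * weightInt n₁ n₂ b : ℝ) : ℂ) := by
  -- A polynomial replaces the functional calculus. It is interpolated on the spectrum of the matrix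
  -- and also on the values predicted by the crystal, so the spectrum need not be identified.
  obtain ⟨p, hp⟩ := exists_polynomial_eval_eq
    ((Matrix.finite_real_spectrum (A := coshCasimir r ħ n₁ n₂)).union
      (Set.finite_range fun b : Crystal n₁ × Crystal n₂ =>
        Real.cosh (r * ħ * (highestInt n₁ n₂ b.1 b.2 + 1))))
    fun x => Real.arcosh x / r - ħ
  have h1 : lambdaOp r ħ n₁ n₂
      = aeval (coshCasimir r ħ n₁ n₂) (p.map (algebraMap ℝ ℂ)) := by
    rw [aeval_map_algebraMap,
      ← cfc_polynomial p _ (isSelfAdjoint_coshCasimir hr.ne' hħ.ne')]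
    exact cfc_congr fun x hx => (hp x (.inl hx)).symm
  rw [h1, ← aeval_comp, trace_aeval_coshCasimir_mul_aeval_H hr.ne' hħ.ne']
  refine Finset.sum_congr rfl fun b _ => ?_
  have h2 : (0 : ℝ) ≤ highestInt n₁ n₂ b.1 b.2 := by exact_mod_cast zero_le_highestInt n₁ n₂ b
  rw [eval_comp, eval_map_algebraMap, ← Complex.coe_algebraMap, aeval_algebraMap_apply,
    coe_aeval_eq_eval, hp _ (.inr ⟨b, rfl⟩), Real.arcosh_cosh (by positivity),
    Complex.coe_algebraMap]
  congr 3
  field_simp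
  ring

/-- An exact equality, with no limit taken: the quantum corner does not depend on `r > 0`. -/
theorem quantumCorner_eq_crystalCorner (Λ₁ Λ₂ : ℝ) (φ ψ : ℂ[X]) (hr : 0 < r) (hħ : 0 < ħ) :
    quantumCorner Λ₁ Λ₂ φ ψ r ħ = crystalCorner Λ₁ Λ₂ φ ψ ħ := by
  rw [quantumCorner, crystalCorner, repTensor_gen, trace_aeval_lambdaOp_mul_aeval_H hr hħ]
  simp only [tensorHw_eq hħ, tensorWt_eq]

end TraceIdentity

/-! ### The limits of the crystal sums and of the classical expectations -/

section Square

theorem continuous_contHw (Λ₁ Λ₂ : ℝ) :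
    Continuous fun z : ℝ × ℝ => contHw Λ₁ Λ₂ (Λ₁ * (2 * z.1 - 1)) (Λ₂ * (2 * z.2 - 1)) := by
  unfold contHw
  fun_prop

/-- The first argument of `G` carries an explicit dependence on `ħ`, needed for the shift in `cosh
(r (hw + ħ))`. -/
theorem tendsto_crystal_average {G : ℝ × ℝ × ℝ → ℂ} (hG : Continuous G) {Λ₁ Λ₂ : ℝ}
    (hΛ₁ : 0 < Λ₁) (hΛ₂ : 0 < Λ₂) :
    Tendsto (fun ħ => (∑ b : Crystal (level Λ₁ ħ) × Crystal (level Λ₂ ħ),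
        G (ħ, tensorHw ħ (level Λ₁ ħ) (level Λ₂ ħ) b, tensorWt ħ (level Λ₁ ħ) (level Λ₂ ħ) b)) /
        (((level Λ₁ ħ : ℂ) + 1) * ((level Λ₂ ħ : ℂ) + 1))) (𝓝[>] 0)
      (𝓝 (∫ s in (0 : ℝ)..1, ∫ t in (0 : ℝ)..1,
        G (0, contHw Λ₁ Λ₂ (Λ₁ * (2 * s - 1)) (Λ₂ * (2 * t - 1)),
          Λ₁ * (2 * s - 1) + Λ₂ * (2 * t - 1)))) := by
  have h := tendsto_average₂ (P := ℝ × ℝ × ℝ)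
    (Φ := fun z => G (z.1.1, contHw z.1.2.1 z.1.2.2 z.2.1 z.2.2, z.2.1 + z.2.2))
    -- At finite `ħ` the highest weight rule involves `Λᵢ^ħ` rather than `Λᵢ`; these are passed as
    -- convergent parameters.
    (p := fun ħ => (ħ, ħ * level Λ₁ ħ, ħ * level Λ₂ ħ)) (p₀ := (0, Λ₁, Λ₂))
    (hG.comp (by unfold contHw; fun_prop))
    ((tendsto_nhdsWithin_of_tendsto_nhds tendsto_id).prodMk_nhds
      ((tendsto_level hΛ₁).prodMk_nhds (tendsto_level hΛ₂))) hΛ₁ hΛ₂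
  refine h.congr' ?_
  filter_upwards [self_mem_nhdsWithin] with ħ hħ
  congr 1
  refine Finset.sum_congr rfl fun b _ => ?_
  rw [tensorHw_eq hħ, highestInt_real ħ hħ]
  rfl

theorem integral_mul_two_sub_one {Λ : ℝ} (hΛ : Λ ≠ 0) (f : ℝ → ℂ) :
    ∫ t in (0 : ℝ)..1, f (Λ * (2 * t - 1)) = ((1 / (2 * Λ) : ℝ) : ℂ) * ∫ x in (-Λ)..Λ, f x := by
  have h := intervalIntegral.integral_comp_mul_sub (a := 0) (b := 1) (c := 2 * Λ) f
    (mul_ne_zero two_ne_zero hΛ) Λ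
  rw [mul_zero, zero_sub, mul_one, two_mul, add_sub_cancel_right, ← two_mul] at h
  rw [← Complex.real_smul, one_div, ← h]
  congr 1
  ext t
  ring_nf

theorem continuousCorner_eq {Λ₁ Λ₂ : ℝ} (hΛ₁ : 0 < Λ₁) (hΛ₂ : 0 < Λ₂) (φ ψ : ℂ[X]) :
    continuousCorner Λ₁ Λ₂ φ ψ = ∫ s in (0 : ℝ)..1, ∫ t in (0 : ℝ)..1,
      φ.eval (contHw Λ₁ Λ₂ (Λ₁ * (2 * s - 1)) (Λ₂ * (2 * t - 1)) : ℂ) *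
        ψ.eval ((Λ₁ * (2 * s - 1) + Λ₂ * (2 * t - 1) : ℝ) : ℂ) := by
  have h := fun μ₁ : ℝ => integral_mul_two_sub_one hΛ₂.ne'
    fun μ₂ => φ.eval (contHw Λ₁ Λ₂ μ₁ μ₂ : ℂ) * ψ.eval ((μ₁ + μ₂ : ℝ) : ℂ)
  simp only [h]
  rw [intervalIntegral.integral_const_mul, integral_mul_two_sub_one hΛ₁.ne'
    fun μ₁ => ∫ μ₂ in (-Λ₂)..Λ₂, φ.eval (contHw Λ₁ Λ₂ μ₁ μ₂ : ℂ) * ψ.eval ((μ₁ + μ₂ : ℝ) : ℂ),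
    continuousCorner, ← mul_assoc]
  congr 1
  push_cast
  ring

theorem tendsto_crystalCorner {Λ₁ Λ₂ : ℝ} (hΛ₁ : 0 < Λ₁) (hΛ₂ : 0 < Λ₂) (φ ψ : ℂ[X]) :
    Tendsto (crystalCorner Λ₁ Λ₂ φ ψ) (𝓝[>] 0) (𝓝 (continuousCorner Λ₁ Λ₂ φ ψ)) := by
  rw [continuousCorner_eq hΛ₁ hΛ₂]
  exact tendsto_crystal_average
    (G := fun z => φ.eval ((z.2.1 : ℝ) : ℂ) * ψ.eval ((z.2.2 : ℝ) : ℂ)) (by fun_prop) hΛ₁ hΛ₂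

/-- The coefficient `e^{sħ}`. -/
noncomputable def planckExp (s : ℝ) : planckRing :=
  ⟨fun t => ((Real.exp (s * t) : ℝ) : ℂ), by
    have h1 : ContDiff ℝ ((⊤ : ℕ∞) : WithTop ℕ∞) (fun t : ℝ => Real.exp (s * t)) := by fun_prop
    exact (Complex.ofRealCLM.contDiff.comp h1).contDiffAt⟩

/-- The coefficient `r (e^{rħ} - e^{-rħ}) / ħ`, with value `2 r²` at `ħ = 0`. -/
noncomputable def planckQuot (r : ℝ) : planckRing :=
  ⟨dslope (fun t : ℝ => ((r * (Real.exp (r * t) - Real.exp (-(r * t))) : ℝ) : ℂ)) 0, by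
    -- Analyticity of the numerator, which vanishes at zero, makes the slope with its singularity
    -- removed analytic, hence smooth.
    have h1 : AnalyticAt ℝ (fun t : ℝ => r * (Real.exp (r * t) - Real.exp (-(r * t)))) 0 := by
      fun_prop
    have h2 : AnalyticAt ℝ
        (fun t : ℝ => ((r * (Real.exp (r * t) - Real.exp (-(r * t))) : ℝ) : ℂ)) 0 :=
      (Complex.ofRealCLM.analyticAt _).comp h1
    obtain ⟨p, hp⟩ := h2
    change ContDiffAt ℝ ((⊤ : ℕ∞) : WithTop ℕ∞) _ 0
    exact hp.has_fpower_series_dslope_fslope.analyticAt.contDiffAt⟩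

theorem evalPlanck_planckQuot {ħ : ℝ} (hħ : ħ ≠ 0) (r : ℝ) : evalPlanck ħ (planckQuot r)
    = ((r * (Real.exp (r * ħ) - Real.exp (-(r * ħ))) / ħ : ℝ) : ℂ) := by
  change dslope _ _ _ = _
  rw [dslope_of_ne _ hħ, slope_def_module]
  simp only [mul_zero, neg_zero, sub_self, Complex.ofReal_zero, sub_zero, Complex.real_smul]
  rw [← Complex.ofReal_mul]
  congr 1
  ring

theorem evalPlanck_zero_planckQuot (r : ℝ) : evalPlanck 0 (planckQuot r) = ((2 * r ^ 2 : ℝ) : ℂ) := by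
  change dslope _ _ _ = _
  rw [dslope_same]
  have h1 : HasDerivAt (fun t : ℝ => r * (Real.exp (r * t) - Real.exp (-(r * t)))) (2 * r ^ 2) 0 := by
    have ha : HasDerivAt (fun t : ℝ => r * t) r 0 := by
      simpa using (hasDerivAt_id (0 : ℝ)).const_mul r
    refine ((ha.exp.sub ha.neg.exp).const_mul r).congr_deriv ?_
    simp only [mul_zero, Pi.neg_apply, neg_zero, Real.exp_zero]
    ring
  exact h1.ofReal_comp.deriv

/-- The observable `(sinh (rħ) / (rħ)) C^{r,ħ}`. -/
noncomputable def coshObs (r : ℝ) : Observable r :=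
  planckQuot r • (gen r planckVar (planckQ r) .E * gen r planckVar (planckQ r) .F) +
    algebraMap ℂ planckRing ((1 / 2 : ℝ) : ℂ) •
      (planckExp r • (gen r planckVar (planckQ r) .k * gen r planckVar (planckQ r) .k) +
      planckExp (-r) • (gen r planckVar (planckQ r) .kInv * gen r planckVar (planckQ r) .kInv))

theorem obsMat₂_coshObs {r ħ : ℝ} (hr : r ≠ 0) (hħ : ħ ≠ 0) (n₁ n₂ : ℕ) :
    obsMat₂ r ħ n₁ n₂ (coshObs r) = coshCasimir r ħ n₁ n₂ := by
  rw [coshCasimir_eq_EF hr hħ, diagonal_cosh_eq, coshObs]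
  simp only [map_add, obsMat₂_smul, map_mul, obsMat₂_gen, evalPlanck_planckQuot hħ]
  have h1 : ∀ c : ℂ, evalPlanck ħ (algebraMap ℂ planckRing c) = c := fun _ => rfl
  have h2 : ∀ s, evalPlanck ħ (planckExp s) = ((Real.exp (s * ħ) : ℝ) : ℂ) := fun _ => rfl
  rw [h1, h2, h2, neg_mul]

theorem modHbar_coshObs (r : ℝ) : modHbar r (coshObs r) = fun g => (coshParam r g : ℂ) := by
  have h1 : ∀ c : ℂ, evalPlanck 0 (algebraMap ℂ planckRing c) = c := fun _ => rfl
  have h2 : ∀ s, evalPlanck 0 (planckExp s) = ((Real.exp (s * 0) : ℝ) : ℂ) := fun _ => rfl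
  rw [coshObs]
  simp only [map_add, modHbar_smul, map_mul, modHbar_gen, evalPlanck_zero_planckQuot, h1, h2]
  ext g
  simp only [coordTuple, coshParam, Pi.add_apply, Pi.smul_apply, Pi.mul_apply, smul_eq_mul,
    Real.cosh_eq, mul_zero, Real.exp_zero, Complex.ofReal_one,
    one_mul, ← Complex.ofReal_mul, ← Real.exp_add, ← neg_add, add_halves]
  push_cast
  rw [Complex.normSq_eq_conj_mul_self]
  ring

/-- The value of a polynomial at the observable `H`. -/
noncomputable def polyObs (r : ℝ) (ψ : ℂ[X]) : Observable r :=
  ∑ j ∈ Finset.range (ψ.natDegree + 1),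
    algebraMap ℂ planckRing (ψ.coeff j) • gen r planckVar (planckQ r) .H ^ j

theorem obsMat₂_polyObs (r ħ : ℝ) (n₁ n₂ : ℕ) (ψ : ℂ[X]) :
    obsMat₂ r ħ n₁ n₂ (polyObs r ψ) = aeval (tensorTuple r ħ n₁ n₂ .H) ψ := by
  rw [polyObs, aeval_eq_sum_range, map_sum]
  simp only [obsMat₂_smul, map_pow, obsMat₂_gen]
  rfl

theorem modHbar_polyObs (r : ℝ) (ψ : ℂ[X]) :
    modHbar r (polyObs r ψ) = fun g => ψ.eval (g.1 : ℂ) := by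
  ext g
  rw [polyObs, eval_eq_sum_range, map_sum, Finset.sum_apply]
  simp only [modHbar_smul, map_pow, modHbar_gen]
  rfl

theorem kInv_mul_kInv_mul_k_mul_k (r ħ : ℝ) (n₁ n₂ : ℕ) :
    repTensor r ħ n₁ n₂ (qNegH r ħ) * (obsMat₂ r ħ n₁ n₂
      (gen r planckVar (planckQ r) .k * gen r planckVar (planckQ r) .k)) = 1 := by
  rw [qNegH, map_mul, map_mul, repTensor_gen, obsMat₂_gen, tensorTuple_k_mul_k,
    tensorTuple_kInv_mul_kInv, Matrix.diagonal_mul_diagonal, ← Matrix.diagonal_one]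
  congr 1
  ext b
  rw [← Complex.ofReal_mul, ← Real.exp_add, add_neg_cancel, Real.exp_zero, Complex.ofReal_one]

/-- `K` cancels `q^{-H}`, so a quotient of two weighted traces is an ordinary normalized trace. This
is the origin of the factor `e^{-rH}` in the classical corner. -/
theorem weightedTrace₂_k_mul_k_mul (r Λ₁ Λ₂ ħ : ℝ) (𝓕 : Observable r) :
    weightedTrace₂ r Λ₁ Λ₂
        (gen r planckVar (planckQ r) .k * gen r planckVar (planckQ r) .k * 𝓕) ħ
      = (obsMat₂ r ħ (level Λ₁ ħ) (level Λ₂ ħ) 𝓕).trace /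
          (((level Λ₁ ħ : ℂ) + 1) * ((level Λ₂ ħ : ℂ) + 1)) *
        weightedTrace₂ r Λ₁ Λ₂
          (gen r planckVar (planckQ r) .k * gen r planckVar (planckQ r) .k) ħ := by
  have h0 : ((level Λ₁ ħ : ℂ) + 1) * ((level Λ₂ ħ : ℂ) + 1) ≠ 0 :=
    mul_ne_zero (Nat.cast_add_one_ne_zero _) (Nat.cast_add_one_ne_zero _)
  have h1 : ∀ 𝓖 : Observable r, weightedTrace₂ r Λ₁ Λ₂ 𝓖 ħ
      = (repTensor r ħ (level Λ₁ ħ) (level Λ₂ ħ) (qNegH r ħ) *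
          obsMat₂ r ħ (level Λ₁ ħ) (level Λ₂ ħ) 𝓖).trace /
        (repTensor r ħ (level Λ₁ ħ) (level Λ₂ ħ) (qNegH r ħ)).trace := fun 𝓖 => by
    rw [weightedTrace₂, map_mul]
    rfl
  rw [h1, h1, map_mul _ _ 𝓕, ← mul_assoc, kInv_mul_kInv_mul_k_mul_k, one_mul, Matrix.trace_one]
  simp only [Fintype.card_prod, Fintype.card_fin, Nat.cast_mul, Nat.cast_add, Nat.cast_one]
  rw [div_mul_div_cancel₀ h0]

/-! ### The classical expectations, from the exact quantum identity -/

variable {Ω : Type*} [MeasurableSpace Ω] {P : Measure Ω} [IsProbabilityMeasure P]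
  {g₁ g₂ : Ω → SU2Star} {r Λ₁ Λ₂ : ℝ}

/-- Uniqueness of limits: the weighted trace of `K` times the observable tends to the left side by
the two-orbit theorem. By the trace identity it equals a crystal average times the weighted trace of
`K`, which tends to the right side. -/
theorem integral_coshParam_pow_mul (hr : 0 < r) (hΛ₁ : 0 < Λ₁) (hΛ₂ : 0 < Λ₂)
    (h₁ : HasLaw g₁ (uniformOrbit r Λ₁) P) (h₂ : HasLaw g₂ (uniformOrbit r Λ₂) P)
    (hind : IndepFun g₁ g₂ P) (ψ : ℂ[X]) (m : ℕ) :
    ∫ ω, (coshParam r (starMul r (g₁ ω) (g₂ ω)) : ℂ) ^ m *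
        (((Real.exp (-(r * (starMul r (g₁ ω) (g₂ ω)).1)) : ℝ) : ℂ) *
          ψ.eval ((starMul r (g₁ ω) (g₂ ω)).1 : ℂ)) ∂P
      = (∫ s in (0 : ℝ)..1, ∫ t in (0 : ℝ)..1,
          ((Real.cosh (r * contHw Λ₁ Λ₂ (Λ₁ * (2 * s - 1)) (Λ₂ * (2 * t - 1))) : ℝ) : ℂ) ^ m *
          ψ.eval ((Λ₁ * (2 * s - 1) + Λ₂ * (2 * t - 1) : ℝ) : ℂ)) *
        ∫ ω, ((Real.exp (-(r * (starMul r (g₁ ω) (g₂ ω)).1)) : ℝ) : ℂ) ∂P := by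
  set x := gen r planckVar (planckQ r) with hx
  have hk : modHbar r (x .k * x .k) = fun g => ((Real.exp (-(r * g.1)) : ℝ) : ℂ) := by
    ext g
    rw [map_mul, hx, modHbar_gen, Pi.mul_apply, coordTuple, ← Complex.ofReal_mul, ← Real.exp_add,
      ← neg_add, add_halves]
  have l1 := tendsto_weightedTrace₂ hr.le hΛ₁ hΛ₂ h₁ h₂ hind
    (x .k * x .k * (coshObs r ^ m * polyObs r ψ))
  have l2 := tendsto_weightedTrace₂ hr.le hΛ₁ hΛ₂ h₁ h₂ hind (x .k * x .k)
  -- The Casimir takes the value `cosh (r (hw + ħ))` on the crystal; the shift by `ħ` disappears in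
  -- the limit.
  have l3 := tendsto_crystal_average
    (G := fun z => ((Real.cosh (r * (z.2.1 + z.1)) : ℝ) : ℂ) ^ m * ψ.eval ((z.2.2 : ℝ) : ℂ))
    (by have := Real.continuous_cosh; fun_prop) hΛ₁ hΛ₂
  rw [map_mul _ _ (coshObs r ^ m * polyObs r ψ), hk, map_mul, map_pow, modHbar_coshObs,
    modHbar_polyObs] at l1
  rw [hk] at l2
  simp only [add_zero] at l3
  refine (integral_congr_ae (.of_forall fun ω => ?_)).trans
    (tendsto_nhds_unique l1 ((l3.mul l2).congr' ?_))
  · simp only [Pi.mul_apply, Pi.pow_apply]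
    ring
  · filter_upwards [self_mem_nhdsWithin] with ħ hħ
    have hħ' : (0 : ℝ) < ħ := hħ
    rw [weightedTrace₂_k_mul_k_mul, map_mul _ (coshObs r ^ m), map_pow,
      obsMat₂_coshObs hr.ne' hħ'.ne', obsMat₂_polyObs]
    have := trace_aeval_coshCasimir_mul_aeval_H (n₁ := level Λ₁ ħ) (n₂ := level Λ₂ ħ) hr.ne'
      hħ'.ne' (Polynomial.X ^ m) ψ
    rw [map_pow, aeval_X] at this
    rw [this]
    congr 2
    refine Finset.sum_congr rfl fun b _ => ?_
    rw [tensorHw_eq hħ', tensorWt_eq, eval_pow, eval_X, mul_assoc r, mul_add ħ, mul_one]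

/-- If both entries of the maximum were negative, `μ₂ ≥ -Λ₂` would give `Λ₁ < Λ₂` and `μ₁ ≤ Λ₁` the
reverse. Nonnegativity lets `arcosh` undo `cosh`. -/
theorem contHw_nonneg (hΛ₁ : 0 < Λ₁) (hΛ₂ : 0 < Λ₂) {s t : ℝ} (hs : s ∈ Set.Icc (0 : ℝ) 1)
    (ht : t ∈ Set.Icc (0 : ℝ) 1) : 0 ≤ contHw Λ₁ Λ₂ (Λ₁ * (2 * s - 1)) (Λ₂ * (2 * t - 1)) := by
  rw [contHw, le_max_iff]
  by_contra! h
  nlinarith [mul_nonneg hΛ₁.le (sub_nonneg.2 hs.2), mul_nonneg hΛ₂.le ht.1]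

theorem continuous_orbitParam (hr : 0 < r) : Continuous (orbitParam r) := by
  have h : orbitParam r = fun g => Real.arcosh (coshParam r g) / r :=
    funext (orbitParam_eq hr)
  rw [h]
  exact (Real.continuousOn_arcosh.comp_continuous (continuous_coshParam r)
    (one_le_coshParam r)).div_const r

theorem continuous_crystalObservable (hr : 0 < r) (φ ψ : ℂ[X]) :
    Continuous (crystalObservable φ ψ r) := by
  have h := continuous_orbitParam hr
  unfold crystalObservable
  fun_prop

theorem integrableOn_unitSquare {f : ℝ × ℝ → ℂ} (hf : Continuous f) :
    IntegrableOn f (Set.Ioc (0 : ℝ) 1 ×ˢ Set.Ioc (0 : ℝ) 1) :=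
  (hf.continuousOn.integrableOn_compact (isCompact_Icc.prod isCompact_Icc)).mono_set
    (Set.prod_mono Set.Ioc_subset_Icc_self Set.Ioc_subset_Icc_self)

theorem setIntegral_unitSquare {f : ℝ × ℝ → ℂ} (hf : Continuous f) :
    ∫ z in Set.Ioc (0 : ℝ) 1 ×ˢ Set.Ioc (0 : ℝ) 1, f z
      = ∫ s in (0 : ℝ)..1, ∫ t in (0 : ℝ)..1, f (s, t) := by
  simp only [intervalIntegral.integral_of_le zero_le_one]
  exact setIntegral_prod f (integrableOn_unitSquare hf)

/-- The moments of `cosh (r Λ(g))`, weighted by `e^{-rH} ψ(H)`, match those of `cosh (r hw)` on the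
square. Both variables are bounded, so integrals of continuous functions match too, in particular of
powers of `arcosh / r`, which recover `Λ(g)` and `hw`. -/
theorem integral_crystalObservable (hr : 0 < r) (hΛ₁ : 0 < Λ₁) (hΛ₂ : 0 < Λ₂)
    (h₁ : HasLaw g₁ (uniformOrbit r Λ₁) P) (h₂ : HasLaw g₂ (uniformOrbit r Λ₂) P)
    (hind : IndepFun g₁ g₂ P) (φ ψ : ℂ[X]) :
    ∫ ω, crystalObservable φ ψ r (starMul r (g₁ ω) (g₂ ω)) ∂P
      = continuousCorner Λ₁ Λ₂ φ ψ *
        ∫ ω, crystalObservable 1 1 r (starMul r (g₁ ω) (g₂ ω)) ∂P := by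
  set Z := ∫ ω, crystalObservable 1 1 r (starMul r (g₁ ω) (g₂ ω)) ∂P with hZ
  have hZ' : Z = ∫ ω, ((Real.exp (-(r * (starMul r (g₁ ω) (g₂ ω)).1)) : ℝ) : ℂ) ∂P := by
    simp only [hZ, crystalObservable, eval_one, mul_one]
  have hcont := continuous_contHw Λ₁ Λ₂
  have hwt : Continuous fun z : ℝ × ℝ => Λ₁ * (2 * z.1 - 1) + Λ₂ * (2 * z.2 - 1) := by fun_prop
  set S := Set.Ioc (0 : ℝ) 1 ×ˢ Set.Ioc (0 : ℝ) 1 with hS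
  set hw : ℝ × ℝ → ℝ := fun z => contHw Λ₁ Λ₂ (Λ₁ * (2 * z.1 - 1)) (Λ₂ * (2 * z.2 - 1)) with hhw
  set wt : ℝ × ℝ → ℝ := fun z => Λ₁ * (2 * z.1 - 1) + Λ₂ * (2 * z.2 - 1) with hwtdef
  have hSm : MeasurableSet S := measurableSet_Ioc.prod measurableSet_Ioc
  have hcosh : Continuous fun z => Real.cosh (r * hw z) :=
    Real.continuous_cosh.comp (continuous_const.mul hcont)
  have hpsi : Continuous fun g : SU2Star =>
      ((Real.exp (-(r * g.1)) : ℝ) : ℂ) * ψ.eval (g.1 : ℂ) := by fun_prop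
  -- Truncation at `1` gives continuity on the whole line; it has no effect, both variables being at
  -- least `1`.
  have hu : Continuous fun x : ℝ => Real.arcosh (max x 1) / r :=
    (Real.continuousOn_arcosh.comp_continuous (by fun_prop) fun x => le_max_right x 1).div_const r
  obtain ⟨K, hK, hmem⟩ := exists_compact_starMul r Λ₁ Λ₂
  obtain ⟨A, hA⟩ := (hK.image (continuous_coshParam r)).bddAbove
  obtain ⟨B, hB⟩ :=
    (((isCompact_Icc (a := (0 : ℝ)) (b := 1)).prod (isCompact_Icc (a := (0 : ℝ)) (b := 1))).image
      hcosh).bddAbove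
  have hSub : S ⊆ Set.Icc (0 : ℝ) 1 ×ˢ Set.Icc (0 : ℝ) 1 :=
    Set.prod_mono Set.Ioc_subset_Icc_self Set.Ioc_subset_Icc_self
  have key : ∀ j : ℕ, ∫ ω, (((Real.arcosh (max (coshParam r (starMul r (g₁ ω) (g₂ ω))) 1) / r) ^ j
        : ℝ) : ℂ) * (((Real.exp (-(r * (starMul r (g₁ ω) (g₂ ω)).1)) : ℝ) : ℂ) *
          ψ.eval ((starMul r (g₁ ω) (g₂ ω)).1 : ℂ)) ∂P
      = ∫ z in S, (((Real.arcosh (max (Real.cosh (r * hw z)) 1) / r) ^ j : ℝ) : ℂ) *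
          (ψ.eval ((wt z : ℝ) : ℂ) * Z) := fun j => by
    refine integral_comp_eq_of_moments (A := 1) (B := max A B)
      (u := fun x => (Real.arcosh (max x 1) / r) ^ j)
      ((continuous_coshParam r).measurable.comp_aemeasurable (aemeasurable_starMul h₁ h₂))
      (integrable_comp_starMul h₁ h₂ hpsi) hcosh.aemeasurable
      (integrableOn_unitSquare (by fun_prop)) ?_ ?_ (fun m => ?_) (hu.pow j)
    · filter_upwards [ae_mem_dressingOrbit_of_hasLaw h₁, ae_mem_dressingOrbit_of_hasLaw h₂]
        with ω k1 k2
      exact ⟨one_le_coshParam r _,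
        (hA ⟨_, hmem _ k1 _ k2, rfl⟩).trans (le_max_left _ _)⟩
    · filter_upwards [ae_restrict_mem hSm] with z hz
      exact ⟨Real.one_le_cosh _, (hB ⟨_, hSub hz, rfl⟩).trans (le_max_right _ _)⟩
    · simp only [Function.comp_apply]
      rw [integral_coshParam_pow_mul hr hΛ₁ hΛ₂ h₁ h₂ hind, ← hZ', setIntegral_unitSquare
        (by fun_prop), ← intervalIntegral.integral_mul_const]
      simp only [← intervalIntegral.integral_mul_const, mul_assoc]
      rfl
  have main : ∫ ω, crystalObservable φ ψ r (starMul r (g₁ ω) (g₂ ω)) ∂P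
      = ∫ z in S, φ.eval ((hw z : ℝ) : ℂ) * (ψ.eval ((wt z : ℝ) : ℂ) * Z) := by
    induction φ using Polynomial.induction_on' with
    | add p q hp hq =>
      have e : ∀ g, crystalObservable (p + q) ψ r g
          = crystalObservable p ψ r g + crystalObservable q ψ r g := fun g => by
        simp only [crystalObservable, eval_add]
        ring
      simp only [e, eval_add, add_mul]
      rw [integral_add
        (integrable_comp_starMul h₁ h₂ (continuous_crystalObservable hr p ψ))
        (integrable_comp_starMul h₁ h₂ (continuous_crystalObservable hr q ψ)), integral_add
        (integrableOn_unitSquare (by fun_prop)) (integrableOn_unitSquare (by fun_prop)), hp, hq]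
    | monomial j a =>
      calc _ = a * ∫ ω, (((Real.arcosh (max (coshParam r (starMul r (g₁ ω) (g₂ ω))) 1) / r) ^ j
            : ℝ) : ℂ) * (((Real.exp (-(r * (starMul r (g₁ ω) (g₂ ω)).1)) : ℝ) : ℂ) *
            ψ.eval ((starMul r (g₁ ω) (g₂ ω)).1 : ℂ)) ∂P := by
            rw [← integral_const_mul]
            congr 1
            ext ω
            rw [crystalObservable, orbitParam_eq hr, max_eq_left (one_le_coshParam r _),
              eval_monomial, Complex.ofReal_pow]
            ring
        _ = _ := by
            rw [key, ← integral_const_mul]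
            refine setIntegral_congr_fun hSm fun z hz => ?_
            rw [max_eq_left (Real.one_le_cosh _), Real.arcosh_cosh
              (mul_nonneg hr.le (contHw_nonneg hΛ₁ hΛ₂ (hSub hz).1 (hSub hz).2)),
              mul_div_cancel_left₀ _ hr.ne', eval_monomial, Complex.ofReal_pow]
            ring
  rw [main, setIntegral_unitSquare (by fun_prop), continuousCorner_eq hΛ₁ hΛ₂,
    ← intervalIntegral.integral_mul_const]
  simp only [← intervalIntegral.integral_mul_const, mul_assoc]
  rfl

theorem integral_crystalObservable_one_ne_zero (h₁ : HasLaw g₁ (uniformOrbit r Λ₁) P)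
    (h₂ : HasLaw g₂ (uniformOrbit r Λ₂) P) :
    ∫ ω, crystalObservable 1 1 r (starMul r (g₁ ω) (g₂ ω)) ∂P ≠ 0 := by
  have h := integrable_comp_starMul (f := fun g => ((Real.exp (-(r * g.1)) : ℝ) : ℂ)) h₁ h₂
    (by fun_prop)
  have h' : Integrable (fun ω => Real.exp (-(r * (starMul r (g₁ ω) (g₂ ω)).1))) P := by
    exact h.re
  simp only [crystalObservable, eval_one, mul_one]
  rw [integral_complex_ofReal, Complex.ofReal_ne_zero]
  exact (integral_exp_pos h').ne'

end Square

end StaticLimits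

/-! ### The theorem -/

theorem mainTheorem2 (Λ₁ Λ₂ : ℝ) (hΛ₁ : 0 < Λ₁) (hΛ₂ : 0 < Λ₂)
    {Ω : Type*} [MeasurableSpace Ω] (P : Measure Ω) [IsProbabilityMeasure P]
    (g₁ g₂ : ℝ → Ω → StaticLimits.SU2Star)
    (hg₁ : ∀ r : ℝ, 0 ≤ r → HasLaw (g₁ r) (StaticLimits.uniformOrbit r Λ₁) P)
    (hg₂ : ∀ r : ℝ, 0 ≤ r → HasLaw (g₂ r) (StaticLimits.uniformOrbit r Λ₂) P)
    (hind : ∀ r : ℝ, 0 ≤ r → IndepFun (g₁ r) (g₂ r) P) :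
    -- one orbit
    (∀ r : ℝ, 0 ≤ r → ∀ 𝓕 : StaticLimits.Observable r,
      Integrable (fun ω => StaticLimits.modHbar r 𝓕 (g₁ r ω)) P ∧
      Tendsto (StaticLimits.weightedTrace r Λ₁ 𝓕) (𝓝[>] 0)
        (𝓝 (∫ ω, StaticLimits.modHbar r 𝓕 (g₁ r ω) ∂P))) ∧
    -- two orbits
    (∀ r : ℝ, 0 ≤ r → ∀ 𝓕 : StaticLimits.Observable r,
      Integrable (fun ω => StaticLimits.modHbar r 𝓕
        (StaticLimits.starMul r (g₁ r ω) (g₂ r ω))) P ∧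
      Tendsto (StaticLimits.weightedTrace₂ r Λ₁ Λ₂ 𝓕) (𝓝[>] 0)
        (𝓝 (∫ ω, StaticLimits.modHbar r 𝓕
          (StaticLimits.starMul r (g₁ r ω) (g₂ r ω)) ∂P))) ∧
    -- the commutative square
    (∀ φ ψ : ℂ[X],
      (∀ r : ℝ, 0 < r →
        Integrable (fun ω => StaticLimits.crystalObservable φ ψ r
          (StaticLimits.starMul r (g₁ r ω) (g₂ r ω))) P ∧
        Tendsto (fun ħ => StaticLimits.quantumCorner Λ₁ Λ₂ φ ψ r ħ) (𝓝[>] 0)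
          (𝓝 ((∫ ω, StaticLimits.crystalObservable φ ψ r
              (StaticLimits.starMul r (g₁ r ω) (g₂ r ω)) ∂P) /
            (∫ ω, StaticLimits.crystalObservable 1 1 r
              (StaticLimits.starMul r (g₁ r ω) (g₂ r ω)) ∂P)))) ∧
      (∀ ħ : ℝ, 0 < ħ →
        Tendsto (fun r => StaticLimits.quantumCorner Λ₁ Λ₂ φ ψ r ħ) atTop
          (𝓝 (StaticLimits.crystalCorner Λ₁ Λ₂ φ ψ ħ))) ∧
      Tendsto (StaticLimits.crystalCorner Λ₁ Λ₂ φ ψ) (𝓝[>] 0)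
        (𝓝 (StaticLimits.continuousCorner Λ₁ Λ₂ φ ψ)) ∧
      Tendsto (fun r => (∫ ω, StaticLimits.crystalObservable φ ψ r
              (StaticLimits.starMul r (g₁ r ω) (g₂ r ω)) ∂P) /
            (∫ ω, StaticLimits.crystalObservable 1 1 r
              (StaticLimits.starMul r (g₁ r ω) (g₂ r ω)) ∂P)) atTop
        (𝓝 (StaticLimits.continuousCorner Λ₁ Λ₂ φ ψ))) ∧
    -- the tensor product rule for the highest weight
    (∀ (ħ : ℝ), 0 < ħ → ∀ (n₁ n₂ : ℕ)
      (b : StaticLimits.Crystal n₁ × StaticLimits.Crystal n₂),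
      StaticLimits.tensorHw ħ n₁ n₂ b =
        max (ħ * n₁ + StaticLimits.crystalWt ħ n₂ b.2)
          (-StaticLimits.crystalWt ħ n₁ b.1 + ħ * n₂)) := by
  refine ⟨fun r hr 𝓕 => ?_, fun r hr 𝓕 => ?_, fun φ ψ => ⟨fun r hr => ?_, fun ħ hħ => ?_, ?_, ?_⟩,
    fun ħ hħ n₁ n₂ b => ?_⟩
  · have hc := StaticLimits.continuous_modHbar r 𝓕
    refine ⟨StaticLimits.integrable_comp_hasLaw (hg₁ r hr) hc, ?_⟩
    rw [StaticLimits.integral_comp_hasLaw (hg₁ r hr) hc]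
    exact StaticLimits.tendsto_weightedTrace hr hΛ₁ 𝓕
  · exact ⟨StaticLimits.integrable_comp_starMul (hg₁ r hr) (hg₂ r hr)
      (StaticLimits.continuous_modHbar r 𝓕), StaticLimits.tendsto_weightedTrace₂ hr hΛ₁ hΛ₂
        (hg₁ r hr) (hg₂ r hr) (hind r hr) 𝓕⟩
  · refine ⟨StaticLimits.integrable_comp_starMul (hg₁ r hr.le) (hg₂ r hr.le)
      (StaticLimits.continuous_crystalObservable hr φ ψ), ?_⟩
    rw [StaticLimits.integral_crystalObservable hr hΛ₁ hΛ₂ (hg₁ r hr.le) (hg₂ r hr.le)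
      (hind r hr.le), mul_div_cancel_right₀ _ (StaticLimits.integral_crystalObservable_one_ne_zero
        (hg₁ r hr.le) (hg₂ r hr.le))]
    -- The classical quotient has become the continuous corner, and the quantum corner is the
    -- crystal corner, so this is the convergence of crystal sums.
    refine (StaticLimits.tendsto_crystalCorner hΛ₁ hΛ₂ φ ψ).congr' ?_
    filter_upwards [self_mem_nhdsWithin] with ħ hħ
    exact (StaticLimits.quantumCorner_eq_crystalCorner Λ₁ Λ₂ φ ψ hr hħ).symm
  -- The quantum corner is constant on `r > 0`.
  · refine tendsto_const_nhds.congr' ?_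
    filter_upwards [eventually_gt_atTop 0] with r hr
    exact (StaticLimits.quantumCorner_eq_crystalCorner Λ₁ Λ₂ φ ψ hr hħ).symm
  · exact StaticLimits.tendsto_crystalCorner hΛ₁ hΛ₂ φ ψ
  -- The classical quotient is constant on `r > 0` as well.
  · refine tendsto_const_nhds.congr' ?_
    filter_upwards [eventually_gt_atTop 0] with r hr
    rw [StaticLimits.integral_crystalObservable hr hΛ₁ hΛ₂ (hg₁ r hr.le) (hg₂ r hr.le)
      (hind r hr.le), mul_div_cancel_right₀ _ (StaticLimits.integral_crystalObservable_one_ne_zero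
        (hg₁ r hr.le) (hg₂ r hr.le))]
  · rw [StaticLimits.tensorHw_eq hħ, StaticLimits.highestInt_real ħ hħ]
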